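/- Let $\nu_1,\dots,\nu_d\in\mathbb Z^m$ be such that $\Delta=\{x\in(\mathbb R^m)^*\mid \langle x,\nu_j\rangle+\tfrac12\ge 0,\ j=1,\dots,d\}$ is a compact Delzant polytope whose facets are exactly the sets $\{x \in \Delta \mid \langle x,\nu_j\rangle+\tfrac12=0\}$ (at each vertex the conormals of the facets through it form a $\mathbb Z$-basis of $\mathbb Z^m$); so $\Delta$ is the moment polytope, in normalized position, of a closed connected monotone symplectic toric manifold $N$. Assume that $N$ is even: $\sum_j\nu_j\in 2\mathbb Z^m$. Let $r\ge 0$ and $1\le k_i\le n_i$ for $i=1,\dots,r$, and suppose that $d>0$ or $r>0$ (that is, not both $N=\mathrm{pt}$ and $r=0$). Let $\mathfrak k=\{x\in\mathbb R^d\mid\sum_j x_j\nu_j=0\}$ and let $K=\{(e^{ix_1},\dots,e^{ix_d})\mid x\in\mathfrak k\}\subset (S^1)^d$. Let $D=d+\sum_i n_ik_i$ and let $G=K\times\prod_{i=1}^r U(k_i)\subset U(D)$, where $K$ is embedded as diagonal matrices and $A\in U(k_i)$ as the block-diagonal matrix with $n_i$ diagonal blocks equal to $A$; let $\mathfrak g$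 be its Lie algebra. On $\mathbb C^D$ let $\omega_{\rm std}=\sum_j dx_j\wedge dy_j$ and $\alpha_{{\rm std},z}=\tfrac12\omega_{\rm std}(z,\cdot)$, let $\Phi_G:\mathbb C^D\to\mathfrak g^*$, $\langle\Phi_G(z),X\rangle=\alpha_{{\rm std},z}(Xz)$, be the moment map, and let $p\in\mathfrak g^*$ be the restriction of $-\tfrac i2\mathrm{tr}$. Let $G_0$ be the identity component of $G\cap SU(D)$ and let $G_0^\tau$ be the subgroup of $G$ generated by $G_0$ and $-I\in G$. Put $V=\Phi_G^{-1}(p)/G_0^\tau$ and $M=\Phi_G^{-1}(p)/G$, with the quotient topologies, let $\widehat\chi:\Phi_G^{-1}(p)\to V$ and $\sigma:\Phi_G^{-1}(p)\to M$ be the quotient projections, and let $\pi:V\to M$ be the induced map. Then $\Phi_G^{-1}(p)$ is a smooth embedded submanifold of $\mathbb C^D$; $V$ and $M$ carry smooth manifold structures for which $\widehat\chi$ and $\sigma$ are smooth submersions; $G/G_0^\tau$ is isomorphic as a topological group to the circle $S^1$, which thereby acts on $V$; there are forms $\alpha\in\Omega^1(V)$ and $\omega\in\Omega^2(M)$ with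 $\widehat\chi^*\alpha=\alpha_{\rm std}|_{\Phi_G^{-1}(p)}$ and $\sigma^*\omega=\omega_{\rm std}|_{\Phi_G^{-1}(p)}$; and $(V,\alpha,\pi,M,\omega)$ is a prequantization bundle. That is: $V$ and $M$ are closed connected manifolds, $\omega$ is a symplectic form, $\pi:V\to M$ is a smooth principal $S^1$-bundle, and $\alpha$ is a smooth $S^1$-invariant connection form (it takes a constant positive value on the vector field on $V$ that generates the action of $S^1=G/G_0^\tau$, the circle being suitably oriented) with $d\alpha=\pi^*\omega$. -/

import Mathlib

open scoped Manifold ContDiff Kronecker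
open Matrix

/-! ### Differential forms on manifolds modelled on a normed space, prequantization bundles -/

section Forms

variable {E E' V M : Type*} [NormedAddCommGroup E] [NormedSpace ℝ E]
  [NormedAddCommGroup E'] [NormedSpace ℝ E']
  [TopologicalSpace V] [ChartedSpace E V] [TopologicalSpace M] [ChartedSpace E' M]

/-- A (not necessarily smooth) differential `q`-form on the manifold `V` modelled on `E`. -/
abbrev DiffForm (E V : Type*) [NormedAddCommGroup E] [NormedSpace ℝ E]
    [TopologicalSpace V] [ChartedSpace E V] (q : ℕ) : Type _ :=
  ∀ x : V, (TangentSpace 𝓘(ℝ, E) x) [⋀^Fin q]→L[ℝ] ℝ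

namespace DiffForm

/-- The pullback `f^* β` of a form along `f`. -/
noncomputable def pullback {q : ℕ} (f : V → M) (β : DiffForm E' M q) : DiffForm E V q :=
  fun x => (β (f x)).compContinuousLinearMap (mfderiv 𝓘(ℝ, E) 𝓘(ℝ, E') f x)

/-- The expression of a form in the chart at `x₀`: its pullback along the inverse of the chart.
Only its values on the (open) target of the chart are meaningful. -/
noncomputable def inChart {q : ℕ} (β : DiffForm E V q) (x₀ : V) : E → E [⋀^Fin q]→L[ℝ] ℝ :=
  fun y => (β ((extChartAt 𝓘(ℝ, E) x₀).symm y)).compContinuousLinearMap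
    (mfderiv 𝓘(ℝ, E) 𝓘(ℝ, E) (extChartAt 𝓘(ℝ, E) x₀).symm y)

/-- A form is smooth if it is smooth in all the charts. -/
def IsSmooth {q : ℕ} (β : DiffForm E V q) : Prop :=
  ∀ x₀ : V, ContDiffOn ℝ ∞ (β.inChart x₀) (extChartAt 𝓘(ℝ, E) x₀).target

/-- The exterior derivative of a form, computed at `x` in the chart at `x`. -/
noncomputable def d {q : ℕ} (β : DiffForm E V q) : DiffForm E V (q + 1) :=
  fun x => (extDeriv (β.inChart x) (extChartAt 𝓘(ℝ, E) x x)).compContinuousLinearMap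
    (mfderiv 𝓘(ℝ, E) 𝓘(ℝ, E) (extChartAt 𝓘(ℝ, E) x) x)

/-- A symplectic form: a smooth closed nondegenerate `2`-form. -/
structure IsSymplectic (β : DiffForm E V 2) : Prop where
  smooth : β.IsSmooth
  closed : β.d = 0
  nondegenerate : ∀ (x : V) (u : TangentSpace 𝓘(ℝ, E) x),
    (∀ v : TangentSpace 𝓘(ℝ, E) x, β x ![u, v] = 0) → u = 0

end DiffForm

/-- `π : V → M` is a smooth principal bundle for the given action of the circle on `V`:
the action is smooth, and `π` has smooth equivariant local trivializations. -/
structure IsPrincipalCircleBundle (E E' : Type*) {V M : Type*}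
    [NormedAddCommGroup E] [NormedSpace ℝ E] [NormedAddCommGroup E'] [NormedSpace ℝ E']
    [TopologicalSpace V] [ChartedSpace E V] [TopologicalSpace M] [ChartedSpace E' M]
    [MulAction Circle V] (π : V → M) : Prop where
  smooth_smul : ContMDiffSMul (𝓡 1) 𝓘(ℝ, E) ∞ Circle V
  smooth_proj : ContMDiff 𝓘(ℝ, E) 𝓘(ℝ, E') ∞ π
  proj_smul : ∀ (a : Circle) (v : V), π (a • v) = π v
  locallyTrivial : ∀ x : M, ∃ e : Bundle.Trivialization Circle π, x ∈ e.baseSet ∧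
    ContMDiffOn 𝓘(ℝ, E) (𝓘(ℝ, E').prod (𝓡 1)) ∞ e e.source ∧
    ContMDiffOn (𝓘(ℝ, E').prod (𝓡 1)) 𝓘(ℝ, E) ∞ e.toOpenPartialHomeomorph.symm e.target ∧
    ∀ (a : Circle), ∀ v ∈ e.source, e (a • v) = ((e v).1, a * (e v).2)

/-- `(V, α, π, M, Ω)` is a prequantization bundle: `V` and `M` are closed connected manifolds,
`Ω` is a symplectic form on `M`, `π : V → M` is a principal circle bundle, and `α` is a smooth
invariant connection form on `V` with `dα = π^* Ω`.

The circle carries the parameter `s ↦ e^{is}`. A connection form is real-valued after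
an identification of the Lie algebra of the circle with `ℝ`, that is, `α` takes a constant positive
value `c` on the vector field generating the action; so the Reeb vector field of `α` generates the
action of the circle `ℝ / 2πcℤ`, acting through `s ↦ e^{is/c}`. -/
structure IsPrequantizationBundle [MulAction Circle V]
    (α : DiffForm E V 1) (π : V → M) (Ω : DiffForm E' M 2) : Prop where
  isManifold_total : IsManifold 𝓘(ℝ, E) ∞ V
  isManifold_base : IsManifold 𝓘(ℝ, E') ∞ M
  t2_total : T2Space V
  t2_base : T2Space M
  compact_total : CompactSpace V
  compact_base : CompactSpace M
  connected_total : ConnectedSpace V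
  connected_base : ConnectedSpace M
  symplectic : Ω.IsSymplectic
  principal : IsPrincipalCircleBundle E E' π
  smooth : α.IsSmooth
  invariant : ∀ a : Circle, α.pullback (fun v : V => a • v) = α
  connection : ∃ c : ℝ, 0 < c ∧ ∀ v : V,
    α (Circle.exp 0 • v)
      ![mfderiv 𝓘(ℝ, ℝ) 𝓘(ℝ, E) (fun s : ℝ => Circle.exp s • v) 0 (1 : ℝ)] = c
  curvature : α.d = Ω.pullback π

end Forms

/-! ### The moment polytope of the toric factor -/

section Polytope

variable {m d : ℕ}

/-- The polytope `{x | ⟨x, ν_j⟩ + 1/2 ≥ 0 for all j}` in the dual of `ℝ^m`. -/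
def monotonePolytope (ν : Fin d → Fin m → ℤ) : Set (Fin m → ℝ) :=
  {x | ∀ j, 0 ≤ ∑ l, x l * (ν j l : ℝ) + 1 / 2}

/-- The face of `monotonePolytope ν` on which the `j`-th inequality is an equality. -/
def monotonePolytopeFace (ν : Fin d → Fin m → ℤ) (j : Fin d) : Set (Fin m → ℝ) :=
  {x ∈ monotonePolytope ν | ∑ l, x l * (ν j l : ℝ) + 1 / 2 = 0}

/-- `monotonePolytope ν` is a Delzant polytope with facets in bijection with the `ν_j`: it is
compact, every `ν_j` is the conormal of a face of codimension one, and at every vertex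
the conormals of the facets through it form a basis of the lattice `ℤ^m`
(so the `ν_j` are primitive and the facets are pairwise distinct). -/
structure IsMonotoneDelzant (ν : Fin d → Fin m → ℤ) : Prop where
  compact : IsCompact (monotonePolytope ν)
  facet : ∀ j, (monotonePolytopeFace ν j).Nonempty ∧
    Module.finrank ℝ (vectorSpan ℝ (monotonePolytopeFace ν j)) + 1 = m
  smooth : ∀ x ∈ (monotonePolytope ν).extremePoints ℝ,
    LinearIndependent ℤ (fun j : {j // x ∈ monotonePolytopeFace ν j} => ν j) ∧
    Submodule.span ℤ (Set.range fun j : {j // x ∈ monotonePolytopeFace ν j} => ν j) = ⊤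

end Polytope

/-! ### The group `G = K × ∏ U(k_i)` acting on `ℂ^D` -/

namespace ToricGrassmann

variable {m d r : ℕ} (ν : Fin d → Fin m → ℤ) (n k : Fin r → ℕ)

/-- The Lie algebra `𝔨 = ker β ⊆ ℝ^d`, where `β e_j = ν_j`. -/
def kerBeta : Submodule ℝ (Fin d → ℝ) where
  carrier := {x | ∀ l, ∑ j, x j * (ν j l : ℝ) = 0}
  zero_mem' := by simp
  add_mem' {x y} hx hy l := by
    have h1 := hx l
    have h2 := hy l
    simp only [Pi.add_apply, add_mul, Finset.sum_add_distrib, h1, h2, add_zero]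
  smul_mem' c x hx l := by
    have h1 := hx l
    simp only [Pi.smul_apply, smul_eq_mul, mul_assoc, ← Finset.mul_sum, h1, mul_zero]

/-- The subtorus `K = exp 𝔨` of `(S^1)^d`. -/
noncomputable def torusK : Subgroup (Fin d → Circle) where
  carrier := {t | ∃ x ∈ kerBeta ν, t = fun j => Circle.exp (x j)}
  one_mem' := ⟨0, (kerBeta ν).zero_mem, by ext; simp⟩
  mul_mem' := by
    rintro _ _ ⟨x, hx, rfl⟩ ⟨y, hy, rfl⟩
    exact ⟨x + y, (kerBeta ν).add_mem hx hy, by funext j; simp [Circle.exp_add]⟩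
  inv_mem' := by
    rintro _ ⟨x, hx, rfl⟩
    exact ⟨-x, (kerBeta ν).neg_mem hx, by funext j; simp [Circle.exp_neg]⟩

/-- The compact Lie group `G = K × ∏ U(k_i)`. -/
abbrev G : Type := torusK ν × (∀ i, Matrix.unitaryGroup (Fin (k i)) ℂ)

/-- The index set of the coordinates of `ℂ^D = ℂ^d × ∏ ℂ^{n_i × k_i}`. -/
abbrev Idx (d : ℕ) (n k : Fin r → ℕ) : Type := Fin d ⊕ (Σ i : Fin r, Fin (n i) × Fin (k i))

/-- The block-diagonal matrix of size `D` with blocks `diag t` and, for each `i`,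
`n_i` diagonal blocks equal to `A_i`. -/
def blockMatrix (t : Fin d → ℂ) (A : ∀ i, Matrix (Fin (k i)) (Fin (k i)) ℂ) :
    Matrix (Idx d n k) (Idx d n k) ℂ :=
  Matrix.fromBlocks (Matrix.diagonal t) 0 0
    (Matrix.blockDiagonal' fun i => (1 : Matrix (Fin (n i)) (Fin (n i)) ℂ) ⊗ₖ A i)

theorem blockMatrix_mul (t s : Fin d → ℂ) (A B : ∀ i, Matrix (Fin (k i)) (Fin (k i)) ℂ) :
    blockMatrix n k t A * blockMatrix n k s B = blockMatrix n k (t * s) (A * B) := by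
  simp only [blockMatrix, Matrix.fromBlocks_multiply, Matrix.zero_mul, Matrix.mul_zero,
    add_zero, zero_add, ← Matrix.blockDiagonal'_mul, ← Matrix.mul_kronecker_mul, mul_one,
    Matrix.diagonal_mul_diagonal]
  rfl

theorem blockMatrix_one : blockMatrix n k (1 : Fin d → ℂ) 1 = 1 := by
  have h : (fun i => (1 : Matrix (Fin (n i)) (Fin (n i)) ℂ) ⊗ₖ
      (1 : ∀ i, Matrix (Fin (k i)) (Fin (k i)) ℂ) i) = 1 := by
    funext i; simp
  simp only [blockMatrix, h, Matrix.blockDiagonal'_one]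
  simp [Matrix.fromBlocks_one]

theorem blockMatrix_conjTranspose (t : Fin d → ℂ)
    (A : ∀ i, Matrix (Fin (k i)) (Fin (k i)) ℂ) :
    (blockMatrix n k t A)ᴴ = blockMatrix n k (star t) (fun i => (A i)ᴴ) := by
  simp [blockMatrix, Matrix.fromBlocks_conjTranspose, Matrix.blockDiagonal'_conjTranspose,
    Matrix.conjTranspose_kronecker]

/-- The embedding of `G` into the unitary matrices of size `D`. -/
noncomputable def embed : G ν k →* Matrix (Idx d n k) (Idx d n k) ℂ where
  toFun g := blockMatrix n k (fun j => ((g.1 : Fin d → Circle) j : ℂ))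
    (fun i => (g.2 i : Matrix (Fin (k i)) (Fin (k i)) ℂ))
  map_one' := blockMatrix_one n k
  map_mul' _ _ := (blockMatrix_mul n k _ _ _ _).symm

/-- The Lie algebra `𝔤 = 𝔨 ⊕ ⨁ 𝔲(k_i)`. -/
def lieG : Submodule ℝ ((Fin d → ℝ) × (∀ i, Matrix (Fin (k i)) (Fin (k i)) ℂ)) where
  carrier := {X | X.1 ∈ kerBeta ν ∧ ∀ i, (X.2 i)ᴴ = -X.2 i}
  zero_mem' := ⟨(kerBeta ν).zero_mem, by simp⟩
  add_mem' hX hY := ⟨(kerBeta ν).add_mem hX.1 hY.1, fun i => by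
    simp [Matrix.conjTranspose_add, hX.2 i, hY.2 i, add_comm]⟩
  smul_mem' c X hX := ⟨(kerBeta ν).smul_mem c hX.1, fun i => by
    simp [Matrix.conjTranspose_smul, hX.2 i]⟩

theorem blockMatrix_add (t s : Fin d → ℂ) (A B : ∀ i, Matrix (Fin (k i)) (Fin (k i)) ℂ) :
    blockMatrix n k (t + s) (A + B) = blockMatrix n k t A + blockMatrix n k s B := by
  have h : (fun i => (1 : Matrix (Fin (n i)) (Fin (n i)) ℂ) ⊗ₖ (A + B) i) =
      (fun i => (1 : Matrix (Fin (n i)) (Fin (n i)) ℂ) ⊗ₖ A i) +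
      (fun i => (1 : Matrix (Fin (n i)) (Fin (n i)) ℂ) ⊗ₖ B i) := by
    funext i; simp [Matrix.kronecker_add]
  simp only [blockMatrix, h, Matrix.blockDiagonal'_add, Matrix.fromBlocks_add, add_zero,
    Matrix.diagonal_add]
  rfl

theorem blockMatrix_smul (c : ℝ) (t : Fin d → ℂ) (A : ∀ i, Matrix (Fin (k i)) (Fin (k i)) ℂ) :
    blockMatrix n k (c • t) (c • A) = c • blockMatrix n k t A := by
  have h : (fun i => (1 : Matrix (Fin (n i)) (Fin (n i)) ℂ) ⊗ₖ (c • A) i) =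
      c • (fun i => (1 : Matrix (Fin (n i)) (Fin (n i)) ℂ) ⊗ₖ A i) := by
    funext i; simp [Matrix.kronecker_smul]
  simp only [blockMatrix, h, Matrix.blockDiagonal'_smul, Matrix.fromBlocks_smul, smul_zero,
    Matrix.diagonal_smul]

/-- The inclusion `𝔤 → 𝔲(D)`, the differential of `embed`. -/
noncomputable def lieEmbed : lieG ν k →ₗ[ℝ] Matrix (Idx d n k) (Idx d n k) ℂ where
  toFun X := blockMatrix n k (fun j => Complex.I * (X.1.1 j : ℂ)) X.1.2
  map_add' X Y := by
    rw [← blockMatrix_add]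
    congr 1
    funext j; simp [mul_add]
  map_smul' c X := by
    rw [RingHom.id_apply, ← blockMatrix_smul]
    congr 1
    funext j; simp; ring

/-- The standard symplectic form `ω_std(u, v) = Im (u^* v)`, that is `∑ dx_j ∧ dy_j`. -/
noncomputable def stdSymplectic {ι : Type*} [Fintype ι] (u v : ι → ℂ) : ℝ := (star u ⬝ᵥ v).im

/-- The Liouville form `α_std` at `z`, evaluated on `v`. -/
noncomputable def stdLiouville {ι : Type*} [Fintype ι] (z v : ι → ℂ) : ℝ :=
  1 / 2 * stdSymplectic z v

/-- The moment map `Φ_G : ℂ^D → 𝔤^*`, `⟨Φ_G(z), X⟩ = α_std(Xz)`. -/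
noncomputable def momentMap (z : Idx d n k → ℂ) : Module.Dual ℝ (lieG ν k) where
  toFun X := stdLiouville z (lieEmbed ν n k X *ᵥ z)
  map_add' X Y := by
    simp [stdLiouville, stdSymplectic, Matrix.add_mulVec, dotProduct_add, mul_add]
  map_smul' c X := by
    simp [stdLiouville, stdSymplectic, Matrix.smul_mulVec, dotProduct_smul]; ring

/-- The element `p ∈ 𝔤^*`, the restriction of `-(i/2) tr` on `𝔲(D)`. -/
noncomputable def momentValue : Module.Dual ℝ (lieG ν k) where
  toFun X := (-(Complex.I / 2) * (lieEmbed ν n k X).trace).re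
  map_add' X Y := by simp [Matrix.trace_add]; ring
  map_smul' c X := by simp [Matrix.trace_smul]; ring

/-- The level set `Φ_G⁻¹(p)`. -/
def Level : Set (Idx d n k → ℂ) := momentMap ν n k ⁻¹' {momentValue ν n k}

theorem embed_conjTranspose_mul (g : G ν k) : (embed ν n k g)ᴴ * embed ν n k g = 1 := by
  have h1 : (star fun j => ((g.1 : Fin d → Circle) j : ℂ)) *
      (fun j => ((g.1 : Fin d → Circle) j : ℂ)) = 1 := by
    funext j
    simp [← Circle.coe_inv_eq_conj]
  have h2 : (fun i => (g.2 i : Matrix (Fin (k i)) (Fin (k i)) ℂ)ᴴ) *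
      (fun i => (g.2 i : Matrix (Fin (k i)) (Fin (k i)) ℂ)) = 1 := by
    funext i
    exact Matrix.mem_unitaryGroup_iff'.1 (g.2 i).2
  change (blockMatrix n k _ _)ᴴ * blockMatrix n k _ _ = 1
  rw [blockMatrix_conjTranspose, blockMatrix_mul, h1, h2, blockMatrix_one]

/-- The coadjoint-equivariance that makes the level set invariant. -/
theorem exists_conj (g : G ν k) (X : lieG ν k) : ∃ Y : lieG ν k,
    lieEmbed ν n k Y = (embed ν n k g)ᴴ * lieEmbed ν n k X * embed ν n k g := by
  refine ⟨⟨(X.1.1, fun i => (g.2 i : Matrix (Fin (k i)) (Fin (k i)) ℂ)ᴴ * X.1.2 i *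
    (g.2 i : Matrix (Fin (k i)) (Fin (k i)) ℂ)), X.2.1, fun i => ?_⟩, ?_⟩
  · simp [Matrix.conjTranspose_mul, X.2.2 i, mul_assoc]
  · change blockMatrix n k _ _ = (blockMatrix n k _ _)ᴴ * blockMatrix n k _ _ * blockMatrix n k _ _
    rw [blockMatrix_conjTranspose, blockMatrix_mul, blockMatrix_mul]
    congr 1
    funext j
    have h1 : (starRingEnd ℂ) ((g.1 : Fin d → Circle) j : ℂ) * ((g.1 : Fin d → Circle) j : ℂ) = 1 := by
      simp [← Circle.coe_inv_eq_conj]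
    simp only [Pi.mul_apply, Pi.star_apply, RCLike.star_def]
    rw [mul_right_comm, h1, one_mul]

theorem embed_mulVec_mem (g : G ν k) {z : Idx d n k → ℂ} (hz : z ∈ Level ν n k) :
    embed ν n k g *ᵥ z ∈ Level ν n k := by
  have hz' : momentMap ν n k z = momentValue ν n k := hz
  change momentMap ν n k (embed ν n k g *ᵥ z) = momentValue ν n k
  ext X
  obtain ⟨Y, hY⟩ := exists_conj ν n k g X
  have h1 : momentMap ν n k (embed ν n k g *ᵥ z) X = momentMap ν n k z Y := by
    simp only [momentMap, LinearMap.coe_mk, AddHom.coe_mk, stdLiouville, stdSymplectic, hY,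
      Matrix.star_mulVec, Matrix.dotProduct_mulVec,
      Matrix.vecMul_vecMul]
  have h2 : momentValue ν n k Y = momentValue ν n k X := by
    have h3 := mul_eq_one_comm.1 (embed_conjTranspose_mul ν n k g)
    simp only [momentValue, LinearMap.coe_mk, AddHom.coe_mk, hY]
    rw [Matrix.trace_mul_comm, ← mul_assoc, h3, one_mul]
  rw [h1, hz', h2]

noncomputable instance : MulAction (G ν k) (Level ν n k) where
  smul g z := ⟨embed ν n k g *ᵥ z.1, embed_mulVec_mem ν n k g z.2⟩
  one_smul z := Subtype.ext (by
    change embed ν n k 1 *ᵥ z.1 = z.1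
    rw [map_one, Matrix.one_mulVec])
  mul_smul g h z := Subtype.ext (by
    change embed ν n k (g * h) *ᵥ z.1 = embed ν n k g *ᵥ (embed ν n k h *ᵥ z.1)
    rw [map_mul, Matrix.mulVec_mulVec])

/-- The subgroup `G ∩ SU(D)`. -/
noncomputable def specialG : Subgroup (G ν k) := (Matrix.detMonoidHom.comp (embed ν n k)).ker

/-- `G_0`, the identity component of `G ∩ SU(D)`. -/
noncomputable def G0 : Subgroup (G ν k) :=
  (Subgroup.connectedComponentOfOne (specialG ν n k)).map (specialG ν n k).subtype

/-- `G_0^τ`, the subgroup of `G` generated by `G_0` and `-I`. -/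
noncomputable def G0tau : Subgroup (G ν k) :=
  Subgroup.closure ((G0 ν n k : Set (G ν k)) ∪ {g | embed ν n k g = -1})

/-- The total space `V = Φ_G⁻¹(p) / G_0^τ`. -/
def TotalSpace : Type := MulAction.orbitRel.Quotient (G0tau ν n k) (Level ν n k)

/-- The base `M = Φ_G⁻¹(p) / G`. -/
def Base : Type := MulAction.orbitRel.Quotient (G ν k) (Level ν n k)

instance : TopologicalSpace (TotalSpace ν n k) :=
  inferInstanceAs (TopologicalSpace (Quotient (MulAction.orbitRel (G0tau ν n k) (Level ν n k))))

instance : TopologicalSpace (Base ν n k) :=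
  inferInstanceAs (TopologicalSpace (Quotient (MulAction.orbitRel (G ν k) (Level ν n k))))

/-- The quotient projection `Φ_G⁻¹(p) → V`. -/
noncomputable def toTotalSpace (z : Level ν n k) : TotalSpace ν n k :=
  Quotient.mk (MulAction.orbitRel (G0tau ν n k) (Level ν n k)) z

/-- The quotient projection `Φ_G⁻¹(p) → M`. -/
noncomputable def toBase (z : Level ν n k) : Base ν n k :=
  Quotient.mk (MulAction.orbitRel (G ν k) (Level ν n k)) z

/-- The projection `π : V → M`. -/
noncomputable def proj : TotalSpace ν n k → Base ν n k :=
  Quotient.lift (toBase ν n k) (by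
    rintro a b ⟨g, hg⟩
    exact Quotient.sound ⟨(g : G ν k), hg⟩)

end ToricGrassmann

/-! The proof rests on a local form of freeness of the `G`-action. At a vertex of Δ the conormals
form a ℤ-basis, which gives an integer projection `P` of ℝ^d onto 𝔨 (`exists_isTorusRetraction`), so
that K is the closed subtorus t_l = ∏_j t_j^{P_{jl}}. For a point of Δ the vertex can be chosen on
all facets through that point, and then the rows of `P` indexed by those facets vanish. The level
set consists of the z with |z_j|² = 2⟨x,ν_j⟩ + 1 for some x ∈ Δ and with Gram matrices n_i·I
(`mem_level_iff`). It is a continuous image of (S¹)^d × Δ × ∏U(n_i), hence compact and connected.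

Near a point z₀ of the level set, the phases of the coordinates not vanishing at z₀, recombined by
`P`, and the unitary polar factors of the matrices of inner products with z₀ form a smooth
equivariant map Γ to `G` (`exists_equivariantMap`). Differentiating equivariance recovers X from Xz,
so p is a regular value of the moment map. The equation Γ = 1 cuts a slice out of the level set
(`exists_slice`). Slices give charts of M; a slice together with the angle of θ(Γ z) gives charts of
V, and Γ also yields the local trivializations of π. Smoothness of maps into `G` is always tested in
the ambient algebra `Coords`, where inversion on `G` is a real-linear involution, so no manifold
structure on `G` is used.

The circle: restricted to `G`, the determinant is χ^e for a primitive character χ. The kernel of χ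
is connected, hence equal to G_0. Evenness of N puts −I in `G`, and θ is χ or χ² according as χ(−I)
is 1 or −1 (`exists_character_ker_eq`). That det is not locally constant on `G` follows from
compactness of Δ if d > 0, and from the scalars in the unitary factors if r > 0.

The forms: on the level set α_std(Xz) = p(X), which is half the derivative of det along X and thus a
positive multiple of the derivative of θ. So α_std kills the directions of G_0^τ, descends to V, and
is a positive constant on the generator of the circle action (`isBasicForm_liouvilleForm`,
`form_generator`). Orbit directions are ω-orthogonal to the level set, so ω_std = dα_std descends to
M, and dα = π^*ω holds because both sides pull back dα_std along the same lift. A tangent vector of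
the level set which is ω-orthogonal to it lies in the double orthogonal of the orbit directions,
which is the space of orbit directions; it dies in M, so ω is nondegenerate (`form_nondegenerate`).
-/

/-! ### Smooth structures on quotients of subsets of a vector space -/

section QuotientCharts

open Set Filter Topology

variable {E F X : Type*} [NormedAddCommGroup E] [NormedSpace ℝ E]
  [NormedAddCommGroup F] [NormedSpace ℝ F] [TopologicalSpace X] {Z : Set E}

/-- A chart of the quotient of `Z ⊆ E` by a map `q : Z → X`: a `q`-invariant smooth map `coord`
together with a smooth local section `lift`, inverse to each other modulo `q`. -/
structure QuotientChart (F : Type*) [NormedAddCommGroup F] [NormedSpace ℝ F] (q : Z → X) where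
  dom : Set E
  cod : Set F
  coord : E → F
  lift : F → Z
  isOpen_dom : IsOpen dom
  isOpen_cod : IsOpen cod
  contDiffOn_coord : ContDiffOn ℝ ∞ coord dom
  contDiffOn_lift : ContDiffOn ℝ ∞ (fun w => (lift w : E)) cod
  coord_mem : ∀ z : Z, (z : E) ∈ dom → coord z ∈ cod
  lift_mem : ∀ w ∈ cod, (lift w : E) ∈ dom
  coord_lift : ∀ w ∈ cod, coord (lift w) = w
  quot_lift_coord : ∀ z : Z, (z : E) ∈ dom → q (lift (coord z)) = q z
  saturated : ∀ z z' : Z, q z = q z' → (z : E) ∈ dom → (z' : E) ∈ dom ∧ coord z' = coord z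

namespace QuotientChart

variable {q : Z → X} (C : QuotientChart F q)

/-- The chart of the quotient. -/
noncomputable def toChart (hq : IsOpenQuotientMap q) : OpenPartialHomeomorph X F where
  toFun x := C.coord (Function.surjInv hq.surjective x : Z)
  invFun w := q (C.lift w)
  source := q '' {z | (z : E) ∈ C.dom}
  target := C.cod
  map_source' := by
    rintro _ ⟨z, hz, rfl⟩
    exact C.coord_mem _ (C.saturated _ _ (Function.surjInv_eq hq.surjective (q z)).symm hz).1
  map_target' w hw := ⟨_, C.lift_mem w hw, rfl⟩
  left_inv' := by
    rintro _ ⟨z, hz, rfl⟩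
    have h := (C.saturated _ _ (Function.surjInv_eq hq.surjective (q z)).symm hz).1
    rw [C.quot_lift_coord _ h, Function.surjInv_eq hq.surjective]
  right_inv' w hw := by
    rw [(C.saturated _ _ (Function.surjInv_eq hq.surjective (q (C.lift w))).symm
      (C.lift_mem w hw)).2, C.coord_lift w hw]
  open_source := hq.isOpenMap _ (C.isOpen_dom.preimage continuous_subtype_val)
  open_target := C.isOpen_cod
  continuousOn_toFun := by
    have ho : IsOpen (q '' {z | (z : E) ∈ C.dom}) :=
      hq.isOpenMap _ (C.isOpen_dom.preimage continuous_subtype_val)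
    rintro _ ⟨z, hz, rfl⟩
    refine ContinuousAt.continuousWithinAt ?_
    rw [← hq.continuousAt_comp_iff]
    have h1 : ContinuousAt (fun z : Z => C.coord z) z :=
      ContinuousAt.comp (f := Subtype.val) (g := C.coord)
        (C.contDiffOn_coord.continuousOn.continuousAt (C.isOpen_dom.mem_nhds hz))
        continuous_subtype_val.continuousAt
    refine h1.congr ?_
    filter_upwards [(C.isOpen_dom.preimage continuous_subtype_val).mem_nhds hz] with z' hz'
    exact (C.saturated _ _ (Function.surjInv_eq hq.surjective (q z')).symm hz').2.symm
  continuousOn_invFun := hq.continuous.comp_continuousOn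
    (continuousOn_iff_continuous_domRestrict.2 (by
      refine continuous_induced_rng.2 ?_
      exact continuousOn_iff_continuous_domRestrict.1 C.contDiffOn_lift.continuousOn))

theorem toChart_source (hq : IsOpenQuotientMap q) (z : Z) :
    q z ∈ (C.toChart hq).source ↔ (z : E) ∈ C.dom :=
  ⟨fun ⟨_, hz', h⟩ => (C.saturated _ _ h hz').1, fun h => ⟨z, h, rfl⟩⟩

theorem toChart_apply (hq : IsOpenQuotientMap q) {z : Z} (hz : (z : E) ∈ C.dom) :
    C.toChart hq (q z) = C.coord z :=
  (C.saturated _ _ (Function.surjInv_eq hq.surjective (q z)).symm hz).2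

/-- On the overlap the transition map is `C'.coord` after `C.lift`, a composite of smooth maps
between normed spaces. Hence any two quotient charts are compatible, with no further condition. -/
theorem contDiffOn_transition (hq : IsOpenQuotientMap q) (C' : QuotientChart F q) :
    ContDiffOn ℝ ∞ ((C.toChart hq).symm ≫ₕ C'.toChart hq)
      ((C.toChart hq).symm ≫ₕ C'.toChart hq).source := by
  have h1 : ∀ w ∈ ((C.toChart hq).symm ≫ₕ C'.toChart hq).source,
      w ∈ C.cod ∧ (C.lift w : E) ∈ C'.dom := by
    intro w hw
    rw [OpenPartialHomeomorph.trans_source] at hw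
    exact ⟨hw.1, (C'.toChart_source hq _).1 hw.2⟩
  have h2 : ContDiffOn ℝ ∞ (fun w => C'.coord (C.lift w))
      ((C.toChart hq).symm ≫ₕ C'.toChart hq).source :=
    C'.contDiffOn_coord.comp (C.contDiffOn_lift.mono fun w hw => (h1 w hw).1)
      fun w hw => (h1 w hw).2
  exact h2.congr fun w hw => C'.toChart_apply hq (h1 w hw).2

end QuotientChart

/-- The smooth structure on `X` is the quotient structure for `q : Z → X`. -/
structure IsSmoothQuotient (F : Type*) [NormedAddCommGroup F] [NormedSpace ℝ F]
    [ChartedSpace F X] (q : Z → X) : Prop where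
  isOpenQuotientMap : IsOpenQuotientMap q
  exists_chart : ∀ z : Z, ∃ C : QuotientChart F q, (z : E) ∈ C.dom ∧
    C.lift (C.coord z) = z ∧ C.toChart isOpenQuotientMap ∈ atlas F X
  of_mem_atlas : ∀ e ∈ atlas F X, ∃ C : QuotientChart F q, C.toChart isOpenQuotientMap = e

/-- One chart per point suffices, compatibility being automatic. The lift is required to return `z`
itself and not merely a point of its fibre, so that there is a smooth local section through every
prescribed point; this is what makes the projections submersions. -/
theorem exists_isSmoothQuotient {q : Z → X} (hq : IsOpenQuotientMap q)
    (h : ∀ z : Z, ∃ C : QuotientChart F q, (z : E) ∈ C.dom ∧ C.lift (C.coord z) = z) :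
    ∃ _ : ChartedSpace F X, IsSmoothQuotient F q := by
  choose C hC hC' using h
  let inst : ChartedSpace F X :=
    { atlas := range fun z => (C z).toChart hq
      chartAt := fun x => (C (Function.surjInv hq.surjective x)).toChart hq
      mem_chart_source := fun x =>
        ⟨_, hC (Function.surjInv hq.surjective x), Function.surjInv_eq hq.surjective x⟩
      chart_mem_atlas := fun x => mem_range_self _ }
  exact ⟨inst, hq, fun z => ⟨C z, hC z, hC' z, mem_range_self _⟩, fun e ⟨z, hz⟩ => ⟨C z, hz⟩⟩

namespace IsSmoothQuotient

variable [ChartedSpace F X] {q : Z → X} (h : IsSmoothQuotient F q)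
include h

theorem isManifold : IsManifold 𝓘(ℝ, F) ∞ X := by
  refine isManifold_of_contDiffOn _ _ _ fun e e' he he' => ?_
  obtain ⟨C, rfl⟩ := h.of_mem_atlas e he
  obtain ⟨C', rfl⟩ := h.of_mem_atlas e' he'
  simpa using C.contDiffOn_transition h.isOpenQuotientMap C'

variable {E' H N : Type*} [NormedAddCommGroup E'] [NormedSpace ℝ E'] [TopologicalSpace H]
  {I : ModelWithCorners ℝ E' H} [TopologicalSpace N] [ChartedSpace H N]

/-- Maps which lift smoothly to `Z` are smooth. -/
theorem contMDiffAt_comp {g : N → Z} {y : N}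
    (hg : ContMDiffAt I 𝓘(ℝ, E) ∞ (fun t => (g t : E)) y) :
    ContMDiffAt I 𝓘(ℝ, F) ∞ (fun t => q (g t)) y := by
  have := h.isManifold
  have hgc : ContinuousAt g y := Topology.IsInducing.subtypeVal.continuousAt_iff.2 hg.continuousAt
  have hqc : ContinuousAt (fun t => q (g t)) y :=
    h.isOpenQuotientMap.continuous.continuousAt.comp hgc
  obtain ⟨C, hC⟩ := h.of_mem_atlas _ (chart_mem_atlas F (q (g y)))
  have hy : (g y : E) ∈ C.dom := by
    rw [← C.toChart_source h.isOpenQuotientMap, hC]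
    exact mem_chart_source F _
  rw [contMDiffAt_iff_target]
  refine ⟨hqc, ?_⟩
  have h1 : ContMDiffAt I 𝓘(ℝ, F) ∞ (fun t => C.coord (g t)) y :=
    ContMDiffAt.comp (I' := 𝓘(ℝ, E)) y (g := C.coord) (f := fun t => (g t : E))
      (C.contDiffOn_coord.contDiffAt (C.isOpen_dom.mem_nhds hy)).contMDiffAt hg
  refine h1.congr_of_eventuallyEq ?_
  filter_upwards [hg.continuousAt.preimage_mem_nhds (C.isOpen_dom.mem_nhds hy)] with t ht
  simp only [Function.comp_apply, extChartAt, mfld_simps, ← hC]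
  exact C.toChart_apply _ ht

/-- Smooth local sections. -/
theorem exists_section (z : Z) : ∃ sec : X → Z, sec (q z) = z ∧
    (∀ᶠ x in 𝓝 (q z), q (sec x) = x ∧ ContMDiffAt 𝓘(ℝ, F) 𝓘(ℝ, E) ∞ (fun x => (sec x : E)) x) := by
  have := h.isManifold
  obtain ⟨C, hz, hC, hCa⟩ := h.exists_chart z
  set e := C.toChart h.isOpenQuotientMap with he
  have hez : q z ∈ e.source := (C.toChart_source _ z).2 hz
  refine ⟨fun x => C.lift (e x), (congrArg C.lift (C.toChart_apply _ hz)).trans hC, ?_⟩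
  filter_upwards [e.open_source.mem_nhds hez] with x hx
  refine ⟨e.left_inv hx, ?_⟩
  have h1 : ContMDiffAt 𝓘(ℝ, F) 𝓘(ℝ, F) ∞ e x :=
    (contMDiffOn_of_mem_maximalAtlas (IsManifold.subset_maximalAtlas hCa)).contMDiffAt
      (e.open_source.mem_nhds hx)
  exact ContMDiffAt.comp (I' := 𝓘(ℝ, F)) x (g := fun w => (C.lift w : E)) (f := e)
      (C.contDiffOn_lift.contDiffAt (C.isOpen_cod.mem_nhds (e.map_source hx))).contMDiffAt h1

theorem mdifferentiableAt_comp {g : N → Z} {y : N}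
    (hg : ContMDiffAt I 𝓘(ℝ, E) ∞ (fun t => (g t : E)) y) :
    MDifferentiableAt I 𝓘(ℝ, F) (fun t => q (g t)) y :=
  (h.contMDiffAt_comp hg).mdifferentiableAt (by simp)

/-- A map out of a smooth quotient is smooth if its composition with the local sections is. -/
theorem contMDiffAt_of_lift {f : X → N} {z : Z} {g : E → N} (hg : ContMDiffAt 𝓘(ℝ, E) I ∞ g z)
    (hfg : ∀ᶠ z' : Z in 𝓝 z, f (q z') = g z') : ContMDiffAt 𝓘(ℝ, F) I ∞ f (q z) := by
  obtain ⟨sec, hsec, hs⟩ := h.exists_section z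
  have hsz := hs.self_of_nhds.2
  have h1 : ContMDiffAt 𝓘(ℝ, F) I ∞ (fun x => g (sec x)) (q z) :=
    ContMDiffAt.comp (I' := 𝓘(ℝ, E)) (q z) (g := g) (f := fun x => (sec x : E))
      (by rw [hsec]; exact hg) hsz
  refine h1.congr_of_eventuallyEq ?_
  have h2 : Tendsto sec (𝓝 (q z)) (𝓝 z) := by
    have := Topology.IsInducing.subtypeVal.continuousAt_iff.2 hsz.continuousAt
    rw [ContinuousAt, hsec] at this
    exact this
  filter_upwards [hs, h2.eventually hfg] with x hx hx'
  rw [← hx', hx.1]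

end IsSmoothQuotient

end QuotientCharts

/-! ### Differential forms on quotients -/

section QuotientForms

open Set Filter Topology

variable {E F X : Type} [NormedAddCommGroup E] [NormedSpace ℝ E]
  [NormedAddCommGroup F] [NormedSpace ℝ F] [TopologicalSpace X] {Z : Set E}

/-- A family of alternating maps is smooth if its values on all vectors are. -/
theorem contDiffOn_alternating_of_apply [FiniteDimensional ℝ F] {n : ℕ} {s : Set E}
    {f : E → F [⋀^Fin n]→L[ℝ] ℝ} (hf : ∀ v : Fin n → F, ContDiffOn ℝ ∞ (fun x => f x v) s) :
    ContDiffOn ℝ ∞ f s := by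
  let b := Module.finBasis ℝ F
  -- Evaluation on tuples of basis vectors is linear and injective, and a linear left inverse on a
  -- finite-dimensional space is smooth, so smoothness of the values gives smoothness of the form.
  let ev : (F [⋀^Fin n]→L[ℝ] ℝ) →ₗ[ℝ] ((Fin n → Fin (Module.finrank ℝ F)) → ℝ) :=
    { toFun := fun φ c => φ fun i => b (c i)
      map_add' := fun _ _ => rfl
      map_smul' := fun _ _ => rfl }
  have hev : LinearMap.ker ev = ⊥ := by
    rw [LinearMap.ker_eq_bot]
    intro φ ψ h
    apply ContinuousAlternatingMap.toAlternatingMap_injective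
    apply AlternatingMap.coe_multilinearMap_injective
    exact Module.Basis.ext_multilinear (fun _ => b) fun c => congrFun h c
  obtain ⟨g, hg⟩ := ev.exists_leftInverse_of_injective hev
  have h1 : f = fun x => g (ev (f x)) := by
    funext x
    exact (LinearMap.congr_fun hg (f x)).symm
  rw [h1]
  exact (LinearMap.toContinuousLinearMap g).contDiff.comp_contDiffOn
    (contDiffOn_pi.2 fun c => hf _)

/-- A form on `E` is basic for `q : Z → X` if any two lifts of the same map to `X` pull it back to
the same form. -/
def IsBasicForm {n : ℕ} (q : Z → X) (β : E → E [⋀^Fin n]→L[ℝ] ℝ) : Prop :=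
  ∀ (E' N : Type) [NormedAddCommGroup E'] [NormedSpace ℝ E'] [TopologicalSpace N]
    [ChartedSpace E' N] (g₁ g₂ : N → Z) (y : N),
    ContMDiffAt 𝓘(ℝ, E') 𝓘(ℝ, E) ∞ (fun t => (g₁ t : E)) y →
    ContMDiffAt 𝓘(ℝ, E') 𝓘(ℝ, E) ∞ (fun t => (g₂ t : E)) y →
    (∀ᶠ t in 𝓝 y, q (g₁ t) = q (g₂ t)) →
    (β (g₁ y)).compContinuousLinearMap (mfderiv 𝓘(ℝ, E') 𝓘(ℝ, E) (fun t => (g₁ t : E)) y) =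
      (β (g₂ y)).compContinuousLinearMap (mfderiv 𝓘(ℝ, E') 𝓘(ℝ, E) (fun t => (g₂ t : E)) y)

namespace IsSmoothQuotient

variable [ChartedSpace F X] {q : Z → X} (h : IsSmoothQuotient F q)

/-- The chart at `x`. -/
noncomputable def quotientChartAt (x : X) : QuotientChart F q :=
  (h.of_mem_atlas _ (chart_mem_atlas F x)).choose

theorem toChart_quotientChartAt (x : X) :
    (h.quotientChartAt x).toChart h.isOpenQuotientMap = chartAt F x :=
  (h.of_mem_atlas _ (chart_mem_atlas F x)).choose_spec

/-- A smooth local section at `x`. -/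
noncomputable def sectionAt (x x' : X) : Z :=
  (h.quotientChartAt x).lift (extChartAt 𝓘(ℝ, F) x x')

theorem eventually_sectionAt (x : X) : ∀ᶠ x' in 𝓝 x, q (h.sectionAt x x') = x' ∧
    ContMDiffAt 𝓘(ℝ, F) 𝓘(ℝ, E) ∞ (fun x' => (h.sectionAt x x' : E)) x' := by
  have := h.isManifold
  have hC := h.toChart_quotientChartAt x
  have he : ⇑(extChartAt 𝓘(ℝ, F) x) = chartAt F x := by simp only [mfld_simps]
  filter_upwards [(chartAt F x).open_source.mem_nhds (mem_chart_source F x)] with x' hx'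
  have h1 : ContMDiffAt 𝓘(ℝ, F) 𝓘(ℝ, F) ∞ (extChartAt 𝓘(ℝ, F) x) x' :=
    contMDiffAt_extChartAt' hx'
  refine ⟨?_, ?_⟩
  · rw [sectionAt, he, ← hC]
    rw [← hC] at hx'
    exact ((h.quotientChartAt x).toChart h.isOpenQuotientMap).left_inv hx'
  · refine ContMDiffAt.comp (I' := 𝓘(ℝ, F)) x'
      (g := fun w => ((h.quotientChartAt x).lift w : E)) (f := extChartAt 𝓘(ℝ, F) x)
      ((h.quotientChartAt x).contDiffOn_lift.contDiffAt
        ((h.quotientChartAt x).isOpen_cod.mem_nhds ?_)).contMDiffAt h1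
    rw [he, ← hC]
    rw [← hC] at hx'
    exact ((h.quotientChartAt x).toChart h.isOpenQuotientMap).map_source hx'

theorem contMDiffAt_sectionAt (x : X) :
    ContMDiffAt 𝓘(ℝ, F) 𝓘(ℝ, E) ∞ (fun x' => (h.sectionAt x x' : E)) x :=
  (h.eventually_sectionAt x).self_of_nhds.2

/-- The form on `X` induced by a (basic) form on `E`. -/
noncomputable def form {n : ℕ} (β : E → E [⋀^Fin n]→L[ℝ] ℝ) : DiffForm F X n := fun x =>
  (β (h.sectionAt x x)).compContinuousLinearMap
    (mfderiv 𝓘(ℝ, F) 𝓘(ℝ, E) (fun x' => (h.sectionAt x x' : E)) x)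

variable {n : ℕ} {β : E → E [⋀^Fin n]→L[ℝ] ℝ}

/-- The form on `X` is defined through one chosen section at each point. Basicness removes the
choice: `g` and the chosen section composed with `q ∘ g` are two lifts of the same map. -/
theorem form_pullback (hβ : IsBasicForm q β) {E' N : Type} [NormedAddCommGroup E']
    [NormedSpace ℝ E'] [TopologicalSpace N] [ChartedSpace E' N] {g : N → Z} {y : N}
    (hg : ContMDiffAt 𝓘(ℝ, E') 𝓘(ℝ, E) ∞ (fun t => (g t : E)) y) :
    (h.form β).pullback (fun t => q (g t)) y =
      (β (g y)).compContinuousLinearMap (mfderiv 𝓘(ℝ, E') 𝓘(ℝ, E) (fun t => (g t : E)) y) := by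
  have hs := h.contMDiffAt_sectionAt (q (g y))
  have hq := h.contMDiffAt_comp hg
  have h1 : ContMDiffAt 𝓘(ℝ, E') 𝓘(ℝ, E) ∞
      (fun t => (h.sectionAt (q (g y)) (q (g t)) : E)) y :=
    ContMDiffAt.comp (f := fun t => q (g t)) y hs hq
  have h2 := hβ E' N (fun t => h.sectionAt (q (g y)) (q (g t))) g y h1 hg
    (by filter_upwards [hq.continuousAt.eventually (h.eventually_sectionAt (q (g y)))] with t ht
        exact ht.1)
  rw [← h2]
  have h3 := mfderiv_comp y (hs.mdifferentiableAt (by simp)) (hq.mdifferentiableAt (by simp))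
  ext v
  exact congrArg (β (h.sectionAt (q (g y)) (q (g y)))) (funext fun i => (by
    exact (congrArg (fun L => L (v i)) h3).symm))

theorem form_pullback_apply (hβ : IsBasicForm q β) {E' N : Type} [NormedAddCommGroup E']
    [NormedSpace ℝ E'] [TopologicalSpace N] [ChartedSpace E' N] {g : N → Z} {y : N}
    (hg : ContMDiffAt 𝓘(ℝ, E') 𝓘(ℝ, E) ∞ (fun t => (g t : E)) y)
    (v : Fin n → TangentSpace 𝓘(ℝ, E') y) :
    h.form β (q (g y)) (fun i => mfderiv 𝓘(ℝ, E') 𝓘(ℝ, F) (fun t => q (g t)) y (v i)) =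
      β (g y) (fun i => mfderiv 𝓘(ℝ, E') 𝓘(ℝ, E) (fun t => (g t : E)) y (v i)) :=
  congrArg (fun L => L v) (h.form_pullback hβ hg)

/-- The inverse chart is `q` after `lift`, so `lift` is a lift of it to `Z`. -/
theorem form_inChart (hβ : IsBasicForm q β) (x₀ : X) {w : F}
    (hw : w ∈ (h.quotientChartAt x₀).cod) :
    (h.form β).inChart x₀ w = (β ((h.quotientChartAt x₀).lift w)).compContinuousLinearMap
      (fderiv ℝ (fun w => ((h.quotientChartAt x₀).lift w : E)) w) := by
  set C := h.quotientChartAt x₀ with hCdef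
  have hC : C.toChart h.isOpenQuotientMap = chartAt F x₀ := h.toChart_quotientChartAt x₀
  have h1 : (extChartAt 𝓘(ℝ, F) x₀).symm = fun w => q (C.lift w) := by
    funext w
    simp only [extChartAt, mfld_simps, ← hC]
    rfl
  have h2 : ContMDiffAt 𝓘(ℝ, F) 𝓘(ℝ, E) ∞ (fun w => (C.lift w : E)) w :=
    (C.contDiffOn_lift.contDiffAt (C.isOpen_cod.mem_nhds hw)).contMDiffAt
  have h3 := h.form_pullback hβ h2
  rw [mfderiv_eq_fderiv] at h3
  refine Eq.trans ?_ h3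
  rw [DiffForm.inChart, h1]
  rfl

theorem extChartAt_target (x₀ : X) :
    (extChartAt 𝓘(ℝ, F) x₀).target = (h.quotientChartAt x₀).cod := by
  simp only [extChartAt, mfld_simps, ← h.toChart_quotientChartAt x₀]
  rfl

theorem form_isSmooth [FiniteDimensional ℝ F] (hβ : IsBasicForm q β)
    (hs : ContDiff ℝ ∞ fun p : E × (Fin n → E) => β p.1 p.2) : (h.form β).IsSmooth := by
  intro x₀
  rw [h.extChartAt_target x₀]
  refine ContDiffOn.congr (contDiffOn_alternating_of_apply fun v => ?_)
    fun w hw => h.form_inChart hβ x₀ hw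
  have h2 := (h.quotientChartAt x₀).contDiffOn_lift
  have h3 : ContDiffOn ℝ ∞ (fderiv ℝ (fun w => ((h.quotientChartAt x₀).lift w : E)))
      (h.quotientChartAt x₀).cod :=
    h2.fderiv_of_isOpen (h.quotientChartAt x₀).isOpen_cod (by simp)
  exact hs.comp_contDiffOn (h2.prodMk (contDiffOn_pi.2 fun i => h3.clm_apply contDiffOn_const))

/-- In the chart the form is the pullback of `β` along `lift`, and the exterior derivative commutes
with pullback. At `x`, both `d` and `form` use the same chart at `x`, so basicness of `extDeriv β`
is not needed here. -/
theorem form_d [FiniteDimensional ℝ E] (hβ : IsBasicForm q β)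
    (hs : ContDiff ℝ ∞ fun p : E × (Fin n → E) => β p.1 p.2) :
    (h.form β).d = h.form (extDeriv β) := by
  funext x
  set C := h.quotientChartAt x
  set y := extChartAt 𝓘(ℝ, F) x x with hy
  have := h.isManifold
  have hyC : y ∈ C.cod := by
    rw [← h.extChartAt_target x]
    exact mem_extChartAt_target x
  have hsβ : ContDiff ℝ ∞ β := by
    rw [← contDiffOn_univ]
    refine contDiffOn_alternating_of_apply fun v => ?_
    exact contDiffOn_univ.2 (hs.comp (contDiff_id.prodMk contDiff_const))
  have hl : ContDiffAt ℝ ∞ (fun w => (C.lift w : E)) y :=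
    C.contDiffOn_lift.contDiffAt (C.isOpen_cod.mem_nhds hyC)
  have h1 : extDeriv ((h.form β).inChart x) y =
      (extDeriv β (C.lift y)).compContinuousLinearMap (fderiv ℝ (fun w => (C.lift w : E)) y) := by
    rw [← extDeriv_pullback (hsβ.differentiable (by simp)).differentiableAt hl
      (by simpa using WithTop.coe_le_coe.2 (le_top : (2 : ℕ∞) ≤ ⊤))]
    apply Filter.EventuallyEq.extDeriv_eq
    filter_upwards [C.isOpen_cod.mem_nhds hyC] with w hw using h.form_inChart hβ x hw
  have h2 : MDifferentiableAt 𝓘(ℝ, F) 𝓘(ℝ, F) (extChartAt 𝓘(ℝ, F) x) x :=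
    mdifferentiableAt_extChartAt (mem_chart_source F x)
  have h3 := mfderiv_comp (I' := 𝓘(ℝ, F)) x (g := fun w => (C.lift w : E))
    (hl.contMDiffAt.mdifferentiableAt (by simp)) h2
  rw [mfderiv_eq_fderiv] at h3
  rw [DiffForm.d, h1]
  ext v
  exact congrArg (extDeriv β (C.lift y)) (funext fun i =>
    (congrArg (fun L => L (v i)) h3).symm)

end IsSmoothQuotient

end QuotientForms

/-! ### The set `Z` as its own quotient by the identity: the inclusion and the projections -/

section Submersions

open Set Filter Topology

variable {E F F₀ X : Type} [NormedAddCommGroup E] [NormedSpace ℝ E]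
  [NormedAddCommGroup F] [NormedSpace ℝ F] [NormedAddCommGroup F₀] [NormedSpace ℝ F₀]
  [TopologicalSpace X] {Z : Set E} [ChartedSpace F₀ Z] [ChartedSpace F X] {q : Z → X}

namespace IsSmoothQuotient

theorem contMDiff_val (hZ : IsSmoothQuotient F₀ (id : Z → Z)) :
    ContMDiff 𝓘(ℝ, F₀) 𝓘(ℝ, E) ∞ (Subtype.val : Z → E) := fun z => by
  obtain ⟨sec, -, hs⟩ := hZ.exists_section z
  refine hs.self_of_nhds.2.congr_of_eventuallyEq ?_
  filter_upwards [hs] with x hx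
  exact congrArg Subtype.val hx.1.symm

/-- The chart of `Z` is the restriction of `C.coord`, which is smooth on an open subset of `E`. The
invertible differential of the chart therefore factors through that of the inclusion. -/
theorem mfderiv_val_injective (hZ : IsSmoothQuotient F₀ (id : Z → Z)) (z : Z) :
    Function.Injective (mfderiv 𝓘(ℝ, F₀) 𝓘(ℝ, E) (Subtype.val : Z → E) z) := by
  have := hZ.isManifold
  have hC := hZ.toChart_quotientChartAt z
  set C := hZ.quotientChartAt z
  have hz : (z : E) ∈ C.dom := by
    rw [← C.toChart_source hZ.isOpenQuotientMap, hC]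
    exact mem_chart_source F₀ _
  have h1 : (fun x : Z => C.coord x) =ᶠ[𝓝 z] extChartAt 𝓘(ℝ, F₀) z := by
    filter_upwards [(C.isOpen_dom.preimage continuous_subtype_val).mem_nhds hz] with x hx
    simp only [extChartAt, mfld_simps, ← hC]
    exact (C.toChart_apply _ hx).symm
  have h2 := (isInvertible_mfderiv_extChartAt (I := 𝓘(ℝ, F₀))
    (mem_extChartAt_source (I := 𝓘(ℝ, F₀)) z)).injective
  rw [← h1.mfderiv_eq] at h2
  have h3 := mfderiv_comp (I' := 𝓘(ℝ, E)) z (g := C.coord) (f := Subtype.val)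
    ((C.contDiffOn_coord.contDiffAt
      (C.isOpen_dom.mem_nhds hz)).contMDiffAt.mdifferentiableAt (by simp))
    ((hZ.contMDiff_val z).mdifferentiableAt (by simp))
  intro u v huv
  apply h2
  exact (congrArg (fun L => L u) h3).trans ((congrArg _ huv).trans
    (congrArg (fun L => L v) h3).symm)

theorem contMDiff_quot (hZ : IsSmoothQuotient F₀ (id : Z → Z)) (h : IsSmoothQuotient F q) :
    ContMDiff 𝓘(ℝ, F₀) 𝓘(ℝ, F) ∞ q := fun z =>
  h.contMDiffAt_comp (g := id) (hZ.contMDiff_val z)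

theorem mfderiv_quot_comp (hZ : IsSmoothQuotient F₀ (id : Z → Z)) (h : IsSmoothQuotient F q)
    {E' N : Type} [NormedAddCommGroup E'] [NormedSpace ℝ E'] [TopologicalSpace N]
    [ChartedSpace E' N] {g : N → Z} {y : N}
    (hg : ContMDiffAt 𝓘(ℝ, E') 𝓘(ℝ, E) ∞ (fun t => (g t : E)) y) (u : TangentSpace 𝓘(ℝ, E') y) :
    mfderiv 𝓘(ℝ, F₀) 𝓘(ℝ, F) q (g y) (mfderiv 𝓘(ℝ, E') 𝓘(ℝ, F₀) g y u) =
      mfderiv 𝓘(ℝ, E') 𝓘(ℝ, F) (fun t => q (g t)) y u := by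
  have hg' : MDifferentiableAt 𝓘(ℝ, E') 𝓘(ℝ, F₀) g y := hZ.mdifferentiableAt_comp hg
  have h1 := mfderiv_comp y ((hZ.contMDiff_quot h (g y)).mdifferentiableAt (by simp)) hg'
  exact (congrArg (fun L => L u) h1).symm

theorem mfderiv_val_comp (hZ : IsSmoothQuotient F₀ (id : Z → Z))
    {E' N : Type} [NormedAddCommGroup E'] [NormedSpace ℝ E'] [TopologicalSpace N]
    [ChartedSpace E' N] {g : N → Z} {y : N}
    (hg : ContMDiffAt 𝓘(ℝ, E') 𝓘(ℝ, E) ∞ (fun t => (g t : E)) y) (u : TangentSpace 𝓘(ℝ, E') y) :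
    mfderiv 𝓘(ℝ, F₀) 𝓘(ℝ, E) (Subtype.val : Z → E) (g y) (mfderiv 𝓘(ℝ, E') 𝓘(ℝ, F₀) g y u) =
      mfderiv 𝓘(ℝ, E') 𝓘(ℝ, E) (fun t => (g t : E)) y u := by
  have hg' : MDifferentiableAt 𝓘(ℝ, E') 𝓘(ℝ, F₀) g y := hZ.mdifferentiableAt_comp hg
  have h1 := mfderiv_comp y ((hZ.contMDiff_val (g y)).mdifferentiableAt (by simp)) hg'
  exact (congrArg (fun L => L u) h1).symm

/-- Differentiate `q ∘ sec = id` for a local section through the prescribed point `z`. -/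
theorem exists_mfderiv_quot_eq (hZ : IsSmoothQuotient F₀ (id : Z → Z)) (h : IsSmoothQuotient F q)
    {z : Z} {x : X} (hx : q z = x) (v : TangentSpace 𝓘(ℝ, F) x) :
    ∃ u : TangentSpace 𝓘(ℝ, F₀) z, mfderiv 𝓘(ℝ, F₀) 𝓘(ℝ, F) q z u = v := by
  subst hx
  obtain ⟨sec, hsec, hs⟩ := h.exists_section z
  have h2 : (fun x => q (sec x)) =ᶠ[𝓝 (q z)] id := by
    filter_upwards [hs] with x hx using hx.1
  have h3 := hZ.mfderiv_quot_comp h hs.self_of_nhds.2 v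
  rw [h2.mfderiv_eq, mfderiv_id, hsec] at h3
  exact ⟨_, h3⟩

theorem mfderiv_quot_surjective (hZ : IsSmoothQuotient F₀ (id : Z → Z))
    (h : IsSmoothQuotient F q) (z : Z) :
    Function.Surjective (mfderiv 𝓘(ℝ, F₀) 𝓘(ℝ, F) q z) :=
  hZ.exists_mfderiv_quot_eq h rfl

theorem form_quot_apply (hZ : IsSmoothQuotient F₀ (id : Z → Z)) (h : IsSmoothQuotient F q)
    {n : ℕ} {β : E → E [⋀^Fin n]→L[ℝ] ℝ} (hβ : IsBasicForm q β) (z : Z)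
    (v : Fin n → TangentSpace 𝓘(ℝ, F₀) z) :
    h.form β (q z) (fun i => mfderiv 𝓘(ℝ, F₀) 𝓘(ℝ, F) q z (v i)) =
      β z (fun i => mfderiv 𝓘(ℝ, F₀) 𝓘(ℝ, E) (Subtype.val : Z → E) z (v i)) :=
  h.form_pullback_apply hβ (g := id) (hZ.contMDiff_val z) v

end IsSmoothQuotient

end Submersions

/-! ### Regular level sets -/

section LevelSets

open Set Filter Topology

variable {E E' : Type*} [NormedAddCommGroup E] [NormedSpace ℝ E] [FiniteDimensional ℝ E]
  [NormedAddCommGroup E'] [NormedSpace ℝ E'] [FiniteDimensional ℝ E']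

/-- The implicit function theorem: a level set near a regular point is parametrized by an open set
in a vector space, with a linear map as inverse. -/
theorem exists_levelSet_parametrization {f : E → E'} {U : Set E} (hU : IsOpen U)
    (hf : ContDiffOn ℝ ∞ f U) {z₀ : E} (hz₀ : z₀ ∈ U)
    (hsurj : Function.Surjective (fderiv ℝ f z₀)) {c : ℕ}
    (hc : Module.finrank ℝ E = Module.finrank ℝ E' + c) :
    ∃ (O : Set E) (W : Set (EuclideanSpace ℝ (Fin c))) (P : E →L[ℝ] EuclideanSpace ℝ (Fin c))
      (s : EuclideanSpace ℝ (Fin c) → E),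
      IsOpen O ∧ IsOpen W ∧ O ⊆ U ∧ z₀ ∈ O ∧ ContDiffOn ℝ ∞ s W ∧
      (∀ w ∈ W, s w ∈ O ∧ f (s w) = f z₀ ∧ P (s w) = w) ∧
      (∀ z ∈ O, f z = f z₀ → P z ∈ W ∧ s (P z) = z) ∧
      ∀ v, fderiv ℝ f z₀ v = 0 → ∃ w, fderiv ℝ s (P z₀) w = v := by
  set A := fderiv ℝ f z₀ with hA
  have hker : Module.finrank ℝ (LinearMap.ker A.toLinearMap) = c := by
    have h1 := A.toLinearMap.finrank_range_add_finrank_ker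
    rw [LinearMap.range_eq_top.2 hsurj, finrank_top] at h1
    omega
  obtain ⟨p, hp⟩ := (LinearMap.ker A.toLinearMap).subtype.exists_leftInverse_of_injective
    (Submodule.ker_subtype _)
  let e : LinearMap.ker A.toLinearMap ≃ₗ[ℝ] EuclideanSpace ℝ (Fin c) :=
    LinearEquiv.ofFinrankEq _ _ (by simp [hker])
  -- `P` is an isomorphism on the kernel of the derivative `A`, so `(A, P)` is bijective and `(f,
  -- P)` straightens the level sets of `f` near `z₀`.
  let P : E →L[ℝ] EuclideanSpace ℝ (Fin c) := LinearMap.toContinuousLinearMap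
    ((e : LinearMap.ker A.toLinearMap →ₗ[ℝ] EuclideanSpace ℝ (Fin c)).comp p)
  have hPker : ∀ v (hv : A v = 0), P v = e ⟨v, hv⟩ := by
    intro v hv
    exact congrArg e (LinearMap.congr_fun hp ⟨v, hv⟩)
  let L : E →L[ℝ] E' × EuclideanSpace ℝ (Fin c) := A.prod P
  have hLinj : Function.Injective L := by
    rw [injective_iff_map_eq_zero]
    intro v hv
    have hv1 : A v = 0 := congrArg Prod.fst hv
    have hv2 : P v = 0 := congrArg Prod.snd hv
    rw [hPker v hv1] at hv2
    simpa using congrArg Subtype.val (e.map_eq_zero_iff.1 hv2)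
  let L' : E ≃L[ℝ] E' × EuclideanSpace ℝ (Fin c) :=
    (LinearEquiv.ofInjectiveOfFinrankEq L.toLinearMap hLinj
      (by simp [hc])).toContinuousLinearEquiv
  have hL' : (L' : E →L[ℝ] E' × EuclideanSpace ℝ (Fin c)) = L := by
    ext v <;> rfl
  let Ψ : E → E' × EuclideanSpace ℝ (Fin c) := fun z => (f z, P z)
  have hΨ : ContDiffOn ℝ ∞ Ψ U := hf.prodMk P.contDiff.contDiffOn
  have hd : HasFDerivAt Ψ (L' : E →L[ℝ] E' × EuclideanSpace ℝ (Fin c)) z₀ := by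
    rw [hL']
    exact (((hf.contDiffAt (hU.mem_nhds hz₀)).differentiableAt (by simp)).hasFDerivAt).prodMk
      P.hasFDerivAt
  let Φ := (hΨ.contDiffAt (hU.mem_nhds hz₀)).toOpenPartialHomeomorph Ψ hd (by simp)
  have hΦ : ∀ z, Φ z = (f z, P z) := fun z => rfl
  have hz₀Φ : z₀ ∈ Φ.source :=
    (hΨ.contDiffAt (hU.mem_nhds hz₀)).mem_toOpenPartialHomeomorph_source hd (by simp)
  -- the open set on which the derivative is invertible
  let I : Set E := {z | z ∈ U ∧ (fderiv ℝ Ψ z) ∈ range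
    ((↑) : (E ≃L[ℝ] E' × EuclideanSpace ℝ (Fin c)) → (E →L[ℝ] E' × EuclideanSpace ℝ (Fin c)))}
  have hI : IsOpen I :=
    (hΨ.continuousOn_fderiv_of_isOpen hU (by simp)).isOpen_inter_preimage hU
      ContinuousLinearEquiv.isOpen
  have hz₀I : z₀ ∈ I := ⟨hz₀, L', hd.fderiv.symm⟩
  let O := Φ.source ∩ I
  let j : EuclideanSpace ℝ (Fin c) → E' × EuclideanSpace ℝ (Fin c) := fun w => (f z₀, w)
  have hj : ContDiff ℝ ∞ j := contDiff_const.prodMk contDiff_id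
  let W := j ⁻¹' (Φ.target ∩ Φ.symm ⁻¹' I)
  have hsm : ∀ w ∈ W, ContDiffAt ℝ ∞ (fun w => Φ.symm (j w)) w := by
    intro w hw
    obtain ⟨hU', D, hD⟩ := hw.2
    refine ContDiffAt.comp (g := Φ.symm) (f := j) w ?_ hj.contDiffAt
    refine Φ.contDiffAt_symm hw.1 (f₀' := D) ?_ (hΨ.contDiffAt (hU.mem_nhds hU'))
    rw [hD]
    exact ((hΨ.contDiffAt (hU.mem_nhds hU')).differentiableAt (by simp)).hasFDerivAt
  have hinv : ∀ w ∈ W, Φ.symm (j w) ∈ O ∧ f (Φ.symm (j w)) = f z₀ ∧ P (Φ.symm (j w)) = w := by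
    intro w hw
    have h1 := Φ.right_inv hw.1
    rw [hΦ] at h1
    exact ⟨⟨Φ.map_target hw.1, hw.2⟩, congrArg Prod.fst h1, congrArg Prod.snd h1⟩
  have hinv2 : ∀ z ∈ O, f z = f z₀ → P z ∈ W ∧ Φ.symm (j (P z)) = z := by
    intro z hz hfz
    have h1 : j (P z) = Φ z := by rw [hΦ, hfz]
    have h2 : Φ.symm (j (P z)) = z := by rw [h1, Φ.left_inv hz.1]
    refine ⟨⟨?_, ?_⟩, h2⟩
    · rw [h1]; exact Φ.map_source hz.1
    · change Φ.symm (j (P z)) ∈ I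
      rw [h2]; exact hz.2
  have hW : IsOpen W :=
    (Φ.symm.continuousOn.isOpen_inter_preimage Φ.open_target hI).preimage hj.continuous
  refine ⟨O, W, P, fun w => Φ.symm (j w), Φ.open_source.inter hI, hW, fun z hz => hz.2.1,
    ⟨hz₀Φ, hz₀I⟩, fun w hw => (hsm w hw).contDiffWithinAt, hinv, hinv2, ?_⟩
  intro v hv
  obtain ⟨hPW, hsP⟩ := hinv2 z₀ ⟨hz₀Φ, hz₀I⟩ rfl
  -- Differentiating `Ψ ∘ s = (f z₀, id)` shows that `L'` sends the derivative of `s` at `P v` to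
  -- `(0, P v)`, which is also the image of `v` because `A v = 0`.
  refine ⟨P v, ?_⟩
  have hsd := ((hsm _ hPW).differentiableAt (by simp)).hasFDerivAt
  have h1 : HasFDerivAt (fun w => Ψ (Φ.symm (j w)))
      ((L' : E →L[ℝ] E' × EuclideanSpace ℝ (Fin c)) ∘L
        fderiv ℝ (fun w => Φ.symm (j w)) (P z₀)) (P z₀) := by
    refine HasFDerivAt.comp (P z₀) (g := Ψ) ?_ hsd
    rw [hsP]; exact hd
  have h2 : HasFDerivAt (fun w => Ψ (Φ.symm (j w)))
      (ContinuousLinearMap.inr ℝ E' (EuclideanSpace ℝ (Fin c))) (P z₀) := by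
    have h3 : HasFDerivAt j (ContinuousLinearMap.inr ℝ E' (EuclideanSpace ℝ (Fin c))) (P z₀) := 
      (hasFDerivAt_const (𝕜 := ℝ) (f z₀) (P z₀)).prodMk (hasFDerivAt_id (𝕜 := ℝ) (P z₀))
    refine h3.congr_of_eventuallyEq ?_
    filter_upwards [hW.mem_nhds hPW] with w hw
    exact Φ.right_inv hw.1
  have h4 := congrArg (fun T => T (P v)) (h1.unique h2)
  apply L'.injective
  refine Eq.trans h4 ?_
  have h5 : L' v = L v := congrArg (fun T => T v) hL'
  rw [h5]
  exact Prod.ext hv.symm rfl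

end LevelSets

/-! ### The unitary group -/

section Unitary

variable {ι : Type*} [Fintype ι] [DecidableEq ι]

theorem Circle.coe_mul_star (z : Circle) : (z : ℂ) * star (z : ℂ) = 1 := by
  rw [Complex.star_def, Complex.mul_conj, Circle.normSq_coe, Complex.ofReal_one]

/-- The diagonal unitary matrix with entries `e^{iλ}`. -/
noncomputable def expDiagonal (l : ι → ℝ) : Matrix.unitaryGroup ι ℂ :=
  ⟨Matrix.diagonal fun a => (Circle.exp (l a) : ℂ), by
    rw [Matrix.mem_unitaryGroup_iff, Matrix.star_eq_conjTranspose, Matrix.diagonal_conjTranspose,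
      Matrix.diagonal_mul_diagonal, ← Matrix.diagonal_one]
    congr 1
    funext a
    exact Circle.coe_mul_star _⟩

/-- The unitary matrix `U diag(e^{iλ}) U^*`. -/
noncomputable def conjExp (U : Matrix.unitaryGroup ι ℂ) (l : ι → ℝ) : Matrix.unitaryGroup ι ℂ :=
  U * expDiagonal l * U⁻¹

theorem expDiagonal_add (l l' : ι → ℝ) : expDiagonal (l + l') = expDiagonal l * expDiagonal l' := by
  apply Subtype.ext
  simp [expDiagonal, Circle.exp_add]

theorem expDiagonal_zero : expDiagonal (0 : ι → ℝ) = 1 := by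
  apply Subtype.ext
  simp [expDiagonal]

theorem conjExp_add (U : Matrix.unitaryGroup ι ℂ) (l l' : ι → ℝ) :
    conjExp U (l + l') = conjExp U l * conjExp U l' := by
  simp [conjExp, expDiagonal_add, mul_assoc]

theorem conjExp_zero (U : Matrix.unitaryGroup ι ℂ) : conjExp U 0 = 1 := by
  simp [conjExp, expDiagonal_zero]

theorem conjExp_two_pi (U : Matrix.unitaryGroup ι ℂ) (c : ι → ℤ) :
    conjExp U (fun a => c a * (2 * Real.pi)) = 1 := by
  have : expDiagonal (fun a => (c a : ℝ) * (2 * Real.pi)) = (1 : Matrix.unitaryGroup ι ℂ) := by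
    apply Subtype.ext
    simp [expDiagonal, -Circle.coe_exp]
  simp [conjExp, this]

theorem coe_conjExp (U : Matrix.unitaryGroup ι ℂ) (l : ι → ℝ) :
    (conjExp U l : Matrix ι ι ℂ) = (U : Matrix ι ι ℂ) *
      Matrix.diagonal (fun a => (Circle.exp (l a) : ℂ)) * (U : Matrix ι ι ℂ)ᴴ := rfl

theorem conjTranspose_mul_coe (U : Matrix.unitaryGroup ι ℂ) :
    (U : Matrix ι ι ℂ)ᴴ * (U : Matrix ι ι ℂ) = 1 := Matrix.mem_unitaryGroup_iff'.1 U.2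

theorem coe_mul_conjTranspose (U : Matrix.unitaryGroup ι ℂ) :
    (U : Matrix ι ι ℂ) * (U : Matrix ι ι ℂ)ᴴ = 1 := Matrix.mem_unitaryGroup_iff.1 U.2

theorem det_conjExp (U : Matrix.unitaryGroup ι ℂ) (l : ι → ℝ) :
    (conjExp U l : Matrix ι ι ℂ).det = Circle.exp (∑ a, l a) := by
  rw [coe_conjExp, Matrix.det_mul_right_comm, coe_mul_conjTranspose, one_mul, Matrix.det_diagonal]
  simp [Circle.coe_exp, ← Complex.exp_sum, Finset.sum_mul]

theorem continuous_conjExp (U : Matrix.unitaryGroup ι ℂ) : Continuous (conjExp U) := by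
  refine continuous_induced_rng.2 ?_
  refine (continuous_const.matrix_mul (Continuous.matrix_diagonal ?_)).matrix_mul continuous_const
  exact continuous_pi fun a => (Circle.exp.continuous.comp (continuous_apply a)).subtype_val

theorem exists_eq_conj_diagonal_of_isHermitian {H : Matrix ι ι ℂ} (hH : H.IsHermitian) :
    ∃ (U : Matrix.unitaryGroup ι ℂ) (l : ι → ℝ),
      H = (U : Matrix ι ι ℂ) * Matrix.diagonal (fun a => (l a : ℂ)) * (U : Matrix ι ι ℂ)ᴴ :=
  ⟨hH.eigenvectorUnitary, hH.eigenvalues, by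
    have := hH.spectral_theorem
    rw [Unitary.conjStarAlgAut_apply] at this
    exact this⟩

theorem exists_eq_conj_diagonal_of_skew {B : Matrix ι ι ℂ} (hB : Bᴴ = -B) :
    ∃ (U : Matrix.unitaryGroup ι ℂ) (l : ι → ℝ), B = (U : Matrix ι ι ℂ) *
      Matrix.diagonal (fun a => Complex.I * (l a : ℂ)) * (U : Matrix ι ι ℂ)ᴴ := by
  have hH : (-Complex.I • B).IsHermitian := by
    simp [Matrix.IsHermitian, Matrix.conjTranspose_smul, hB]
  obtain ⟨U, l, h⟩ := exists_eq_conj_diagonal_of_isHermitian hH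
  refine ⟨U, l, ?_⟩
  have h1 : B = Complex.I • (-Complex.I • B) := by simp [smul_smul]
  have h2 : (fun a => Complex.I * (l a : ℂ)) = Complex.I • fun a => (l a : ℂ) := rfl
  rw [h1, h, h2, Matrix.diagonal_smul]
  simp

/-- Cayley transform: choose ζ on the circle with −ζ not an eigenvalue of `A`, which excludes
finitely many points. Then i(ζ − A)(A + ζ)⁻¹ is Hermitian, hence unitarily diagonalizable, and `A`
is diagonal in the same basis. -/
theorem exists_eq_conjExp (A : Matrix.unitaryGroup ι ℂ) :
    ∃ (U : Matrix.unitaryGroup ι ℂ) (l : ι → ℝ), A = conjExp U l := by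
  have hinf : Infinite Circle := Circle.argEquiv.infinite_iff.2
    (Set.Ioc_infinite (by linarith [Real.pi_pos])).to_subtype
  have hfin : {z : Circle | (A : Matrix ι ι ℂ).charpoly.IsRoot (-z : ℂ)}.Finite := by
    refine Set.Finite.of_finite_image (f := fun z : Circle => (-z : ℂ)) (((A : Matrix ι ι ℂ).charpoly.rootSet_finite ℂ).subset ?_) ?_
    · rintro _ ⟨z, hz, rfl⟩
      rw [Polynomial.mem_rootSet]
      refine ⟨(Matrix.charpoly_monic _).ne_zero, ?_⟩
      simpa [Polynomial.aeval_def] using hz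
    · intro z _ w _ h
      exact Circle.ext (neg_injective h)
  obtain ⟨ζ, hζζ, hζn, hζ⟩ : ∃ ζ : ℂ, ζ * star ζ = 1 ∧ ‖ζ‖ = 1 ∧
      (A : Matrix ι ι ℂ).charpoly.eval (-ζ : ℂ) ≠ 0 := by
    obtain ⟨z, hz⟩ := hfin.exists_notMem
    exact ⟨z, Circle.coe_mul_star z, Circle.norm_coe z, hz⟩
  rw [Matrix.eval_charpoly] at hζ
  set T : Matrix ι ι ℂ := (A : Matrix ι ι ℂ) + ζ • 1 with hT
  have hTdet : IsUnit T.det := by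
    rw [isUnit_iff_ne_zero]
    intro h0
    apply hζ
    have : Matrix.scalar ι (-ζ) - (A : Matrix ι ι ℂ) = -T := by
      rw [hT]; simp [Matrix.smul_one_eq_diagonal]; abel
    rw [this, Matrix.det_neg, h0, mul_zero]
  have hAA := conjTranspose_mul_coe A
  set B : Matrix ι ι ℂ := (A : Matrix ι ι ℂ) with hB
  have hkey : Tᴴ * (ζ • 1 - B) = -((ζ • 1 - B)ᴴ * T) := by
    simp only [hT, Matrix.conjTranspose_add, Matrix.conjTranspose_sub, Matrix.conjTranspose_smul,
      Matrix.conjTranspose_one, Matrix.add_mul, Matrix.sub_mul, Matrix.mul_sub, Matrix.mul_add, hAA,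
      Matrix.smul_mul, Matrix.mul_smul, one_mul, mul_one, smul_add, smul_sub, smul_smul, hζζ, one_smul]
    abel
  have hT1 : T * T⁻¹ = 1 := Matrix.mul_nonsing_inv _ hTdet
  have hT2 : T⁻¹ * T = 1 := Matrix.nonsing_inv_mul _ hTdet
  have hT3 : T⁻¹ᴴ * Tᴴ = 1 := by
    rw [← Matrix.conjTranspose_mul, hT1, Matrix.conjTranspose_one]
  have hH : (Complex.I • ((ζ • 1 - B) * T⁻¹)).IsHermitian := by
    rw [Matrix.IsHermitian, Matrix.conjTranspose_smul, Matrix.conjTranspose_mul, Complex.star_def,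
      Complex.conj_I, neg_smul, ← smul_neg]
    congr 1
    calc -(T⁻¹ᴴ * (ζ • 1 - B)ᴴ)
        = T⁻¹ᴴ * -((ζ • 1 - B)ᴴ * T) * T⁻¹ := by
          rw [Matrix.mul_neg, Matrix.neg_mul, Matrix.mul_assoc, Matrix.mul_assoc, hT1, mul_one]
      _ = (ζ • 1 - B) * T⁻¹ := by
          rw [← hkey, ← Matrix.mul_assoc, hT3, one_mul]
  obtain ⟨U, l, hU⟩ := exists_eq_conj_diagonal_of_isHermitian hH
  have hne : ∀ a, (l a : ℂ) + Complex.I ≠ 0 := fun a h => by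
    simpa using congrArg Complex.im h
  -- The eigenvalues of `A`, obtained by solving l = i(ζ − v)/(v + ζ) for v. They have modulus one
  -- because l is real.
  let v : ι → ℂ := fun a => ζ * (Complex.I - l a) / (l a + Complex.I)
  have hv : ∀ a, ‖v a‖ = 1 := fun a => by
    have h3 : star ((l a : ℂ) + Complex.I) = -(Complex.I - l a) := by simp [sub_eq_add_neg]
    have h4 : ‖(l a : ℂ) + Complex.I‖ = ‖Complex.I - l a‖ := by
      rw [← norm_star, h3, norm_neg]
    simp only [v, norm_div, norm_mul, hζn, one_mul]
    rw [← h4, div_self (norm_ne_zero_iff.2 (hne a))]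
  have hmul : (U : Matrix ι ι ℂ) * Matrix.diagonal (fun a => (l a : ℂ)) * (U : Matrix ι ι ℂ)ᴴ * T =
      Complex.I • (ζ • 1 - B) := by
    rw [← hU, Matrix.smul_mul, Matrix.mul_assoc, hT2, mul_one]
  have hUU := conjTranspose_mul_coe U
  have hUU' := coe_mul_conjTranspose U
  have h5 : Matrix.diagonal (fun a => (l a : ℂ) + Complex.I) * ((U : Matrix ι ι ℂ)ᴴ * B) =
      Matrix.diagonal (fun a => ζ * (Complex.I - l a)) * (U : Matrix ι ι ℂ)ᴴ := by
    have h6 := congrArg (fun Y => (U : Matrix ι ι ℂ)ᴴ * Y) hmul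
    simp only [← Matrix.mul_assoc, hUU, one_mul] at h6
    have e1 : Matrix.diagonal (fun a => (l a : ℂ) + Complex.I) =
        Matrix.diagonal (fun a => (l a : ℂ)) + Complex.I • (1 : Matrix ι ι ℂ) := by
      rw [Matrix.smul_one_eq_diagonal, Matrix.diagonal_add]
    have e2 : Matrix.diagonal (fun a => ζ * (Complex.I - l a)) =
        ζ • (Complex.I • (1 : Matrix ι ι ℂ) - Matrix.diagonal (fun a => (l a : ℂ))) := by
      rw [Matrix.smul_one_eq_diagonal, Matrix.diagonal_sub, ← Matrix.diagonal_smul]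
      rfl
    rw [e1, e2]
    simp only [hT, Matrix.mul_add, Matrix.mul_sub, Matrix.mul_smul, mul_one, smul_sub] at h6
    simp only [Matrix.add_mul, Matrix.smul_mul, one_mul, Matrix.sub_mul, smul_sub, ← Matrix.mul_assoc]
    rw [eq_sub_iff_add_eq] at h6 ⊢
    rw [add_right_comm, h6, smul_comm]
  refine ⟨U, fun a => Complex.arg (v a), Subtype.ext ?_⟩
  rw [coe_conjExp]
  have h7 : (fun a => (Circle.exp (Complex.arg (v a)) : ℂ)) = v := by
    funext a
    have := Complex.norm_mul_exp_arg_mul_I (v a)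
    rw [hv, Complex.ofReal_one, one_mul] at this
    rw [Circle.coe_exp, this]
  have h8 : Matrix.diagonal (fun a => ((l a : ℂ) + Complex.I)⁻¹) *
      Matrix.diagonal (fun a => (l a : ℂ) + Complex.I) = 1 := by
    rw [Matrix.diagonal_mul_diagonal, ← Matrix.diagonal_one]
    congr 1
    funext a
    exact inv_mul_cancel₀ (hne a)
  have h9 := congrArg (fun Y => Matrix.diagonal (fun a => ((l a : ℂ) + Complex.I)⁻¹) * Y) h5
  simp only [← Matrix.mul_assoc, h8, one_mul, Matrix.diagonal_mul_diagonal] at h9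
  have h10 := congrArg (fun Y => (U : Matrix ι ι ℂ) * Y) h9
  simp only [← Matrix.mul_assoc, hUU', one_mul] at h10
  rw [h7, ← hB, h10]
  congr 3
  funext a
  simp only [v]
  ring

instance : CompactSpace (Matrix.unitaryGroup ι ℂ) := by
  refine isCompact_iff_compactSpace.1 ?_
  have h1 : IsClosed (Matrix.unitaryGroup ι ℂ : Set (Matrix ι ι ℂ)) := by
    have : (Matrix.unitaryGroup ι ℂ : Set (Matrix ι ι ℂ)) = {A | A * star A = 1} := by
      ext A; exact Matrix.mem_unitaryGroup_iff
    rw [this]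
    exact isClosed_eq (continuous_id.mul continuous_star) continuous_const
  have h2 : IsCompact (Set.pi Set.univ fun _ : ι => Set.pi Set.univ fun _ : ι =>
      Metric.closedBall (0 : ℂ) 1) :=
    isCompact_univ_pi fun _ => isCompact_univ_pi fun _ => isCompact_closedBall _ _
  refine IsCompact.of_isClosed_subset (X := Matrix ι ι ℂ) h2 h1 fun U hU => ?_
  intro i _ j _
  exact mem_closedBall_zero_iff.2 (entry_norm_bound_of_unitary hU i j)

instance : PathConnectedSpace (Matrix.unitaryGroup ι ℂ) := by
  have h : ∀ A : Matrix.unitaryGroup ι ℂ, Joined 1 A := fun A => by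
    obtain ⟨U, l, rfl⟩ := exists_eq_conjExp A
    exact ⟨⟨⟨fun s => conjExp U ((s : ℝ) • l), by
      exact (continuous_conjExp U).comp (continuous_subtype_val.smul continuous_const)⟩,
      by simp [conjExp_zero], by simp⟩⟩
  exact ⟨⟨1⟩, fun A B => (h A).symm.trans (h B)⟩

/-- The determinant of a unitary matrix. -/
noncomputable def detCircle : Matrix.unitaryGroup ι ℂ →* Circle where
  toFun A := ⟨(A : Matrix ι ι ℂ).det, mem_sphere_zero_iff_norm.2
    (CStarRing.norm_of_mem_unitary (Matrix.det_of_mem_unitary A.2))⟩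
  map_one' := Circle.ext (by simp)
  map_mul' A B := Circle.ext (Matrix.det_mul _ _)

theorem coe_detCircle (A : Matrix.unitaryGroup ι ℂ) :
    (detCircle A : ℂ) = (A : Matrix ι ι ℂ).det := rfl

theorem detCircle_conjExp (U : Matrix.unitaryGroup ι ℂ) (l : ι → ℝ) :
    detCircle (conjExp U l) = Circle.exp (∑ a, l a) := Circle.ext (det_conjExp U l)

theorem continuous_detCircle : Continuous (detCircle (ι := ι)) :=
  continuous_induced_rng.2 continuous_subtype_val.matrix_det

end Unitary

/-! ### The moment polytope and the subtorus -/

section Polytope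

variable {m d : ℕ} {ν : Fin d → Fin m → ℤ}

/-- An integer matrix whose rows lie in the kernel of `β` and which acts as the identity on this
kernel. -/
structure IsTorusRetraction (ν : Fin d → Fin m → ℤ) (P : Fin d → Fin d → ℤ) : Prop where
  row_mem : ∀ j l, ∑ i, P j i * ν i l = 0
  fix : ∀ x ∈ ToricGrassmann.kerBeta ν, ∀ l, ∑ j, x j * (P j l : ℝ) = x l

/-- A vertex contained in all the facets which contain a given point. -/
theorem exists_extremePoint_of_mem (hν : IsMonotoneDelzant ν) {x : Fin m → ℝ}
    (hx : x ∈ monotonePolytope ν) : ∃ v ∈ (monotonePolytope ν).extremePoints ℝ,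
    ∀ j, x ∈ monotonePolytopeFace ν j → v ∈ monotonePolytopeFace ν j := by
  -- The face cut out by all facets through `x`. It is compact and an extreme subset of the
  -- polytope, so its extreme points are vertices of the polytope.
  let B : Set (Fin m → ℝ) :=
    {y ∈ monotonePolytope ν | ∀ j, x ∈ monotonePolytopeFace ν j → y ∈ monotonePolytopeFace ν j}
  have hcont : ∀ j, Continuous fun y : Fin m → ℝ => ∑ l, y l * (ν j l : ℝ) + 1 / 2 := fun j => by
    fun_prop
  have hB : IsCompact B := by
    have : B = monotonePolytope ν ∩ ⋂ j ∈ {j | x ∈ monotonePolytopeFace ν j},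
        {y | ∑ l, y l * (ν j l : ℝ) + 1 / 2 = 0} := by
      ext y
      simp only [B, monotonePolytopeFace, Set.mem_ofPred_eq, Set.mem_inter_iff, Set.mem_iInter]
      constructor
      · exact fun h => ⟨h.1, fun j hj => (h.2 j hj).2⟩
      · exact fun h => ⟨h.1, fun j hj => ⟨h.1, h.2 j hj⟩⟩
    rw [this]
    exact hν.compact.inter_right (isClosed_biInter fun j _ =>
      isClosed_eq (hcont j) continuous_const)
  obtain ⟨v, hv⟩ := hB.extremePoints_nonempty ⟨x, hx, fun j hj => hj⟩
  refine ⟨v, ?_, hv.1.2⟩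
  have hext : IsExtreme ℝ (monotonePolytope ν) B := by
    refine ⟨fun y hy => hy.1, fun y₁ hy₁ y₂ hy₂ y hy hseg => ?_⟩
    obtain ⟨s, t, hs, ht, hst, rfl⟩ := hseg
    refine ⟨hy₁, fun j hj => ⟨hy₁, ?_⟩⟩
    have h1 := (hy.2 j hj).2
    have h2 := hy₁ j
    have h3 := hy₂ j
    have h4 : ∑ l, (s • y₁ + t • y₂) l * (ν j l : ℝ) + 1 / 2 =
        s * (∑ l, y₁ l * (ν j l : ℝ) + 1 / 2) + t * (∑ l, y₂ l * (ν j l : ℝ) + 1 / 2) := by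
      have : (1 / 2 : ℝ) = (s + t) * (1 / 2) := by rw [hst, one_mul]
      conv_lhs => rw [this]
      simp only [Pi.add_apply, Pi.smul_apply, smul_eq_mul, add_mul, Finset.sum_add_distrib,
        mul_add, Finset.mul_sum, mul_assoc]
      ring
    rw [h4] at h1
    have h5 := mul_nonneg ht.le h3
    have h6 := mul_nonneg hs.le h2
    have h7 : s * (∑ l, y₁ l * (ν j l : ℝ) + 1 / 2) = 0 := by linarith
    exact (mul_eq_zero.1 h7).resolve_left hs.ne'
  exact hext.extremePoints_subset_extremePoints hv

/-- At a vertex v on all facets through `x`, the conormals form a ℤ-basis. Subtracting from e_j the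
combination of the basis facets with the coordinates of ν_j lands in 𝔨 and gives row j of `P`. If
facet j contains v, then ν_j is a basis vector and the row is zero. -/
theorem exists_isTorusRetraction (hν : IsMonotoneDelzant ν) {x : Fin m → ℝ}
    (hx : x ∈ monotonePolytope ν) : ∃ P : Fin d → Fin d → ℤ, IsTorusRetraction ν P ∧
    ∀ j, x ∈ monotonePolytopeFace ν j → ∀ l, P j l = 0 := by
  classical
  obtain ⟨v, hv, hxv⟩ := exists_extremePoint_of_mem hν hx
  obtain ⟨hli, hsp⟩ := hν.smooth v hv
  let b : Module.Basis {j // v ∈ monotonePolytopeFace ν j} ℤ (Fin m → ℤ) :=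
    Module.Basis.mk hli hsp.ge
  have hb : ∀ j, b j = ν j := fun j => by simp [b]
  let c : Fin d → Fin d → ℤ := fun j l =>
    if h : v ∈ monotonePolytopeFace ν l then b.repr (ν j) ⟨l, h⟩ else 0
  have hc : ∀ j (f : Fin d → ℤ), ∑ l, c j l * f l =
      ∑ l : {l // v ∈ monotonePolytopeFace ν l}, b.repr (ν j) l * f l := by
    intro j f
    rw [← Finset.sum_filter_of_ne (p := fun l => v ∈ monotonePolytopeFace ν l),
      Finset.sum_subtype _ (p := fun l => v ∈ monotonePolytopeFace ν l) (by simp)]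
    · exact Finset.sum_congr rfl fun l _ => by simp only [c, l.2, dif_pos]
    · intro l _ hl
      by_contra hv'
      simp [c, hv'] at hl
  refine ⟨fun j l => (if j = l then 1 else 0) - c j l, ⟨fun j l => ?_, fun x hx l => ?_⟩,
    fun j hj l => ?_⟩
  · have h1 := congrFun (b.sum_repr (ν j)) l
    simp only [Finset.sum_apply, Pi.smul_apply, smul_eq_mul, hb] at h1
    simp [sub_mul, Finset.sum_sub_distrib, hc, h1]
  -- Column `l` of `c` is an integral linear functional applied to the ν_j; extended to real
  -- coefficients, it kills ∑ x_j ν_j = 0.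
  · have h0 : ∑ j, x j * (c j l : ℝ) = 0 := by
      by_cases hl : v ∈ monotonePolytopeFace ν l
      · have h1 : ∀ j, (c j l : ℝ) = ∑ l', (ν j l' : ℝ) * (b.coord ⟨l, hl⟩ (Pi.single l' 1) : ℝ) := by
          intro j
          have h2 : c j l = b.coord ⟨l, hl⟩ (ν j) := by simp [c, hl]
          have h3 : ν j = ∑ l', ν j l' • (Pi.single l' 1 : Fin m → ℤ) := by
            simpa using (pi_eq_sum_univ' (ν j))
          rw [h2]
          conv_lhs => rw [h3]
          rw [map_sum, Int.cast_sum]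
          exact Finset.sum_congr rfl fun l' _ => by rw [map_smul, smul_eq_mul, Int.cast_mul]
        simp only [h1, Finset.mul_sum]
        rw [Finset.sum_comm]
        refine Finset.sum_eq_zero fun l' _ => ?_
        simp only [← mul_assoc, ← Finset.sum_mul]
        rw [hx l', zero_mul]
      · simp [c, hl]
    simp only [Int.cast_sub, mul_sub, Finset.sum_sub_distrib, h0]
    simp
  · have hvj := hxv j hj
    have h1 : ν j = b ⟨j, hvj⟩ := (hb ⟨j, hvj⟩).symm
    simp only [c, h1, b.repr_self, Finsupp.single_apply]
    by_cases hl : v ∈ monotonePolytopeFace ν l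
    · simp [hl, Subtype.ext_iff]
    · have : j ≠ l := by rintro rfl; exact hl hvj
      simp [hl, this]

theorem zero_mem_monotonePolytope : (0 : Fin m → ℝ) ∈ monotonePolytope ν := by
  intro j
  simp

/-- A real linear functional vanishing on the kernel of `β` is a combination of the `ν_j`. -/
theorem exists_of_kerBeta_le {a : Fin d → ℝ}
    (ha : ∀ x ∈ ToricGrassmann.kerBeta ν, ∑ j, x j * a j = 0) :
    ∃ y : Fin m → ℝ, ∀ j, a j = ∑ l, y l * (ν j l : ℝ) := by
  classical
  let β : (Fin d → ℝ) →ₗ[ℝ] (Fin m → ℝ) :=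
    { toFun := fun x l => ∑ j, x j * (ν j l : ℝ)
      map_add' := fun x y => by funext l; simp [add_mul, Finset.sum_add_distrib]
      map_smul' := fun c x => by funext l; simp [Finset.mul_sum, mul_assoc] }
  let φ : Module.Dual ℝ (Fin d → ℝ) :=
    { toFun := fun x => ∑ j, x j * a j
      map_add' := fun x y => by simp [add_mul, Finset.sum_add_distrib]
      map_smul' := fun c x => by simp [Finset.mul_sum, mul_assoc] }
  have hφ : φ ∈ LinearMap.range β.dualMap := by
    rw [LinearMap.range_dualMap_eq_dualAnnihilator_ker, Submodule.mem_dualAnnihilator]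
    intro x hx
    exact ha x fun l => congrFun hx l
  obtain ⟨ψ, hψ⟩ := hφ
  refine ⟨fun l => ψ (Pi.single l 1), fun j => ?_⟩
  have h1 : φ (Pi.single j 1) = a j := by simp [φ, Pi.single_apply]
  have h2 : β (Pi.single j 1) = ∑ l, (ν j l : ℝ) • (Pi.single l 1 : Fin m → ℝ) := by
    have : β (Pi.single j 1) = fun l => (ν j l : ℝ) := by
      funext l; simp [β, Pi.single_apply]
    rw [this]
    simpa using (pi_eq_sum_univ' (fun l => (ν j l : ℝ)))
  rw [← h1, ← hψ, LinearMap.dualMap_apply, h2]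
  simp [mul_comm]

/-- Otherwise (1,…,1) annihilates 𝔨, so some `y` satisfies ⟨y,ν_j⟩ = 1 for all j. The whole ray
spanned by `y` then lies in the polytope, against boundedness. Thus the determinant is not constant
on K. -/
theorem exists_kerBeta_sum_ne_zero (hν : IsMonotoneDelzant ν) (hd : 0 < d) :
    ∃ x ∈ ToricGrassmann.kerBeta ν, ∑ j, x j ≠ 0 := by
  by_contra! hcon
  obtain ⟨y, hy⟩ := exists_of_kerBeta_le (ν := ν) (a := fun _ => 1) (by simpa using hcon)
  have hy0 : y ≠ 0 := by
    rintro rfl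
    simpa using hy ⟨0, hd⟩
  obtain ⟨R, hR⟩ := hν.compact.isBounded.exists_norm_le
  have hRpos : 0 ≤ R := (norm_nonneg _).trans (hR _ zero_mem_monotonePolytope)
  have hyn : 0 < ‖y‖ := norm_pos_iff.2 hy0
  have h1 : ((R + 1) / ‖y‖) • y ∈ monotonePolytope ν := by
    intro j
    simp only [Pi.smul_apply, smul_eq_mul, mul_assoc, ← Finset.mul_sum, ← hy j]
    positivity
  have h2 := hR _ h1
  rw [norm_smul, Real.norm_of_nonneg (by positivity), div_mul_cancel₀ _ hyn.ne'] at h2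
  linarith

/-- Since the conormals at a vertex span ℤ^m, half of ∑ ν_j equals ∑ a_j ν_j with integers a_j, and
x_j = (1 − 2a_j)π lies in 𝔨. Its exponential is −1 in every coordinate, which is how −I enters K. -/
theorem exists_int_of_even (hν : IsMonotoneDelzant ν)
    (heven : ∃ u : Fin m → ℤ, ∑ j, ν j = 2 • u) :
    ∃ x ∈ ToricGrassmann.kerBeta ν, ∀ j, ∃ c : ℤ, x j = (2 * c + 1) * Real.pi := by
  classical
  obtain ⟨u, hu⟩ := heven
  obtain ⟨v, hv, -⟩ := exists_extremePoint_of_mem hν zero_mem_monotonePolytope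
  have hsp := (hν.smooth v hv).2
  have hu' : u ∈ Submodule.span ℤ (Set.range ν) := by
    refine Submodule.span_mono (s := Set.range fun j : {j // v ∈ monotonePolytopeFace ν j} => ν j)
      ?_ (hsp ▸ Submodule.mem_top)
    rintro _ ⟨j, rfl⟩
    exact ⟨j, rfl⟩
  obtain ⟨a, ha⟩ := (Submodule.mem_span_range_iff_exists_fun ℤ).1 hu'
  refine ⟨fun j => (2 * (-a j : ℤ) + 1) * Real.pi, fun l => ?_, fun j => ⟨-a j, rfl⟩⟩
  have h1 : ∑ j, (2 * (-a j) + 1) * ν j l = 0 := by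
    have h2 := congrFun hu l
    have h3 := congrFun ha l
    simp only [Finset.sum_apply, Pi.smul_apply, smul_eq_mul] at h2 h3
    simp only [add_mul, Finset.sum_add_distrib, one_mul, h2, ← h3, mul_neg, neg_mul,
      Finset.sum_neg_distrib, mul_assoc, ← Finset.mul_sum]
    simp
  have h2 : (∑ j, (2 * (-a j : ℝ) + 1) * (ν j l : ℝ)) = 0 := by exact_mod_cast h1
  have h3 : ∀ j, (2 * ((-a j : ℤ) : ℝ) + 1) * Real.pi * (ν j l : ℝ) =
      Real.pi * ((2 * (-a j : ℝ) + 1) * (ν j l : ℝ)) := fun j => by push_cast; ring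
  simp only [h3, ← Finset.mul_sum, h2, mul_zero]

end Polytope

namespace ToricGrassmann

/-! ### Linear coordinates on the group and its Lie algebra -/

section Coordinates

attribute [local instance] Matrix.linftyOpNormedRing Matrix.linftyOpNormedAlgebra

variable {m d r : ℕ} (ν : Fin d → Fin m → ℤ) (n k : Fin r → ℕ)

/-- The algebra in which `G` and its Lie algebra lie. -/
abbrev Coords (d : ℕ) (k : Fin r → ℕ) : Type :=
  (Fin d → ℂ) × (∀ i, Matrix (Fin (k i)) (Fin (k i)) ℂ)

/-- The inclusion of `G` into the algebra `Coords`. -/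
noncomputable def coords : G ν k →* Coords d k where
  toFun g := (fun j => ((g.1 : Fin d → Circle) j : ℂ),
    fun i => (g.2 i : Matrix (Fin (k i)) (Fin (k i)) ℂ))
  map_one' := by ext <;> rfl
  map_mul' g h := by ext <;> rfl

/-- The inclusion of `𝔤` into the algebra `Coords`. -/
noncomputable def lieCoords : lieG ν k →ₗ[ℝ] Coords d k where
  toFun X := (fun j => Complex.I * (X.1.1 j : ℂ), X.1.2)
  map_add' X Y := by ext <;> simp [mul_add]
  map_smul' c X := by
    ext
    · simp; ring
    · simp

/-- The action of the algebra `Coords` on `ℂ^D`. -/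
noncomputable def actLin : Coords d k →ₗ[ℝ] (Idx d n k → ℂ) →ₗ[ℝ] (Idx d n k → ℂ) :=
  LinearMap.mk₂ ℝ (fun c z => blockMatrix n k c.1 c.2 *ᵥ z)
    (fun c c' z => by
      rw [← Matrix.add_mulVec, ← blockMatrix_add]
      rfl)
    (fun a c z => by
      rw [← Matrix.smul_mulVec, ← blockMatrix_smul]
      rfl)
    (fun c z z' => Matrix.mulVec_add _ _ _) (fun a c z => Matrix.mulVec_smul _ _ _)

/-- The action of the algebra `Coords` on `ℂ^D`, as a continuous bilinear map. -/
noncomputable def act : Coords d k →L[ℝ] (Idx d n k → ℂ) →L[ℝ] (Idx d n k → ℂ) :=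
  (actLin n k).toContinuousBilinearMap

variable {ν n k}

theorem act_apply (c : Coords d k) (z : Idx d n k → ℂ) :
    act n k c z = blockMatrix n k c.1 c.2 *ᵥ z := rfl

theorem act_coords (g : G ν k) (z : Level ν n k) :
    act n k (coords ν k g) (z : Idx d n k → ℂ) = (g • z : Level ν n k) := rfl

theorem act_lieCoords (X : lieG ν k) (z : Idx d n k → ℂ) :
    act n k (lieCoords ν k X) z = lieEmbed ν n k X *ᵥ z := rfl

theorem act_mul (c c' : Coords d k) (z : Idx d n k → ℂ) :
    act n k (c * c') z = act n k c (act n k c' z) := by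
  rw [act_apply, act_apply, act_apply, Matrix.mulVec_mulVec, blockMatrix_mul]
  rfl

theorem act_one (z : Idx d n k → ℂ) : act n k 1 z = z := by
  rw [act_apply]
  exact (congrArg (· *ᵥ z) (blockMatrix_one n k)).trans (Matrix.one_mulVec z)

theorem act_inl (c : Coords d k) (z : Idx d n k → ℂ) (j : Fin d) :
    act n k c z (Sum.inl j) = c.1 j * z (Sum.inl j) := by
  simp [act_apply, blockMatrix, Matrix.mulVec, dotProduct, Matrix.diagonal_apply]

theorem act_inr (c : Coords d k) (z : Idx d n k → ℂ) (i : Fin r) (a : Fin (n i)) (b : Fin (k i)) :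
    act n k c z (Sum.inr ⟨i, a, b⟩) = ∑ b', c.2 i b b' * z (Sum.inr ⟨i, a, b'⟩) := by
  simp only [act_apply, blockMatrix, Matrix.mulVec, dotProduct, Fintype.sum_sum_type,
    Matrix.fromBlocks_apply₂₁, Matrix.fromBlocks_apply₂₂, Matrix.zero_apply, zero_mul,
    Finset.sum_const_zero, zero_add]
  rw [Fintype.sum_sigma, Finset.sum_eq_single i]
  · rw [Fintype.sum_prod_type, Finset.sum_eq_single a]
    · simp [Matrix.blockDiagonal'_apply]
    · intro a' _ ha
      simp [Matrix.blockDiagonal'_apply, ha.symm]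
    · simp
  · intro i' _ hi
    refine Finset.sum_eq_zero fun x _ => ?_
    rw [Matrix.blockDiagonal'_apply_ne _ _ _ hi.symm, zero_mul]
  · simp

theorem coords_injective : Function.Injective (coords ν k) := by
  intro g h hgh
  refine Prod.ext (Subtype.ext (funext fun j => Circle.ext ?_)) (funext fun i => Subtype.ext ?_)
  · exact congrFun (congrArg Prod.fst hgh) j
  · exact congrFun (congrArg Prod.snd hgh) i

theorem coords_mul_star (g : G ν k) : coords ν k g * star (coords ν k g) = 1 := by
  refine Prod.ext (funext fun j => ?_) (funext fun i => ?_)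
  · exact Circle.coe_mul_star _
  · exact coe_mul_conjTranspose (g.2 i)

/-- Inversion on `G` is thereby the restriction of a real-linear map of `Coords`, and so preserves
smoothness. -/
theorem coords_inv (g : G ν k) : coords ν k g⁻¹ = star (coords ν k g) := by
  have h1 : coords ν k g⁻¹ * coords ν k g = 1 := by rw [← map_mul, inv_mul_cancel, map_one]
  calc coords ν k g⁻¹ = coords ν k g⁻¹ * (coords ν k g * star (coords ν k g)) := by
        rw [coords_mul_star, mul_one]
    _ = star (coords ν k g) := by rw [← mul_assoc, h1, one_mul]

/-! ### One-parameter subgroups -/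

/-- The one-parameter subgroup `s ↦ (exp(i s x), U exp(i s l) U^*)`. -/
noncomputable def oneParam (x : kerBeta ν) (U : ∀ i, Matrix.unitaryGroup (Fin (k i)) ℂ)
    (l : ∀ i, Fin (k i) → ℝ) (s : ℝ) : G ν k :=
  (⟨fun j => Circle.exp ((s • x : kerBeta ν).1 j), _, (s • x).2, rfl⟩,
    fun i => conjExp (U i) (s • l i))

theorem oneParam_add (x : kerBeta ν) (U : ∀ i, Matrix.unitaryGroup (Fin (k i)) ℂ)
    (l : ∀ i, Fin (k i) → ℝ) (s t : ℝ) :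
    oneParam x U l (s + t) = oneParam x U l s * oneParam x U l t := by
  refine Prod.ext (Subtype.ext (funext fun j => ?_)) (funext fun i => ?_)
  · change Circle.exp (((s + t) • x : kerBeta ν).1 j) = Circle.exp _ * Circle.exp _
    rw [← Circle.exp_add]
    simp [add_mul]
  · change conjExp (U i) ((s + t) • l i) = conjExp (U i) _ * conjExp (U i) _
    rw [← conjExp_add, add_smul]

theorem oneParam_zero (x : kerBeta ν) (U : ∀ i, Matrix.unitaryGroup (Fin (k i)) ℂ)
    (l : ∀ i, Fin (k i) → ℝ) : oneParam x U l 0 = 1 := by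
  refine Prod.ext (Subtype.ext (funext fun j => ?_)) (funext fun i => ?_)
  · change Circle.exp (((0 : ℝ) • x : kerBeta ν).1 j) = 1
    simp
  · change conjExp (U i) ((0 : ℝ) • l i) = 1
    rw [zero_smul, conjExp_zero]

theorem continuous_oneParam (x : kerBeta ν) (U : ∀ i, Matrix.unitaryGroup (Fin (k i)) ℂ)
    (l : ∀ i, Fin (k i) → ℝ) : Continuous (oneParam x U l) := by
  refine Continuous.prodMk (continuous_induced_rng.2 (continuous_pi fun j => ?_))
    (continuous_pi fun i => ?_)
  · refine Circle.exp.continuous.comp ?_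
    change Continuous fun s : ℝ => s * x.1 j
    fun_prop
  · exact (continuous_conjExp (U i)).comp (continuous_id.smul continuous_const)

theorem exists_eq_oneParam (g : G ν k) : ∃ (x : kerBeta ν)
    (U : ∀ i, Matrix.unitaryGroup (Fin (k i)) ℂ) (l : ∀ i, Fin (k i) → ℝ),
    g = oneParam x U l 1 := by
  obtain ⟨⟨t, x, hx, rfl⟩, A⟩ := g
  choose U l h using fun i => exists_eq_conjExp (A i)
  refine ⟨⟨x, hx⟩, U, l, Prod.ext (Subtype.ext (funext fun j => ?_)) (funext fun i => ?_)⟩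
  · change Circle.exp (x j) = Circle.exp (((1 : ℝ) • x) j)
    rw [one_smul]
  · change A i = conjExp (U i) ((1 : ℝ) • l i)
    rw [one_smul, h]

theorem circle_exp_zpow (y : ℝ) (c : ℤ) : Circle.exp y ^ c = Circle.exp (c * y) := by
  rw [← zsmul_eq_mul, Circle.exp_zsmul]

theorem prod_circle_exp {ι : Type*} (S : Finset ι) (f : ι → ℝ) :
    ∏ i ∈ S, Circle.exp (f i) = Circle.exp (∑ i ∈ S, f i) := by
  classical
  induction S using Finset.induction_on with
  | empty => simp
  | insert i S hi ih => rw [Finset.prod_insert hi, Finset.sum_insert hi, Circle.exp_add, ih]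

theorem coe_prod_circle {ι : Type*} (S : Finset ι) (f : ι → Circle) :
    ((∏ i ∈ S, f i : Circle) : ℂ) = ∏ i ∈ S, (f i : ℂ) := map_prod Circle.coeHom f S

theorem hasDerivAt_circle_exp (x : ℝ) (s : ℝ) :
    HasDerivAt (fun s : ℝ => (Circle.exp (s * x) : ℂ)) (Circle.exp (s * x) * (Complex.I * x)) s := by
  have h1 : HasDerivAt (fun s : ℝ => ((s * x : ℝ) : ℂ) * Complex.I) (Complex.I * x) s := by
    have := ((hasDerivAt_id s).ofReal_comp).mul_const ((x : ℂ) * Complex.I)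
    simp only [id, Complex.ofReal_one, one_mul] at this
    convert! this using 1
    · funext s; push_cast; ring
    · ring
  simpa [Circle.coe_exp] using h1.cexp

theorem contDiff_circle_exp (x : ℝ) : ContDiff ℝ ∞ fun s : ℝ => (Circle.exp (s * x) : ℂ) := by
  have : (fun s : ℝ => (Circle.exp (s * x) : ℂ)) =
      fun s : ℝ => Complex.exp (((s * x : ℝ) : ℂ) * Complex.I) := by
    funext s; simp
  rw [this]
  have h1 : ContDiff ℝ ∞ fun s : ℝ => ((s * x : ℝ) : ℂ) :=
    Complex.ofRealCLM.contDiff.comp (contDiff_id.mul contDiff_const)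
  exact (h1.mul contDiff_const).cexp

/-- Conjugation of diagonal matrices as a real linear map. -/
noncomputable def conjDiagonal {ι : Type*} [Fintype ι] [DecidableEq ι]
    (U : Matrix.unitaryGroup ι ℂ) : (ι → ℂ) →L[ℝ] Matrix ι ι ℂ :=
  LinearMap.toContinuousLinearMap
    { toFun := fun c => (U : Matrix ι ι ℂ) * Matrix.diagonal c * (U : Matrix ι ι ℂ)ᴴ
      map_add' := fun c c' => by
        rw [← Matrix.add_mul, ← Matrix.mul_add, Matrix.diagonal_add]
        rfl
      map_smul' := fun a c => by
        rw [Matrix.diagonal_smul, RingHom.id_apply, Matrix.mul_smul, Matrix.smul_mul] }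

theorem contDiff_coords_oneParam (x : kerBeta ν) (U : ∀ i, Matrix.unitaryGroup (Fin (k i)) ℂ)
    (l : ∀ i, Fin (k i) → ℝ) : ContDiff ℝ ∞ fun s => coords ν k (oneParam x U l s) := by
  refine ContDiff.prodMk (contDiff_pi.2 fun j => contDiff_circle_exp (x.1 j))
    (contDiff_pi.2 fun i => ?_)
  exact (conjDiagonal (U i)).contDiff.comp (contDiff_pi.2 fun a => contDiff_circle_exp (l i a))

theorem hasDerivAt_coords_oneParam (X : lieG ν k) {U : ∀ i, Matrix.unitaryGroup (Fin (k i)) ℂ}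
    {l : ∀ i, Fin (k i) → ℝ} (h : ∀ i, X.1.2 i = (U i : Matrix _ _ ℂ) *
      Matrix.diagonal (fun a => Complex.I * (l i a : ℂ)) * (U i : Matrix _ _ ℂ)ᴴ) :
    HasDerivAt (fun s => coords ν k (oneParam ⟨X.1.1, X.2.1⟩ U l s)) (lieCoords ν k X) 0 := by
  refine HasDerivAt.prodMk (hasDerivAt_pi.2 fun j => ?_) (hasDerivAt_pi.2 fun i => ?_)
  · have h1 := hasDerivAt_circle_exp (X.1.1 j) 0
    rw [zero_mul, Circle.exp_zero, Circle.coe_one, one_mul] at h1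
    exact h1
  · have h1 : HasDerivAt (fun s : ℝ => fun a => (Circle.exp (s * l i a) : ℂ))
        (fun a => Complex.I * (l i a : ℂ)) 0 := hasDerivAt_pi.2 fun a => by
      simpa using hasDerivAt_circle_exp (l i a) 0
    have h2 := (conjDiagonal (U i)).hasFDerivAt.comp_hasDerivAt (0 : ℝ) h1
    rw [h i]
    exact h2

/-! ### Characters -/

/-- The character `(t, A) ↦ ∏ t_j^{a_j} ∏ det(A_i)^{b_i}`. -/
noncomputable def character (ν : Fin d → Fin m → ℤ) (k : Fin r → ℕ) (a : Fin d → ℤ)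
    (b : Fin r → ℤ) : G ν k →* Circle where
  toFun g := (∏ j, (g.1 : Fin d → Circle) j ^ a j) * ∏ i, detCircle (g.2 i) ^ b i
  map_one' := by simp
  map_mul' g h := by
    simp only [Prod.fst_mul, Prod.snd_mul, Subgroup.coe_mul, Pi.mul_apply, mul_zpow, map_mul,
      Finset.prod_mul_distrib]
    exact mul_mul_mul_comm _ _ _ _

/-- The differential of a character, divided by `i`. -/
noncomputable def characterDeriv (ν : Fin d → Fin m → ℤ) (k : Fin r → ℕ) (a : Fin d → ℤ)
    (b : Fin r → ℤ) : lieG ν k →ₗ[ℝ] ℝ where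
  toFun X := ∑ j, a j * X.1.1 j + ∑ i, b i * ((X.1.2 i).trace).im
  map_add' X Y := by
    simp only [Submodule.coe_add, Prod.fst_add, Prod.snd_add, Pi.add_apply, Matrix.trace_add,
      Complex.add_im, mul_add, Finset.sum_add_distrib]
    ring
  map_smul' c X := by
    simp only [Submodule.coe_smul, Prod.smul_fst, Prod.smul_snd, Pi.smul_apply, Matrix.trace_smul,
      Complex.smul_im, smul_eq_mul, RingHom.id_apply, mul_add, Finset.mul_sum]
    congr 1 <;> exact Finset.sum_congr rfl fun _ _ => by ring

/-- The extension of a character to the algebra `Coords`. -/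
noncomputable def characterExt (a : Fin d → ℤ) (b : Fin r → ℤ) (c : Coords d k) : ℂ :=
  (∏ j, c.1 j ^ a j) * ∏ i, (c.2 i).det ^ b i

theorem characterExt_coords (a : Fin d → ℤ) (b : Fin r → ℤ) (g : G ν k) :
    characterExt a b (coords ν k g) = character ν k a b g := by
  simp only [characterExt, character, coords, MonoidHom.coe_mk, OneHom.coe_mk, Circle.coe_mul,
    coe_prod_circle, Circle.coe_zpow, coe_detCircle]

theorem continuous_character (a : Fin d → ℤ) (b : Fin r → ℤ) :
    Continuous (character ν k a b) := by
  refine Continuous.mul (continuous_finsetProd _ fun j _ => Continuous.zpow ?_ _)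
    (continuous_finsetProd _ fun i _ => Continuous.zpow ?_ _)
  · exact (continuous_apply j).comp (continuous_subtype_val.comp continuous_fst)
  · exact continuous_detCircle.comp ((continuous_apply i).comp continuous_snd)

theorem character_oneParam (a : Fin d → ℤ) (b : Fin r → ℤ) (x : kerBeta ν)
    (U : ∀ i, Matrix.unitaryGroup (Fin (k i)) ℂ) (l : ∀ i, Fin (k i) → ℝ) (s : ℝ) :
    character ν k a b (oneParam x U l s) =
      Circle.exp (s * (∑ j, a j * x.1 j + ∑ i, b i * ∑ c, l i c)) := by
  simp only [character, oneParam, MonoidHom.coe_mk, OneHom.coe_mk, detCircle_conjExp, circle_exp_zpow,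
    prod_circle_exp,
    ← Circle.exp_add]
  congr 1
  simp only [Submodule.coe_smul, Pi.smul_apply, smul_eq_mul, ← Finset.mul_sum, mul_add]
  rw [Finset.mul_sum, Finset.mul_sum]
  congr 1 <;> exact Finset.sum_congr rfl fun _ _ => by ring

/-- Diagonalizing the skew-Hermitian components replaces the matrix exponential by conjugated
diagonal exponentials, on which the determinants, and so all characters, are explicit. -/
theorem exists_oneParam (X : lieG ν k) : ∃ c : ℝ → G ν k, c 0 = 1 ∧
    (∀ s t, c (s + t) = c s * c t) ∧ ContDiff ℝ ∞ (fun s => coords ν k (c s)) ∧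
    HasDerivAt (fun s => coords ν k (c s)) (lieCoords ν k X) 0 ∧
    ∀ a b s, character ν k a b (c s) = Circle.exp (s * characterDeriv ν k a b X) := by
  choose U l h using fun i => exists_eq_conj_diagonal_of_skew (X.2.2 i)
  refine ⟨oneParam ⟨X.1.1, X.2.1⟩ U l, oneParam_zero _ _ _, oneParam_add _ _ _,
    contDiff_coords_oneParam _ _ _, hasDerivAt_coords_oneParam X h, fun a b s => ?_⟩
  rw [character_oneParam]
  congr 3
  refine Finset.sum_congr rfl fun i _ => ?_
  congr 1
  rw [h i, Matrix.mul_assoc, Matrix.trace_mul_comm, Matrix.mul_assoc, conjTranspose_mul_coe,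
    mul_one, Matrix.trace_diagonal]
  simp

theorem _root_.ContDiffAt.zpow_of_ne_zero {E : Type*} [NormedAddCommGroup E] [NormedSpace ℝ E]
    {f : E → ℂ} {x : E} (hf : ContDiffAt ℝ ∞ f x) (hx : f x ≠ 0) (a : ℤ) :
    ContDiffAt ℝ ∞ (fun y => f y ^ a) x := by
  cases a with
  | ofNat a => simpa using hf.pow a
  | negSucc a =>
    simp only [zpow_negSucc]
    exact (hf.pow (a + 1)).inv (pow_ne_zero _ hx)

theorem contDiff_det {ι : Type*} [Fintype ι] [DecidableEq ι] :
    ContDiff ℝ ∞ fun A : Matrix ι ι ℂ => A.det := by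
  simp only [Matrix.det_apply]
  refine ContDiff.sum fun σ _ => ContDiff.const_smul _ (contDiff_prod fun i _ => ?_)
  exact (LinearMap.toContinuousLinearMap
    (Matrix.entryLinearMap ℝ ℂ (σ i) i : Matrix ι ι ℂ →ₗ[ℝ] ℂ)).contDiff

theorem contDiff_coords_fst (j : Fin d) : ContDiff ℝ ∞ fun c : Coords d k => c.1 j :=
  (contDiff_apply ℝ ℂ j).comp contDiff_fst

theorem contDiff_coords_snd (i : Fin r) : ContDiff ℝ ∞ fun c : Coords d k => c.2 i :=
  (ContinuousLinearMap.proj (R := ℝ) (φ := fun i => Matrix (Fin (k i)) (Fin (k i)) ℂ)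
    i).contDiff.comp contDiff_snd

theorem contDiffAt_characterExt (a : Fin d → ℤ) (b : Fin r → ℤ) (g : G ν k) :
    ContDiffAt ℝ ∞ (characterExt a b) (coords ν k g) := by
  refine ContDiffAt.mul (contDiffAt_prod fun j _ => ?_) (contDiffAt_prod fun i _ => ?_)
  · exact ((contDiff_coords_fst j).contDiffAt).zpow_of_ne_zero (Circle.coe_ne_zero _) _
  · exact ContDiffAt.zpow_of_ne_zero (f := fun c : Coords d k => (c.2 i).det)
      ((contDiff_det.comp (contDiff_coords_snd i)).contDiffAt)
      (Matrix.UnitaryGroup.det_isUnit (g.2 i)).ne_zero _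

/-- Vectors tangent to a subset of `G`, in the weakest sense. -/
def IsTangentTo (S : Set (G ν k)) (g : G ν k) (D : Coords d k) : Prop :=
  ∀ f : Coords d k → ℂ, DifferentiableAt ℝ f (coords ν k g) → (∀ h ∈ S, f (coords ν k h) = 0) →
    fderiv ℝ f (coords ν k g) D = 0

/-- Exponentiate xP = x for x ∈ 𝔨. These monomial equations serve as the defining equations of K:
for its tangent vectors, its closedness, and the equivariance of `torusMap`. -/
theorem coords_fst_eq_prod {P : Fin d → Fin d → ℤ} (hP : IsTorusRetraction ν P)
    (g : G ν k) (l : Fin d) :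
    (g.1 : Fin d → Circle) l = ∏ j, (g.1 : Fin d → Circle) j ^ P j l := by
  obtain ⟨⟨t, x, hx, rfl⟩, A⟩ := g
  have h1 := hP.fix x hx l
  change Circle.exp (x l) = ∏ j, Circle.exp (x j) ^ P j l
  simp only [circle_exp_zpow, prod_circle_exp]
  conv_lhs => rw [← h1]
  congr 1
  exact Finset.sum_congr rfl fun j _ => mul_comm _ _

/-- It is enough to test on three kinds of functions vanishing on `G`: the entries of A A^* − 1, the
functions t_j t_j^* − 1, and t_l − ∏ t_j^{P_{jl}}. They say in turn that the matrix part is skew,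
that the torus velocity is imaginary, and that it lies in 𝔨. -/
theorem IsTangentTo.exists_lieCoords {P : Fin d → Fin d → ℤ} (hP : IsTorusRetraction ν P)
    {S : Set (G ν k)} {g : G ν k} {D : Coords d k} (hD : IsTangentTo S g D) :
    ∃ X : lieG ν k, D = lieCoords ν k X * coords ν k g := by
  set t : Fin d → ℂ := fun j => ((g.1 : Fin d → Circle) j : ℂ) with ht
  have htt : ∀ j, t j * star (t j) = 1 := fun j => Circle.coe_mul_star _
  have hcurve : ∀ (f : Coords d k → ℂ), DifferentiableAt ℝ f (coords ν k g) →
      (∀ h ∈ S, f (coords ν k h) = 0) → ∀ {γ : ℝ → Coords d k}, γ 0 = coords ν k g →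
      HasDerivAt γ D 0 → HasDerivAt (fun s => f (γ s)) 0 0 := by
    intro f hf hS γ hγ0 hγ
    have h1 := hf.hasFDerivAt
    rw [← hγ0] at h1
    have h2 := h1.comp_hasDerivAt (0 : ℝ) hγ
    rw [hγ0] at h2
    exact h2.congr_deriv (hD f hf hS)
  have hline : HasDerivAt (fun s : ℝ => coords ν k g + s • D) D 0 := by
    have h1 := ((hasDerivAt_id (0 : ℝ)).smul_const D).const_add (coords ν k g)
    rw [one_smul] at h1
    exact h1
  -- the unitary factors
  have hU : ∀ i, D.2 i * star (g.2 i).1 + (g.2 i).1 * star (D.2 i) = 0 := by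
    intro i
    ext b b'
    have hf : Differentiable ℝ fun c : Coords d k => (c.2 i * (c.2 i)ᴴ - 1) b b' := by
      have h1 : (fun c : Coords d k => (c.2 i * (c.2 i)ᴴ - 1) b b') = fun c =>
          (∑ e, c.2 i b e * star (c.2 i b' e)) - (1 : Matrix _ _ ℂ) b b' := by
        funext c
        simp [Matrix.mul_apply]
      rw [h1]
      have h2 : ∀ b e, Differentiable ℝ fun c : Coords d k => c.2 i b e := fun b e =>
        ((LinearMap.toContinuousLinearMap (Matrix.entryLinearMap ℝ ℂ b e :
          Matrix (Fin (k i)) (Fin (k i)) ℂ →ₗ[ℝ] ℂ)).differentiable).comp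
          ((contDiff_coords_snd i).differentiable (by simp))
      exact (Differentiable.fun_sum fun e _ => (h2 b e).mul (h2 b' e).star).sub_const _
    have h3 := hcurve _ hf.differentiableAt (fun h _ => by
      have := coe_mul_conjTranspose (h.2 i)
      change ((h.2 i).1 * (h.2 i).1ᴴ - 1) b b' = 0
      rw [this, sub_self, Matrix.zero_apply]) (by simp) hline
    -- Along the line through g in direction D the test function is a polynomial in s without
    -- constant term, so its derivative at 0 is the linear coefficient D g^* + g D^*.
    have h4 : (fun s : ℝ => ((coords ν k g + s • D).2 i * ((coords ν k g + s • D).2 i)ᴴ - 1) b b') =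
        fun s : ℝ => (s : ℂ) * (D.2 i * star (g.2 i).1 +
          (g.2 i).1 * star (D.2 i)) b b' + (s : ℂ) ^ 2 * (D.2 i * (D.2 i)ᴴ) b b' := by
      funext s
      have h5 : (coords ν k g + s • D).2 i = (g.2 i).1 + (s : ℂ) • D.2 i := by
        ext; simp [coords]
      rw [h5]
      simp only [Matrix.conjTranspose_add, Matrix.conjTranspose_smul, Complex.star_def,
        Complex.conj_ofReal, Matrix.add_mul, Matrix.mul_add, Matrix.smul_mul, Matrix.mul_smul,
        coe_mul_conjTranspose, Matrix.sub_apply, Matrix.add_apply, Matrix.smul_apply, smul_eq_mul,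
        Matrix.star_eq_conjTranspose]
      ring
    rw [h4] at h3
    have h6 : HasDerivAt (fun s : ℝ => (s : ℂ)) 1 0 := (hasDerivAt_id (0 : ℝ)).ofReal_comp
    have h7 := (h6.mul_const ((D.2 i * star (g.2 i).1 +
      (g.2 i).1 * star (D.2 i)) b b')).add
        ((h6.pow 2).mul_const ((D.2 i * (D.2 i)ᴴ) b b'))
    have h8 := h7.unique h3
    simpa using h8
  -- the torus factor
  have hx : ∀ j, ∃ x : ℝ, D.1 j = Complex.I * x * t j := by
    intro j
    have hf : Differentiable ℝ fun c : Coords d k => c.1 j * star (c.1 j) - 1 := by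
      have h2 := (contDiff_coords_fst (k := k) j).differentiable (by simp)
      exact (h2.mul h2.star).sub_const _
    have h3 := hcurve _ hf.differentiableAt (fun h _ => by
      exact sub_eq_zero.2 (Circle.coe_mul_star _)) (by simp) hline
    have h4 : (fun s : ℝ => (coords ν k g + s • D).1 j * star ((coords ν k g + s • D).1 j) - 1) =
        fun s : ℝ => (s : ℂ) * (D.1 j * star (t j) + t j * star (D.1 j)) +
          (s : ℂ) ^ 2 * (D.1 j * star (D.1 j)) := by
      funext s
      have h5 : (coords ν k g + s • D).1 j = t j + (s : ℂ) * D.1 j := by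
        simp [coords, ht]
      rw [h5]
      simp only [star_add, star_mul', Complex.star_def, Complex.conj_ofReal]
      have := htt j
      simp only [Complex.star_def] at this
      linear_combination this
    rw [h4] at h3
    have h6 : HasDerivAt (fun s : ℝ => (s : ℂ)) 1 0 := (hasDerivAt_id (0 : ℝ)).ofReal_comp
    have h7 := (h6.mul_const (D.1 j * star (t j) + t j * star (D.1 j))).add
        ((h6.pow 2).mul_const (D.1 j * star (D.1 j)))
    have h8 := h7.unique h3
    simp only [one_mul, Complex.ofReal_zero, pow_one, Nat.cast_ofNat, mul_zero, zero_mul,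
      add_zero, Nat.add_one_sub_one, mul_one] at h8
    refine ⟨(D.1 j * star (t j)).im, ?_⟩
    have h9 : (D.1 j * star (t j)).re = 0 := by
      have := congrArg Complex.re h8
      simp only [Complex.star_def, Complex.add_re, Complex.mul_re, Complex.conj_re,
        Complex.conj_im, Complex.zero_re] at this ⊢
      linarith
    have h10 : Complex.I * ((D.1 j * star (t j)).im : ℂ) = D.1 j * star (t j) := by
      apply Complex.ext
      · simp only [Complex.mul_re, Complex.I_re, Complex.I_im, Complex.ofReal_re,
          Complex.ofReal_im, h9]
        ring
      · simp only [Complex.mul_im, Complex.I_re, Complex.I_im, Complex.ofReal_re,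
          Complex.ofReal_im]
        ring
    rw [h10, mul_assoc, mul_comm (star (t j)), htt, mul_one]
  choose x hx using hx
  have hxP : ∀ l, ∑ j, x j * (P j l : ℝ) = x l := by
    intro l
    -- A curve with velocity `D` whose torus coordinates stay on the circle: along it the monomial
    -- equation becomes a comparison of two exponentials, whose derivative is the linear equation xP
    -- = x.
    let γ : ℝ → Coords d k := fun s =>
      (fun j => t j * (Circle.exp (s * x j) : ℂ), (coords ν k g).2 + s • D.2)
    have hγ0 : γ 0 = coords ν k g := by
      refine Prod.ext (funext fun j => ?_) ?_
      · simp [γ, ht, coords]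
      · simp [γ]
    have hγ : HasDerivAt γ D 0 := by
      refine HasDerivAt.prodMk (hasDerivAt_pi.2 fun j => ?_) ?_
      · have h1 := (hasDerivAt_circle_exp (x j) 0).const_mul (t j)
        rw [zero_mul, Circle.exp_zero, Circle.coe_one, one_mul] at h1
        rw [hx j, mul_comm]
        exact h1
      · simpa only [one_smul, id] using
          ((hasDerivAt_id (0 : ℝ)).smul_const D.2).const_add (coords ν k g).2
    have hf : ContDiffAt ℝ ∞ (fun c : Coords d k => c.1 l - ∏ j, c.1 j ^ P j l) (coords ν k g) :=
      (contDiff_coords_fst l).contDiffAt.sub (contDiffAt_prod fun j _ =>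
        ((contDiff_coords_fst j).contDiffAt).zpow_of_ne_zero (Circle.coe_ne_zero _) _)
    have h3 := hcurve _ (hf.differentiableAt (by simp)) (fun h _ => by
      have h4 := congrArg ((↑) : Circle → ℂ) (coords_fst_eq_prod hP h l)
      rw [coe_prod_circle] at h4
      simp only [Circle.coe_zpow] at h4
      exact sub_eq_zero.2 h4) hγ0 hγ
    have h5 : (fun s => (γ s).1 l - ∏ j, (γ s).1 j ^ P j l) = fun s : ℝ =>
        t l * ((Circle.exp (s * x l) : ℂ) - (Circle.exp (s * ∑ j, x j * (P j l : ℝ)) : ℂ)) := by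
      funext s
      have h6 : ∏ j, (γ s).1 j ^ P j l =
          (∏ j, t j ^ P j l) * (Circle.exp (s * ∑ j, x j * (P j l : ℝ)) : ℂ) := by
        have h7 : s * ∑ j, x j * (P j l : ℝ) = ∑ j, P j l * (s * x j) := by
          rw [Finset.mul_sum]
          exact Finset.sum_congr rfl fun j _ => by ring
        rw [h7, ← prod_circle_exp, coe_prod_circle, ← Finset.prod_mul_distrib]
        refine Finset.prod_congr rfl fun j _ => ?_
        rw [← circle_exp_zpow, Circle.coe_zpow, ← mul_zpow]
      have h8 : ∏ j, t j ^ P j l = t l := by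
        have h4 := congrArg ((↑) : Circle → ℂ) (coords_fst_eq_prod hP g l)
        rw [coe_prod_circle] at h4
        simp only [Circle.coe_zpow] at h4
        exact h4.symm
      rw [h6, h8, mul_sub]
    rw [h5] at h3
    have h9 := ((hasDerivAt_circle_exp (x l) 0).sub
      (hasDerivAt_circle_exp (∑ j, x j * (P j l : ℝ)) 0)).const_mul (t l)
    have h10 := h9.unique h3
    rw [zero_mul, zero_mul, Circle.exp_zero, Circle.coe_one, one_mul, one_mul, ← mul_sub] at h10
    have h11 : t l ≠ 0 := Circle.coe_ne_zero _
    have h12 := (mul_eq_zero.1 ((mul_eq_zero.1 h10).resolve_left h11)).resolve_left Complex.I_ne_zero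
    rw [← Complex.ofReal_sub, Complex.ofReal_eq_zero] at h12
    linarith
  have hxker : x ∈ kerBeta ν := by
    intro l'
    have h1 : ∀ l, x l * (ν l l' : ℝ) = ∑ j, x j * ((P j l * ν l l' : ℤ) : ℝ) := fun l => by
      rw [← hxP l, Finset.sum_mul]
      exact Finset.sum_congr rfl fun j _ => by push_cast; ring
    rw [Finset.sum_congr rfl fun l _ => h1 l, Finset.sum_comm]
    refine Finset.sum_eq_zero fun j _ => ?_
    rw [← Finset.mul_sum, ← Int.cast_sum, hP.row_mem, Int.cast_zero, mul_zero]
  refine ⟨⟨(x, fun i => D.2 i * (g.2 i).1ᴴ), hxker, fun i => ?_⟩,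
    Prod.ext (funext fun j => hx j) (funext fun i => ?_)⟩
  · rw [Matrix.conjTranspose_mul, Matrix.conjTranspose_conjTranspose, eq_neg_iff_add_eq_zero, add_comm]
    exact hU i
  · change D.2 i = D.2 i * (g.2 i).1ᴴ * (g.2 i).1
    rw [Matrix.mul_assoc, conjTranspose_mul_coe, mul_one]

end Coordinates

end ToricGrassmann

namespace ToricGrassmann

/-! ### The character with kernel `G_0^τ` -/

section Theta

variable {m d r : ℕ} {ν : Fin d → Fin m → ℤ} {n k : Fin r → ℕ}

theorem exists_bezout {ι : Type*} [Fintype ι] {f : ι → ℤ} (hf : f ≠ 0) :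
    ∃ (e : ℕ) (g c : ι → ℤ), 0 < e ∧ (∀ i, f i = e * g i) ∧ ∑ i, c i * g i = 1 := by
  obtain ⟨a, ha⟩ := (IsPrincipalIdealRing.principal (Ideal.span (Set.range f))).principal
  have hmem : ∀ i, ∃ g, f i = a * g := fun i => by
    have h1 : f i ∈ Ideal.span (Set.range f) := Ideal.subset_span ⟨i, rfl⟩
    rw [ha] at h1
    exact Ideal.mem_span_singleton.1 h1
  choose g hg using hmem
  have ha0 : a ≠ 0 := by
    rintro rfl
    exact hf (funext fun i => by simp [hg i])
  obtain ⟨c, hc⟩ := (Submodule.mem_span_range_iff_exists_fun ℤ (v := f)).1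
    (show a ∈ Ideal.span (Set.range f) from ha ▸ Ideal.mem_span_singleton_self a)
  have h1 : ∑ i, c i * g i = 1 := by
    have h2 : a * ∑ i, c i * g i = a * 1 := by
      rw [mul_one, Finset.mul_sum]
      conv_rhs => rw [← hc]
      exact Finset.sum_congr rfl fun i _ => by rw [smul_eq_mul, hg i]; ring
    exact mul_left_cancel₀ ha0 h2
  -- The generator of the ideal is determined up to sign. Moving the sign into `g` and `c` makes `e`
  -- positive, which later fixes the orientation of the circle.
  rcases Int.natAbs_eq a with h | h
  · exact ⟨a.natAbs, g, c, Int.natAbs_pos.2 ha0, fun i => by rw [← h, hg i], h1⟩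
  · refine ⟨a.natAbs, -g, -c, Int.natAbs_pos.2 ha0, fun i => ?_, by simpa using h1⟩
    rw [Pi.neg_apply, mul_neg, ← neg_mul, ← h, hg i]

theorem det_blockDiagonal' {p : ℕ} {ι : Fin p → Type} [∀ i, Fintype (ι i)] [∀ i, DecidableEq (ι i)]
    (M : ∀ i, Matrix (ι i) (ι i) ℂ) : (Matrix.blockDiagonal' M).det = ∏ i, (M i).det := by
  have h1 : (Matrix.blockDiagonal' M).BlockTriangular Sigma.fst :=
    Matrix.blockTriangular_blockDiagonal' M
  rw [h1.det_fintype]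
  refine Finset.prod_congr rfl fun i _ => ?_
  rw [← Matrix.det_reindex_self (Equiv.sigmaSubtype i)]
  congr 1
  ext x y
  simp [Matrix.toSquareBlock_def, Matrix.blockDiagonal'_apply, Equiv.sigmaSubtype]

theorem det_embed (g : G ν k) :
    (embed ν n k g).det = character ν k 1 (fun i => n i) g := by
  rw [← characterExt_coords]
  simp only [embed, MonoidHom.coe_mk, OneHom.coe_mk, blockMatrix, Matrix.det_fromBlocks_zero₂₁,
    Matrix.det_diagonal, det_blockDiagonal', Matrix.det_kronecker, characterExt, coords,
    Pi.one_apply, zpow_one, zpow_natCast, Matrix.det_one, one_pow, one_mul, Fintype.card_fin]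

theorem mem_specialG (g : G ν k) :
    g ∈ specialG ν n k ↔ character ν k 1 (fun i => n i) g = 1 := by
  rw [specialG, MonoidHom.mem_ker, MonoidHom.comp_apply, Matrix.coe_detMonoidHom, det_embed,
    ← Circle.coe_one, Circle.coe_inj]

theorem trace_fromBlocks {p q : Type} [Fintype p] [Fintype q] (A : Matrix p p ℂ) (B : Matrix p q ℂ)
    (C : Matrix q p ℂ) (D : Matrix q q ℂ) :
    (Matrix.fromBlocks A B C D).trace = A.trace + D.trace := by
  simp [Matrix.trace, Fintype.sum_sum_type]

/-- The value p is half the derivative of the determinant character; this ties the level of the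
moment map to the circle `G / G_0^τ`. -/
theorem trace_lieEmbed (X : lieG ν k) : (-(Complex.I / 2) * (lieEmbed ν n k X).trace).re =
    1 / 2 * characterDeriv ν k 1 (fun i => n i) X := by
  simp only [lieEmbed, LinearMap.coe_mk, AddHom.coe_mk, blockMatrix, trace_fromBlocks,
    Matrix.trace_diagonal, Matrix.trace_blockDiagonal', Matrix.trace_kronecker, Matrix.trace_one,
    Fintype.card_fin, characterDeriv, ← Finset.mul_sum]
  have h1 : ∀ z : ℂ, (-(Complex.I / 2) * z).re = 1 / 2 * z.im := fun z => by
    simp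
  rw [h1]
  simp [Complex.mul_im]

theorem embed_injective (hn : ∀ i, 1 ≤ n i) : Function.Injective (embed ν n k) := by
  intro g h hgh
  apply coords_injective
  refine Prod.ext (funext fun j => ?_) (funext fun i => ?_)
  · have h1 := congrFun (congrFun hgh (Sum.inl j)) (Sum.inl j)
    simpa [embed, blockMatrix, coords, -SetLike.coe_eq_coe] using h1
  · ext b b'
    have h1 := congrFun (congrFun hgh (Sum.inr ⟨i, ⟨0, hn i⟩, b⟩)) (Sum.inr ⟨i, ⟨0, hn i⟩, b'⟩)
    simpa [embed, blockMatrix, coords, Matrix.blockDiagonal'_apply] using h1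

theorem exists_embed_eq_neg_one (hν : IsMonotoneDelzant ν)
    (heven : ∃ u : Fin m → ℤ, ∑ j, ν j = 2 • u) : ∃ g : G ν k, embed ν n k g = -1 := by
  obtain ⟨x, hx, hxc⟩ := exists_int_of_even hν heven
  refine ⟨(⟨fun j => Circle.exp (x j), x, hx, rfl⟩, fun i => ⟨-1, by
    simp [Matrix.mem_unitaryGroup_iff]⟩), ?_⟩
  have h1 : (fun j => (Circle.exp (x j) : ℂ)) = (-1 : ℝ) • (1 : Fin d → ℂ) := by
    funext j
    obtain ⟨c, hc⟩ := hxc j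
    have h2 : x j = c * (2 * Real.pi) + Real.pi := by rw [hc]; ring
    rw [h2, Circle.exp_add, Circle.exp_int_mul_two_pi, one_mul]
    simp
  have h2 : blockMatrix n k (fun j => (Circle.exp (x j) : ℂ)) (-1) = -1 := by
    have h3 : (-1 : ∀ i, Matrix (Fin (k i)) (Fin (k i)) ℂ) =
      (-1 : ℝ) • (1 : ∀ i, Matrix (Fin (k i)) (Fin (k i)) ℂ) := by simp
    rw [h1, h3, blockMatrix_smul, blockMatrix_one]
    simp
  exact h2

theorem character_eq_zpow {a a' : Fin d → ℤ} {b b' : Fin r → ℤ} {e : ℤ}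
    (ha : ∀ j, a j = e * a' j) (hb : ∀ i, b i = e * b' i) (g : G ν k) :
    character ν k a b g = character ν k a' b' g ^ e := by
  simp only [character, MonoidHom.coe_mk, OneHom.coe_mk, ha, hb, mul_zpow, ← Finset.prod_zpow,
    ← _root_.zpow_mul, mul_comm e]

/-- The exponents (1,…,1) do not show whether the determinant is a proper power on K. Applying `P`
gives the same character with exponents fixed by `P`, from which divisibility can be read off. -/
theorem character_one_eq {P : Fin d → Fin d → ℤ} (hP : IsTorusRetraction ν P) (b : Fin r → ℤ)
    (g : G ν k) : character ν k 1 b g = character ν k (fun j => ∑ l, P j l) b g := by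
  have h1 : ∏ j, (g.1 : Fin d → Circle) j = ∏ j, (g.1 : Fin d → Circle) j ^ ∑ l, P j l := by
    rw [Finset.prod_congr rfl fun l _ => coords_fst_eq_prod hP g l, Finset.prod_comm]
    refine Finset.prod_congr rfl fun j _ => ?_
    exact (map_sum (zmultiplesHom (Additive Circle) (Additive.ofMul ((g.1 : Fin d → Circle) j))) (fun l => P j l) Finset.univ).symm
  simp only [character, MonoidHom.coe_mk, OneHom.coe_mk, Pi.one_apply, zpow_one, h1]

theorem characterDeriv_one_eq {P : Fin d → Fin d → ℤ} (hP : IsTorusRetraction ν P)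
    (b : Fin r → ℤ) (X : lieG ν k) :
    characterDeriv ν k 1 b X = characterDeriv ν k (fun j => ∑ l, P j l) b X := by
  simp only [characterDeriv, LinearMap.coe_mk, AddHom.coe_mk, Pi.one_apply, Int.cast_one, one_mul,
    Int.cast_sum]
  congr 1
  rw [← Finset.sum_congr rfl fun l _ => hP.fix _ X.2.1 l, Finset.sum_comm]
  exact Finset.sum_congr rfl fun j _ => by rw [← Finset.mul_sum, mul_comm]

theorem isTorusRetraction_idem {P : Fin d → Fin d → ℤ} (hP : IsTorusRetraction ν P) (i l : Fin d) :
    ∑ j, P i j * P j l = P i l := by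
  have h1 : (fun j => (P i j : ℝ)) ∈ kerBeta ν := fun l' => by
    beta_reduce
    exact_mod_cast hP.row_mem i l'
  exact_mod_cast hP.fix _ h1 l

theorem finite_roots_circle {e : ℕ} (he : 0 < e) : {z : Circle | z ^ e = 1}.Finite := by
  refine Set.Finite.of_finite_image (f := fun z : Circle => (z : ℂ))
    ((Polynomial.nthRoots e (1 : ℂ)).toFinset.finite_toSet.subset ?_)
    (Circle.coe_injective.injOn)
  rintro _ ⟨z, hz, rfl⟩
  have : (z : ℂ) ^ e = 1 := by rw [← Circle.coe_pow, hz, Circle.coe_one]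
  simpa [Polynomial.mem_nthRoots he] using this

/-- The kernel of a primitive character whose power is the determinant is `G_0`. -/
theorem ker_character_eq_G0 (hk : ∀ i, 1 ≤ k i) {P : Fin d → Fin d → ℤ}
    (hP : IsTorusRetraction ν P) {e : ℕ} (he : 0 < e) {a : Fin d → ℤ} {b : Fin r → ℤ}
    (ha : ∀ j, ∑ l, P j l = e * a j) (hb : ∀ i, (n i : ℤ) = e * b i)
    {c : Fin d → ℤ} {c' : Fin r → ℤ} (hc : ∑ j, c j * a j + ∑ i, c' i * b i = 1) :
    (character ν k a b).ker = G0 ν n k := by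
  have hdet : ∀ g : G ν k, character ν k 1 (fun i => n i) g = character ν k a b g ^ e := fun g => by
    rw [character_one_eq hP, ← zpow_natCast]
    exact character_eq_zpow ha hb g
  apply le_antisymm
  · intro g hg
    rw [MonoidHom.mem_ker] at hg
    obtain ⟨x, U, l, rfl⟩ := exists_eq_oneParam g
    rw [character_oneParam, one_mul, Circle.exp_eq_one] at hg
    obtain ⟨N, hN⟩ := hg
    -- modify the logarithm of `g`
    let y : kerBeta ν := ⟨fun j => ((∑ i, c i * P i j : ℤ) : ℝ), fun l' => by
      have : ∑ j, (∑ i, c i * P i j) * ν j l' = 0 := by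
        simp only [Finset.sum_mul, mul_assoc]
        rw [Finset.sum_comm]
        simp [← Finset.mul_sum, hP.row_mem]
      beta_reduce
      exact_mod_cast this⟩
    let δ : ∀ i, Fin (k i) → ℤ := fun i => Pi.single ⟨0, hk i⟩ 1
    let x' : kerBeta ν := x - (N * (2 * Real.pi)) • y
    let l' : ∀ i, Fin (k i) → ℝ := fun i => l i - fun q => ((N * c' i * δ i q : ℤ) : ℝ) * (2 * Real.pi)
    have hg : oneParam x U l 1 = oneParam x' U l' 1 := by
      refine Prod.ext (Subtype.ext (funext fun j => ?_)) (funext fun i => ?_)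
      · change Circle.exp (((1 : ℝ) • x : kerBeta ν).1 j) = Circle.exp (((1 : ℝ) • x' : kerBeta ν).1 j)
        have h1 : x.1 j = x'.1 j + (N * (∑ i, c i * P i j) : ℤ) * (2 * Real.pi) := by
          simp only [x', y, Submodule.coe_sub, Submodule.coe_smul, Pi.sub_apply, Pi.smul_apply,
            smul_eq_mul]
          push_cast
          ring
        rw [one_smul, one_smul, h1, Circle.exp_add, Circle.exp_int_mul_two_pi, mul_one]
      · change conjExp (U i) ((1 : ℝ) • l i) = conjExp (U i) ((1 : ℝ) • l' i)
        rw [one_smul, one_smul]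
        have h1 : l i = l' i + fun q => ((N * c' i * δ i q : ℤ) : ℝ) * (2 * Real.pi) := by
          simp [l']
        rw [h1, conjExp_add, conjExp_two_pi, mul_one]
    -- The shift is exactly 2πN by the Bézout relation once Pa = a is known. This holds because e·a
    -- is `P` applied to (1,…,1) and `P` is idempotent.
    have hzero : ∑ j, (a j : ℝ) * x'.1 j + ∑ i, (b i : ℝ) * ∑ q, l' i q = 0 := by
      have h2 : ∑ j, a j * ∑ i, c i * P i j = ∑ i, c i * a i := by
        have h3 : ∀ i, ∑ j, P i j * a j = a i := fun i => by
          have h4 : (e : ℤ) * ∑ j, P i j * a j = e * a i := by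
            rw [← ha i, Finset.mul_sum]
            have : ∀ j, (e : ℤ) * (P i j * a j) = ∑ l, P i j * P j l := fun j => by
              rw [← Finset.mul_sum, ha j]; ring
            rw [Finset.sum_congr rfl fun j _ => this j, Finset.sum_comm]
            exact Finset.sum_congr rfl fun l _ => isTorusRetraction_idem hP i l
          exact mul_left_cancel₀ (by exact_mod_cast he.ne') h4
        simp only [Finset.mul_sum]
        rw [Finset.sum_comm]
        refine Finset.sum_congr rfl fun i _ => ?_
        conv_rhs => rw [← h3 i, Finset.mul_sum]
        exact Finset.sum_congr rfl fun j _ => by ring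
      have h5 : ∀ i, ∑ q, l' i q = ∑ q, l i q - N * c' i * (2 * Real.pi) := fun i => by
        simp [l', δ, Pi.single_apply, Finset.sum_sub_distrib]
      have h6 : ∑ j, (a j : ℝ) * x'.1 j =
          ∑ j, (a j : ℝ) * x.1 j - N * (2 * Real.pi) * ((∑ i, c i * a i : ℤ) : ℝ) := by
        rw [← h2]
        push_cast
        rw [Finset.mul_sum, ← Finset.sum_sub_distrib]
        refine Finset.sum_congr rfl fun j _ => ?_
        simp only [x', y, Submodule.coe_sub, Submodule.coe_smul, Pi.sub_apply, Pi.smul_apply,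
          smul_eq_mul]
        push_cast
        ring
      have h7 : ∑ i, (b i : ℝ) * ∑ q, l' i q = ∑ i, (b i : ℝ) * ∑ q, l i q -
          N * (2 * Real.pi) * ((∑ i, c' i * b i : ℤ) : ℝ) := by
        simp only [h5]
        push_cast
        rw [Finset.mul_sum, ← Finset.sum_sub_distrib]
        exact Finset.sum_congr rfl fun i _ => by ring
      have h8 : ((∑ j, c j * a j : ℤ) : ℝ) + ((∑ i, c' i * b i : ℤ) : ℝ) = 1 := by exact_mod_cast hc
      rw [h6, h7]
      linear_combination hN - N * (2 * Real.pi) * h8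
    have hχ : ∀ s, character ν k a b (oneParam x' U l' s) = 1 := fun s => by
      rw [character_oneParam, hzero, mul_zero, Circle.exp_zero]
    let γ : ℝ → specialG ν n k := fun s => ⟨oneParam x' U l' s, by
      rw [mem_specialG, hdet, hχ, one_pow]⟩
    have hγ : Continuous γ := continuous_induced_rng.2 (continuous_oneParam x' U l')
    have h1 : γ 1 ∈ connectedComponent (1 : specialG ν n k) :=
      (isPreconnected_range hγ).subset_connectedComponent
        ⟨0, Subtype.ext (oneParam_zero x' U l')⟩ ⟨1, rfl⟩
    rw [hg]
    exact ⟨γ 1, h1, rfl⟩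
  -- On `G ∩ SU(D)` the e-th power of the character is det = 1. Its values there are roots of unity,
  -- a finite set, so it is constant on the identity component.
  · rintro _ ⟨g, hg, rfl⟩
    rw [MonoidHom.mem_ker]
    have hcont : Continuous fun g : specialG ν n k => character ν k a b g :=
      (continuous_character a b).comp continuous_subtype_val
    have h1 : IsPreconnected ((fun g : specialG ν n k => character ν k a b g) ''
        connectedComponent (1 : specialG ν n k)) :=
      isPreconnected_connectedComponent.image _ hcont.continuousOn
    have h2 : (fun g : specialG ν n k => character ν k a b g) ''
        connectedComponent (1 : specialG ν n k) ⊆ {z : Circle | z ^ e = 1} := by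
      rintro _ ⟨g, -, rfl⟩
      change character ν k a b g ^ e = 1
      rw [← hdet, (mem_specialG (n := n) _).1 g.2]
    have h3 := (finite_roots_circle he).countable.isTotallyDisconnected _ h2 h1
    have h4 := h3 ⟨g, hg, rfl⟩ ⟨1, mem_connectedComponent, rfl⟩
    simpa using h4

theorem circle_mul_eq_one {z w : Circle} (hz : z ^ 2 = 1) (hw : w ^ 2 = 1) (hz1 : z ≠ 1)
    (hw1 : w ≠ 1) : z * w = 1 := by
  have h : ∀ {z : Circle}, z ^ 2 = 1 → z ≠ 1 → (z : ℂ) = -1 := fun {z} hz hz1 => by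
    have h1 : (z : ℂ) ^ 2 = 1 := by rw [← Circle.coe_pow, hz, Circle.coe_one]
    exact (eq_or_eq_neg_of_sq_eq_sq _ _ (h1.trans (one_pow 2).symm)).resolve_left fun h => hz1 (Circle.ext h)
  apply Circle.ext
  rw [Circle.coe_mul, h hz hz1, h hw hw1, Circle.coe_one]
  norm_num

/-- The circle `G / G_0^τ`: a character of `G` with kernel `G_0^τ`, whose differential is
a positive multiple of the trace. -/
theorem exists_character_ker_eq (hν : IsMonotoneDelzant ν)
    (heven : ∃ u : Fin m → ℤ, ∑ j, ν j = 2 • u) (hk : ∀ i, 1 ≤ k i) (hn : ∀ i, 1 ≤ n i)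
    (hpos : 0 < d ∨ 0 < r) : ∃ (a : Fin d → ℤ) (b : Fin r → ℤ) (c : ℝ), 0 < c ∧
      (character ν k a b).ker = G0tau ν n k ∧
      (∀ X, characterDeriv ν k 1 (fun i => n i) X = c * characterDeriv ν k a b X) ∧
      ∃ X, characterDeriv ν k a b X = 1 := by
  obtain ⟨P, hP, -⟩ := exists_isTorusRetraction hν zero_mem_monotonePolytope
  -- A direction along which the determinant varies ensures that the exponents are not all zero, so
  -- that a primitive root of the determinant exists.
  have hX : ∃ X : lieG ν k, characterDeriv ν k 1 (fun i => n i) X ≠ 0 := by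
    rcases hpos with hd | hr
    · obtain ⟨x, hx, hx0⟩ := exists_kerBeta_sum_ne_zero hν hd
      refine ⟨⟨(x, 0), hx, by simp⟩, ?_⟩
      simpa [characterDeriv] using hx0
    · refine ⟨⟨(0, fun i => Complex.I • 1), (kerBeta ν).zero_mem, by simp⟩, ?_⟩
      have h1 : (0 : ℝ) < ∑ i : Fin r, (n i : ℝ) * (k i : ℝ) :=
        Finset.sum_pos (fun i _ => mul_pos (by exact_mod_cast hn i) (by exact_mod_cast hk i))
          ⟨⟨0, hr⟩, Finset.mem_univ _⟩
      simpa [characterDeriv] using h1.ne'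
  obtain ⟨X, hX⟩ := hX
  have hf : (Sum.elim (fun j => ∑ l, P j l) (fun i => (n i : ℤ)) : Fin d ⊕ Fin r → ℤ) ≠ 0 := by
    intro h0
    apply hX
    have h1 : ∀ j, ∑ l, P j l = 0 := fun j => congrFun h0 (Sum.inl j)
    have h2 : ∀ i, (n i : ℤ) = 0 := fun i => congrFun h0 (Sum.inr i)
    rw [characterDeriv_one_eq hP]
    simp [characterDeriv, h1, h2]
  obtain ⟨e, g, c, he, hg, hc⟩ := exists_bezout hf
  rw [Fintype.sum_sum_type] at hc
  set a : Fin d → ℤ := fun j => g (Sum.inl j) with ha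
  set b : Fin r → ℤ := fun i => g (Sum.inr i) with hb
  have hga : ∀ j, ∑ l, P j l = e * a j := fun j => hg (Sum.inl j)
  have hgb : ∀ i, (n i : ℤ) = e * b i := fun i => hg (Sum.inr i)
  have hker := ker_character_eq_G0 (n := n) hk hP he hga hgb hc
  have he' : (0 : ℝ) < e := by exact_mod_cast he
  have hderiv : ∀ X, characterDeriv ν k 1 (fun i => n i) X = e * characterDeriv ν k a b X := by
    intro X
    rw [characterDeriv_one_eq hP]
    simp only [characterDeriv, LinearMap.coe_mk, AddHom.coe_mk, hga, hgb]
    push_cast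
    rw [mul_add, Finset.mul_sum, Finset.mul_sum]
    congr 1 <;> exact Finset.sum_congr rfl fun _ _ => by ring
  obtain ⟨τ, hτ⟩ := exists_embed_eq_neg_one (n := n) (k := k) hν heven
  have hττ : τ * τ = 1 := embed_injective hn (by rw [map_mul, hτ, map_one]; simp)
  have huniq : ∀ g, embed ν n k g = -1 → g = τ := fun g hg => embed_injective hn (hg.trans hτ.symm)
  have hnorm : ∀ {a' : Fin d → ℤ} {b' : Fin r → ℤ} {c' : ℝ}, 0 < c' →
      (∀ X, characterDeriv ν k 1 (fun i => n i) X = c' * characterDeriv ν k a' b' X) →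
      ∃ X, characterDeriv ν k a' b' X = 1 := by
    intro a' b' c' hc' h
    have h1 : characterDeriv ν k a' b' X ≠ 0 := fun h0 => hX (by rw [h, h0, mul_zero])
    exact ⟨(characterDeriv ν k a' b' X)⁻¹ • X, by rw [map_smul, smul_eq_mul, inv_mul_cancel₀ h1]⟩
  -- If the primitive character χ is 1 on τ = −I, its kernel G_0 already contains τ and θ = χ.
  -- Otherwise χ(τ) = −1 and θ = χ²: an element with χ = −1 becomes an element of G_0 after
  -- multiplication by τ.
  by_cases hχτ : character ν k a b τ = 1
  · refine ⟨a, b, e, he', ?_, hderiv, hnorm he' hderiv⟩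
    apply le_antisymm
    · rw [hker]
      exact fun g hg => Subgroup.subset_closure (Or.inl hg)
    · rw [G0tau, Subgroup.closure_le]
      rintro g (hg | hg)
      · rwa [hker]
      · rw [huniq g hg]
        exact hχτ
  · have hsq : ∀ g, character ν k (fun j => 2 * a j) (fun i => 2 * b i) g = character ν k a b g ^ 2 :=
      fun g => by
        rw [← zpow_natCast]
        exact character_eq_zpow (e := 2) (fun _ => rfl) (fun _ => rfl) g
    have hderiv2 : ∀ X, characterDeriv ν k 1 (fun i => n i) X = (e / 2) *
        characterDeriv ν k (fun j => 2 * a j) (fun i => 2 * b i) X := by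
      intro X
      rw [hderiv]
      simp only [characterDeriv, LinearMap.coe_mk, AddHom.coe_mk]
      push_cast
      simp only [mul_assoc, ← Finset.mul_sum]
      ring
    refine ⟨fun j => 2 * a j, fun i => 2 * b i, e / 2, by positivity, ?_, hderiv2,
      hnorm (by positivity) hderiv2⟩
    have hτ2 : character ν k a b τ ^ 2 = 1 := by rw [sq, ← map_mul, hττ, map_one]
    apply le_antisymm
    · intro g hg
      rw [MonoidHom.mem_ker, hsq] at hg
      have hτmem : τ ∈ G0tau ν n k := Subgroup.subset_closure (Or.inr hτ)
      have hG0 : ∀ g, character ν k a b g = 1 → g ∈ G0tau ν n k := fun g h =>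
        Subgroup.subset_closure (Or.inl (by rw [← hker]; exact h))
      by_cases h1 : character ν k a b g = 1
      · exact hG0 g h1
      · have h2 : τ * g ∈ G0tau ν n k := hG0 _ (by rw [map_mul, circle_mul_eq_one hτ2 hg hχτ h1])
        exact (Subgroup.mul_mem_cancel_left _ hτmem).1 h2
    · rw [G0tau, Subgroup.closure_le]
      rintro g (hg | hg)
      · have h1 : character ν k a b g = 1 := by
          rw [← MonoidHom.mem_ker, hker]
          exact hg
        change character ν k _ _ g = 1
        rw [hsq, h1, one_pow]
      · rw [huniq g hg]
        change character ν k _ _ τ = 1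
        rw [hsq, hτ2]

end Theta

end ToricGrassmann

namespace ToricGrassmann

/-! ### The level set -/

section LevelSet

variable {m d r : ℕ} {ν : Fin d → Fin m → ℤ} {n k : Fin r → ℕ}

/-- The matrix of inner products of the columns of the `i`-th matrix block of `z`. -/
noncomputable def gram (z : Idx d n k → ℂ) (i : Fin r) : Matrix (Fin (k i)) (Fin (k i)) ℂ :=
  Matrix.of fun b b' => ∑ a, z (Sum.inr ⟨i, a, b⟩) * star (z (Sum.inr ⟨i, a, b'⟩))

theorem gram_conjTranspose (z : Idx d n k → ℂ) (i : Fin r) : (gram z i)ᴴ = gram z i := by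
  ext b b'
  simp [gram, Matrix.conjTranspose_apply, mul_comm]

theorem momentMap_apply (z : Idx d n k → ℂ) (X : lieG ν k) : momentMap ν n k z X =
    1 / 2 * (∑ j, X.1.1 j * Complex.normSq (z (Sum.inl j)) +
      ∑ i, ((X.1.2 i * gram z i).trace).im) := by
  change 1 / 2 * (star z ⬝ᵥ act n k (lieCoords ν k X) z).im = _
  rw [dotProduct, Fintype.sum_sum_type, Complex.add_im, Complex.im_sum]
  congr 2
  · refine Finset.sum_congr rfl fun j _ => ?_
    rw [act_inl]
    simp [lieCoords, Complex.normSq_apply]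
    ring
  · rw [Fintype.sum_sigma, Complex.im_sum]
    refine Finset.sum_congr rfl fun i _ => ?_
    congr 1
    rw [Fintype.sum_prod_type, Finset.sum_comm]
    refine Finset.sum_congr rfl fun b _ => ?_
    simp only [act_inr, Pi.star_apply, Finset.mul_sum, Matrix.diag_apply, Matrix.mul_apply, gram,
      Matrix.of_apply]
    rw [Finset.sum_comm]
    refine Finset.sum_congr rfl fun b' _ => Finset.sum_congr rfl fun a _ => ?_
    simp only [lieCoords, LinearMap.coe_mk, AddHom.coe_mk]
    ring

theorem momentValue_apply (X : lieG ν k) : momentValue ν n k X =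
    1 / 2 * (∑ j, X.1.1 j + ∑ i, (n i : ℝ) * ((X.1.2 i).trace).im) := by
  refine (trace_lieEmbed X).trans ?_
  simp [characterDeriv]

/-- The pairing with X splits over the torus and unitary components, so each can be tested
separately. -/
theorem mem_level_iff (z : Idx d n k → ℂ) : z ∈ Level ν n k ↔
    (∀ x ∈ kerBeta ν, ∑ j, x j * (Complex.normSq (z (Sum.inl j)) - 1) = 0) ∧
      ∀ i, gram z i = (n i : ℂ) • 1 := by
  have h0 : z ∈ Level ν n k ↔ ∀ X : lieG ν k, momentMap ν n k z X = momentValue ν n k X :=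
    ⟨fun h X => LinearMap.congr_fun h X, fun h => LinearMap.ext h⟩
  rw [h0]
  simp only [momentMap_apply, momentValue_apply]
  refine ⟨fun h => ⟨fun x hx => ?_, fun i => ?_⟩, fun h X => ?_⟩
  · have h1 := h ⟨(x, 0), hx, by simp⟩
    simp only [Pi.zero_apply, Matrix.zero_mul, Matrix.trace_zero, Complex.zero_im,
      Finset.sum_const_zero, add_zero, mul_zero] at h1
    simp only [mul_sub, mul_one, Finset.sum_sub_distrib]
    linarith
  -- Testing on X = iS, with S the Hermitian defect gram − n·1, gives tr(S²) = 0, hence S = 0.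
  · set S : Matrix (Fin (k i)) (Fin (k i)) ℂ := gram z i - (n i : ℂ) • 1 with hS
    have hSS : Sᴴ = S := by
      rw [hS, Matrix.conjTranspose_sub, gram_conjTranspose, Matrix.conjTranspose_smul]
      simp
    have hmem : (0, Pi.single i (Complex.I • S)) ∈ lieG ν k := by
      refine ⟨(kerBeta ν).zero_mem, fun i' => ?_⟩
      rcases eq_or_ne i' i with rfl | hi
      · simp [Matrix.conjTranspose_smul, hSS]
      · simp [Pi.single_eq_of_ne hi]
    have h1 := h ⟨_, hmem⟩
    simp only [Pi.zero_apply, zero_mul, Finset.sum_const_zero, zero_add] at h1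
    rw [Finset.sum_eq_single i, Finset.sum_eq_single i] at h1
    · simp only [Pi.single_eq_same] at h1
      have h2 : (S * S).trace.re = 0 := by
        have h3 : (Complex.I • S * gram z i).trace - (n i : ℂ) * (Complex.I • S).trace =
            Complex.I * (S * S).trace := by
          conv_rhs => rw [hS, mul_sub, ← hS]
          simp [Matrix.trace_sub, Matrix.trace_smul]
          ring
        have h4 := congrArg Complex.im h3
        simp only [Complex.sub_im, Complex.mul_im, Complex.natCast_im, Complex.natCast_re, zero_mul,
          add_zero, Complex.I_re, Complex.I_im, one_mul, zero_add] at h4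
        linarith
      have h2' : (S * S).trace.im = 0 := by
        have h3 : star (S * S).trace = (S * S).trace := by
          rw [← Matrix.trace_conjTranspose, Matrix.conjTranspose_mul, hSS]
        exact Complex.conj_eq_iff_im.1 h3
      have h5 : (Sᴴ * S).trace = 0 := by
        rw [hSS]
        exact Complex.ext h2 h2'
      open ComplexOrder in
      exact sub_eq_zero.1 (Matrix.trace_conjTranspose_mul_self_eq_zero_iff.1 h5)
    · intro i' _ hi; simp [Pi.single_eq_of_ne hi]
    · simp
    · intro i' _ hi; simp [Pi.single_eq_of_ne hi]
    · simp
  · have h1 := h.1 _ X.2.1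
    simp only [mul_sub, mul_one, Finset.sum_sub_distrib] at h1
    congr 2
    · linarith
    · refine Finset.sum_congr rfl fun i _ => ?_
      rw [h.2 i]
      simp [Matrix.trace_smul]

/-- A point of the level set lies over a point of the polytope whose j-th defining function is
|z_j|²/2. Vanishing coordinates correspond to facets through that point, so a suitable vertex gives
a `P` which never uses their phases. -/
theorem exists_isTorusRetraction_of_mem_level (hν : IsMonotoneDelzant ν) {z : Idx d n k → ℂ}
    (hz : z ∈ Level ν n k) : ∃ P : Fin d → Fin d → ℤ, IsTorusRetraction ν P ∧
      ∀ j, z (Sum.inl j) = 0 → ∀ l, P j l = 0 := by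
  obtain ⟨y, hy⟩ := exists_of_kerBeta_le ((mem_level_iff z).1 hz).1
  have h1 : ∀ j, ∑ l, (y l / 2) * (ν j l : ℝ) + 1 / 2 = Complex.normSq (z (Sum.inl j)) / 2 := by
    intro j
    have h2 : ∑ l, (y l / 2) * (ν j l : ℝ) = (∑ l, y l * (ν j l : ℝ)) / 2 := by
      rw [Finset.sum_div]
      exact Finset.sum_congr rfl fun l _ => by ring
    rw [h2, ← hy j]
    ring
  have h2 : (fun l => y l / 2) ∈ monotonePolytope ν := fun j => by
    rw [h1]
    exact div_nonneg (Complex.normSq_nonneg _) zero_le_two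
  obtain ⟨P, hP, hP0⟩ := exists_isTorusRetraction hν h2
  exact ⟨P, hP, fun j hj => hP0 j ⟨h2, by rw [h1, hj]; simp⟩⟩

end LevelSet

end ToricGrassmann

/-! ### Square roots near the identity -/

section SquareRoot

open Filter Topology

variable {A : Type*} [NormedRing A] [NormedAlgebra ℝ A] [CompleteSpace A] [StarRing A]

/-- Inverse function theorem for x ↦ x² at 1, where the derivative is multiplication by 2. If `x` is
selfadjoint, its root and the star of its root are two square roots in the domain of injectivity,
hence equal. -/
theorem exists_smooth_sqrt (hstar : Continuous (star : A → A)) :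
    ∃ (T : Set A) (R : A → A), IsOpen T ∧ (1 : A) ∈ T ∧ ContDiffOn ℝ ∞ R T ∧ R 1 = 1 ∧
      ∀ x ∈ T, R x * R x = x ∧ IsUnit (R x) ∧ (star x = x → star (R x) = R x) := by
  let sq : A → A := fun x => x * x
  -- The analytic class is used because being analytic at a point is an open condition, whereas C^∞
  -- at a single point does not yield C^∞ on a neighbourhood.
  have hsq : ContDiff ℝ ω sq := contDiff_id.mul contDiff_id
  let e : A ≃L[ℝ] A := ContinuousLinearEquiv.smulLeft (Units.mk0 (2 : ℝ) two_ne_zero)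
  have hd : HasFDerivAt sq (e : A →L[ℝ] A) 1 := by
    have h1 := (hasFDerivAt_id (𝕜 := ℝ) (1 : A)).mul' (hasFDerivAt_id (𝕜 := ℝ) (1 : A))
    refine h1.congr_fderiv ?_
    ext x
    simp [e, two_smul, Units.smul_def]
  let φ := (hsq.contDiffAt (x := 1)).toOpenPartialHomeomorph sq hd (by simp)
  have hφ : ∀ x, φ x = x * x := fun x => rfl
  have h1s : (1 : A) ∈ φ.source :=
    (hsq.contDiffAt (x := 1)).mem_toOpenPartialHomeomorph_source hd (by simp)
  have hφ1 : φ 1 = 1 := by rw [hφ, mul_one]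
  have hR1 : φ.symm 1 = 1 := by
    conv_lhs => rw [← hφ1]
    exact φ.left_inv h1s
  have h1t : (1 : A) ∈ φ.target := hφ1 ▸ φ.map_source h1s
  have hsm : ContDiffAt ℝ ω φ.symm 1 := by
    refine φ.contDiffAt_symm (f₀' := e) h1t ?_ ?_
    · rw [hR1]; exact hd
    · exact hsq.contDiffAt
  have hcont : ContinuousAt φ.symm 1 := hsm.continuousAt
  have hev : ∀ᶠ x in 𝓝 (1 : A), x ∈ φ.target ∧ ContDiffAt ℝ ω φ.symm x ∧
      star (φ.symm x) ∈ φ.source ∧ IsUnit (φ.symm x) := by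
    refine ((φ.open_target.eventually_mem h1t).and ((hsm.eventually (by simp)).and (Eventually.and ?_ ?_)))
    · refine (hstar.continuousAt.comp hcont).eventually_mem (φ.open_source.mem_nhds ?_)
      simpa [hR1] using h1s
    · refine hcont.eventually_mem (Units.isOpen.mem_nhds ?_)
      rw [hR1]
      exact isUnit_one
  obtain ⟨T, hT, hTo, h1T⟩ := eventually_nhds_iff.1 hev
  refine ⟨T, φ.symm, hTo, h1T, fun x hx => ((hT x hx).2.1.of_le le_top).contDiffWithinAt, hR1,
    fun x hx => ?_⟩
  obtain ⟨ht, -, hs, hu⟩ := hT x hx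
  have h1 : φ.symm x * φ.symm x = x := φ.right_inv ht
  refine ⟨h1, hu, fun hx' => φ.injOn hs (φ.map_target ht) ?_⟩
  rw [hφ, hφ, ← star_mul, h1, hx']

end SquareRoot

/-- If the unitary element `x` is selfadjoint and close to `1`, then `x = 1`. -/
theorem eq_one_of_mul_self_eq_one {A : Type*} [Ring A] {x : A} (hx : x * x = 1)
    (hu : IsUnit (x + 1)) : x = 1 := by
  have h1 : (x + 1) * (x - 1) = (x + 1) * 0 := by
    rw [mul_zero, mul_sub, add_mul, hx]
    simp [add_comm]
  exact sub_eq_zero.1 (hu.mul_left_cancel h1)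


namespace ToricGrassmann

/-! ### Local smooth equivariant maps to the group -/

section Equivariant

attribute [local instance] Matrix.linftyOpNormedRing Matrix.linftyOpNormedAlgebra

variable {m d r : ℕ} {ν : Fin d → Fin m → ℤ} {n k : Fin r → ℕ}

theorem coe_circle_exp_arg {w : ℂ} (hw : w ≠ 0) : (Circle.exp (Complex.arg w) : ℂ) = w / ‖w‖ := by
  have h1 : (‖w‖ : ℂ) ≠ 0 := by simpa using hw
  rw [Circle.coe_exp, eq_div_iff h1, mul_comm]
  exact Complex.norm_mul_exp_arg_mul_I w

theorem circle_exp_arg_mul (t : Circle) {w : ℂ} (hw : w ≠ 0) :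
    Circle.exp (Complex.arg (t * w)) = t * Circle.exp (Complex.arg w) := by
  apply Circle.ext
  rw [Circle.coe_mul, coe_circle_exp_arg hw, coe_circle_exp_arg (mul_ne_zero t.coe_ne_zero hw),
    norm_mul, Circle.norm_coe, one_mul, mul_div_assoc]

/-- An equivariant map to the torus. -/
noncomputable def torusMap {P : Fin d → Fin d → ℤ} (hP : IsTorusRetraction ν P)
    (z₀ z : Idx d n k → ℂ) : torusK ν :=
  ⟨fun l => Circle.exp (∑ j, (P j l : ℝ) * Complex.arg (z (Sum.inl j) * star (z₀ (Sum.inl j)))), _,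
    fun l' => by
      simp only [Finset.sum_mul]
      rw [Finset.sum_comm]
      refine Finset.sum_eq_zero fun j _ => ?_
      have h1 : ∑ l, (P j l : ℝ) * ν l l' = 0 := by exact_mod_cast hP.row_mem j l'
      calc ∑ l, (P j l : ℝ) * Complex.arg (z (Sum.inl j) * star (z₀ (Sum.inl j))) * ν l l'
          = Complex.arg (z (Sum.inl j) * star (z₀ (Sum.inl j))) * ∑ l, (P j l : ℝ) * ν l l' := by
            rw [Finset.mul_sum]
            exact Finset.sum_congr rfl fun _ _ => by ring
        _ = 0 := by rw [h1, mul_zero], rfl⟩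

theorem torusMap_apply {P : Fin d → Fin d → ℤ} (hP : IsTorusRetraction ν P)
    (z₀ z : Idx d n k → ℂ) (l : Fin d) : (torusMap hP z₀ z : Fin d → Circle) l =
      ∏ j, Circle.exp (Complex.arg (z (Sum.inl j) * star (z₀ (Sum.inl j)))) ^ P j l := by
  simp only [torusMap, circle_exp_zpow, prod_circle_exp]

theorem torusMap_self {P : Fin d → Fin d → ℤ} (hP : IsTorusRetraction ν P)
    (z₀ : Idx d n k → ℂ) : torusMap hP z₀ z₀ = 1 := by
  refine Subtype.ext (funext fun l => ?_)
  rw [torusMap_apply]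
  refine Finset.prod_eq_one fun j _ => ?_
  have h1 : z₀ (Sum.inl j) * star (z₀ (Sum.inl j)) = (Complex.normSq (z₀ (Sum.inl j)) : ℂ) :=
    Complex.mul_conj _
  rw [h1, Complex.arg_ofReal_of_nonneg (Complex.normSq_nonneg _)]
  simp

/-- Each coordinate not vanishing at `z₀` turns its phase by g_j, the others have exponent 0, and ∏
g_j^{P_{jl}} = g_l on K. -/
theorem torusMap_act {P : Fin d → Fin d → ℤ} (hP : IsTorusRetraction ν P)
    {z₀ z : Idx d n k → ℂ} (h0 : ∀ j, z₀ (Sum.inl j) = 0 → ∀ l, P j l = 0)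
    (hz : ∀ j, z₀ (Sum.inl j) ≠ 0 → z (Sum.inl j) ≠ 0) (g : G ν k) :
    torusMap hP z₀ (act n k (coords ν k g) z) = g.1 * torusMap hP z₀ z := by
  refine Subtype.ext (funext fun l => ?_)
  rw [Subgroup.coe_mul, Pi.mul_apply, torusMap_apply, torusMap_apply, coords_fst_eq_prod hP g l,
    ← Finset.prod_mul_distrib]
  refine Finset.prod_congr rfl fun j _ => ?_
  by_cases hj : z₀ (Sum.inl j) = 0
  · simp [h0 j hj]
  · rw [act_inl, mul_assoc, ← mul_zpow]
    congr 1
    exact circle_exp_arg_mul _ (mul_ne_zero (hz j hj) (star_ne_zero.2 hj))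

/-- The argument jumps, but e^{i arg w} = w/|w| is smooth for w ≠ 0; coordinates vanishing at `z₀`
enter with exponent 0. -/
theorem contDiffOn_torusMap {P : Fin d → Fin d → ℤ} (hP : IsTorusRetraction ν P)
    {z₀ : Idx d n k → ℂ} (h0 : ∀ j, z₀ (Sum.inl j) = 0 → ∀ l, P j l = 0) (l : Fin d) :
    ContDiffOn ℝ ∞ (fun z => ((torusMap hP z₀ z : Fin d → Circle) l : ℂ))
      {z : Idx d n k → ℂ | ∀ j, z₀ (Sum.inl j) ≠ 0 → z (Sum.inl j) ≠ 0} := by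
  intro z hz
  refine ContDiffAt.contDiffWithinAt ?_
  simp only [torusMap_apply, coe_prod_circle, Circle.coe_zpow]
  refine contDiffAt_prod fun j _ => ?_
  by_cases hj : z₀ (Sum.inl j) = 0
  · simpa [h0 j hj] using contDiffAt_const
  · have hc : ContDiffAt ℝ ∞ (fun z : Idx d n k → ℂ => z (Sum.inl j) * star (z₀ (Sum.inl j))) z :=
      ((contDiff_apply ℝ ℂ (Sum.inl j)).mul contDiff_const).contDiffAt
    have hne : z (Sum.inl j) * star (z₀ (Sum.inl j)) ≠ 0 :=
      mul_ne_zero (hz j hj) (star_ne_zero.2 hj)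
    refine ContDiffAt.zpow_of_ne_zero (f := fun z : Idx d n k → ℂ =>
      (Circle.exp (Complex.arg (z (Sum.inl j) * star (z₀ (Sum.inl j)))) : ℂ)) ?_
      (Circle.coe_ne_zero _) _
    have h1 : ContDiffAt ℝ ∞ (fun z : Idx d n k → ℂ =>
        (‖z (Sum.inl j) * star (z₀ (Sum.inl j))‖ : ℂ)) z :=
      Complex.ofRealCLM.contDiff.contDiffAt.comp z (hc.norm ℝ hne)
    refine (hc.mul (h1.inv (Complex.ofReal_ne_zero.2 (norm_ne_zero_iff.2 hne)))).congr_of_eventuallyEq ?_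
    filter_upwards [hc.continuousAt.eventually_ne hne] with z' hz'
    rw [coe_circle_exp_arg hz', div_eq_mul_inv]
    rfl

/-- The normalized matrix of inner products of the columns of `z` and `z₀`. -/
noncomputable def crossGram (z₀ : Idx d n k → ℂ) (i : Fin r) :
    (Idx d n k → ℂ) →L[ℝ] Matrix (Fin (k i)) (Fin (k i)) ℂ :=
  LinearMap.toContinuousLinearMap
    { toFun := fun z => (n i : ℂ)⁻¹ • Matrix.of fun b b' =>
        ∑ a, z (Sum.inr ⟨i, a, b⟩) * star (z₀ (Sum.inr ⟨i, a, b'⟩))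
      map_add' := fun z z' => by
        rw [← smul_add]
        congr 1
        ext b b'
        simp [add_mul, Finset.sum_add_distrib]
      map_smul' := fun c z => by
        rw [RingHom.id_apply, smul_comm]
        congr 1
        ext b b'
        simp [Finset.mul_sum, mul_assoc] }

theorem crossGram_apply (z₀ z : Idx d n k → ℂ) (i : Fin r) : crossGram z₀ i z =
    (n i : ℂ)⁻¹ • Matrix.of fun b b' =>
        ∑ a, z (Sum.inr ⟨i, a, b⟩) * star (z₀ (Sum.inr ⟨i, a, b'⟩)) := rfl

theorem crossGram_self (hn : ∀ i, 1 ≤ n i) {z₀ : Idx d n k → ℂ} (hz₀ : z₀ ∈ Level ν n k)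
    (i : Fin r) : crossGram z₀ i z₀ = 1 := by
  have h1 : (n i : ℂ) ≠ 0 := by have := hn i; exact_mod_cast (by omega : n i ≠ 0)
  have h2 : crossGram z₀ i z₀ = (n i : ℂ)⁻¹ • gram z₀ i := rfl
  rw [h2, ((mem_level_iff z₀).1 hz₀).2 i, smul_smul, inv_mul_cancel₀ h1, one_smul]

theorem crossGram_act (z₀ z : Idx d n k → ℂ) (i : Fin r) (c : Coords d k) :
    crossGram z₀ i (act n k c z) = c.2 i * crossGram z₀ i z := by
  rw [crossGram_apply, crossGram_apply, Matrix.mul_smul]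
  congr 1
  ext b b'
  simp only [Matrix.of_apply, Matrix.mul_apply, act_inr, Finset.sum_mul, Finset.mul_sum]
  rw [Finset.sum_comm]
  exact Finset.sum_congr rfl fun _ _ => Finset.sum_congr rfl fun _ _ => by ring

/-- The conjugate transpose as a continuous linear map. -/
noncomputable def conjTransposeCLM (p : ℕ) :
    Matrix (Fin p) (Fin p) ℂ →L[ℝ] Matrix (Fin p) (Fin p) ℂ :=
  LinearMap.toContinuousLinearMap
    { toFun := fun A => Aᴴ
      map_add' := fun _ _ => Matrix.conjTranspose_add _ _
      map_smul' := fun c A => by simp [Matrix.conjTranspose_smul] }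

theorem conjTransposeCLM_apply {p : ℕ} (A : Matrix (Fin p) (Fin p) ℂ) :
    conjTransposeCLM p A = Aᴴ := rfl

/-- An equivariant map to the unitary group: the unitary part of the polar decomposition. -/
theorem exists_unitaryMap (hn : ∀ i, 1 ≤ n i) {z₀ : Idx d n k → ℂ} (hz₀ : z₀ ∈ Level ν n k)
    (i : Fin r) : ∃ (O : Set (Idx d n k → ℂ)) (B : (Idx d n k → ℂ) → Matrix.unitaryGroup (Fin (k i)) ℂ),
      IsOpen O ∧ z₀ ∈ O ∧
      ContDiffOn ℝ ∞ (fun z => (B z : Matrix (Fin (k i)) (Fin (k i)) ℂ)) O ∧ B z₀ = 1 ∧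
      ∀ (g : G ν k), ∀ z ∈ O, act n k (coords ν k g) z ∈ O ∧
        B (act n k (coords ν k g) z) = g.2 i * B z := by
  classical
  obtain ⟨T, R, hT, h1T, hR, hR1, hTR⟩ :=
    exists_smooth_sqrt (A := Matrix (Fin (k i)) (Fin (k i)) ℂ) (conjTransposeCLM (k i)).continuous
  -- With C the normalized matrix of inner products with `z₀`, N = C^*C is invariant under `G` and
  -- equals 1 at `z₀`. The set where `N` has a smooth square root is therefore a `G`-invariant
  -- neighbourhood.
  let N : (Idx d n k → ℂ) → Matrix (Fin (k i)) (Fin (k i)) ℂ :=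
    fun z => conjTransposeCLM (k i) (crossGram z₀ i z) * crossGram z₀ i z
  have hN : ContDiff ℝ ∞ N :=
    ((conjTransposeCLM (k i)).contDiff.comp (crossGram z₀ i).contDiff).mul (crossGram z₀ i).contDiff
  have hNstar : ∀ z, star (N z) = N z := fun z => by
    simp [N, conjTransposeCLM_apply, Matrix.star_eq_conjTranspose, Matrix.conjTranspose_mul]
  have hNact : ∀ (g : G ν k) z, N (act n k (coords ν k g) z) = N z := fun g z => by
    simp only [N, crossGram_act, conjTransposeCLM_apply, Matrix.conjTranspose_mul]
    have h1 : (coords ν k g).2 i = (g.2 i : Matrix (Fin (k i)) (Fin (k i)) ℂ) := rfl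
    rw [h1, Matrix.mul_assoc, ← Matrix.mul_assoc _ _ (crossGram z₀ i z), conjTranspose_mul_coe,
      Matrix.one_mul]
  -- The polar factor C N^{-1/2}: it is unitary, and equivariant because the action multiplies C by
  -- g on the left and fixes N.
  let B₀ : (Idx d n k → ℂ) → Matrix (Fin (k i)) (Fin (k i)) ℂ :=
    fun z => crossGram z₀ i z * Ring.inverse (R (N z))
  have hmem : ∀ z, N z ∈ T → B₀ z ∈ Matrix.unitaryGroup (Fin (k i)) ℂ := by
    intro z hz
    obtain ⟨h1, h2, h3⟩ := hTR _ hz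
    rw [Matrix.mem_unitaryGroup_iff']
    obtain ⟨u, hu⟩ := h2
    have h4 : star (Ring.inverse (R (N z))) = Ring.inverse (R (N z)) := by
      have h5 : star (Ring.inverse (R (N z))) * R (N z) = 1 := by
        rw [← h3 (hNstar z), ← star_mul, h3 (hNstar z), ← hu, Ring.inverse_unit, Units.mul_inv,
          star_one]
      calc star (Ring.inverse (R (N z)))
          = star (Ring.inverse (R (N z))) * (R (N z) * Ring.inverse (R (N z))) := by
            rw [← hu, Ring.inverse_unit, Units.mul_inv, mul_one]
        _ = Ring.inverse (R (N z)) := by rw [← mul_assoc, h5, one_mul]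
    have h6 : star (crossGram z₀ i z) * crossGram z₀ i z = R (N z) * R (N z) := h1.symm
    calc star (B₀ z) * B₀ z
        = Ring.inverse (R (N z)) * (star (crossGram z₀ i z) * crossGram z₀ i z) *
            Ring.inverse (R (N z)) := by
          simp only [B₀, star_mul, h4, mul_assoc]
      _ = 1 := by
          rw [h6, ← hu, Ring.inverse_unit]
          simp [← mul_assoc]
  let B : (Idx d n k → ℂ) → Matrix.unitaryGroup (Fin (k i)) ℂ :=
    fun z => if h : N z ∈ T then ⟨B₀ z, hmem z h⟩ else 1
  have hB : ∀ z, N z ∈ T → (B z : Matrix (Fin (k i)) (Fin (k i)) ℂ) = B₀ z := fun z hz => by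
    simp only [B, dif_pos hz]
  have hN0 : N z₀ = 1 := by
    simp [N, crossGram_self hn hz₀, conjTransposeCLM_apply]
  refine ⟨N ⁻¹' T, B, hT.preimage hN.continuous, ?_, ?_, ?_, fun g z hz => ⟨?_, ?_⟩⟩
  · simpa [hN0] using h1T
  · refine ContDiffOn.congr ?_ hB
    intro z hz
    refine ContDiffAt.contDiffWithinAt ?_
    refine (crossGram z₀ i).contDiff.contDiffAt.mul ?_
    obtain ⟨u, hu⟩ := (hTR _ hz).2.1
    have h1 : ContDiffAt ℝ ∞ Ring.inverse (R (N z)) := hu ▸ contDiffAt_ringInverse ℝ u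
    exact h1.comp z (ContDiffAt.comp z (hR.contDiffAt (hT.mem_nhds hz)) hN.contDiffAt)
  · apply Subtype.ext
    rw [hB z₀ (by rw [hN0]; exact h1T)]
    simp [B₀, hN0, hR1, crossGram_self hn hz₀]
  · simpa [hNact] using hz
  · apply Subtype.ext
    rw [hB _ (by rw [hNact]; exact hz), Submonoid.coe_mul, hB z hz]
    simp only [B₀, hNact, crossGram_act, Matrix.mul_assoc]
    rfl

/-- Near a point of the level set there is a smooth equivariant map to `G`. -/
theorem exists_equivariantMap (hν : IsMonotoneDelzant ν) (hn : ∀ i, 1 ≤ n i) {z₀ : Idx d n k → ℂ}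
    (hz₀ : z₀ ∈ Level ν n k) : ∃ (O : Set (Idx d n k → ℂ)) (Γ : (Idx d n k → ℂ) → G ν k),
      IsOpen O ∧ z₀ ∈ O ∧ ContDiffOn ℝ ∞ (fun z => coords ν k (Γ z)) O ∧ Γ z₀ = 1 ∧
      ∀ (g : G ν k), ∀ z ∈ O, act n k (coords ν k g) z ∈ O ∧
        Γ (act n k (coords ν k g) z) = g * Γ z := by
  obtain ⟨P, hP, hP0⟩ := exists_isTorusRetraction_of_mem_level hν hz₀
  choose O B hO hzO hB hB1 hBact using exists_unitaryMap (ν := ν) hn hz₀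
  let O₀ : Set (Idx d n k → ℂ) := {z | ∀ j, z₀ (Sum.inl j) ≠ 0 → z (Sum.inl j) ≠ 0}
  have hO₀ : IsOpen O₀ := by
    have h1 : O₀ = ⋂ j, {z : Idx d n k → ℂ | z₀ (Sum.inl j) ≠ 0 → z (Sum.inl j) ≠ 0} := by
      ext z
      simp [O₀]
    rw [h1]
    refine isOpen_iInter_of_finite fun j => ?_
    by_cases hj : z₀ (Sum.inl j) = 0
    · simp [hj]
    · simpa [hj] using isOpen_ne.preimage (continuous_apply (Sum.inl j))
  refine ⟨O₀ ∩ ⋂ i, O i, fun z => (torusMap hP z₀ z, fun i => B i z),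
    hO₀.inter (isOpen_iInter_of_finite hO), ⟨fun j hj => hj, Set.mem_iInter.2 hzO⟩, ?_, ?_,
    fun g z hz => ⟨⟨fun j hj => ?_, Set.mem_iInter.2 fun i => ?_⟩, ?_⟩⟩
  · refine ContDiffOn.prodMk (contDiffOn_pi.2 fun l => ?_) (contDiffOn_pi.2 fun i => ?_)
    · exact (contDiffOn_torusMap hP hP0 l).mono Set.inter_subset_left
    · exact (hB i).mono fun z hz => Set.mem_iInter.1 hz.2 i
  · exact Prod.ext (torusMap_self hP z₀) (funext fun i => hB1 i)
  · rw [act_inl]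
    exact mul_ne_zero (Circle.coe_ne_zero _) (hz.1 j hj)
  · exact (hBact i g z (Set.mem_iInter.1 hz.2 i)).1
  · refine Prod.ext (torusMap_act hP hP0 hz.1 g) (funext fun i => ?_)
    exact (hBact i g z (Set.mem_iInter.1 hz.2 i)).2

end Equivariant

end ToricGrassmann

namespace ToricGrassmann

section Infinitesimal

open Filter Topology

attribute [local instance] Matrix.linftyOpNormedRing Matrix.linftyOpNormedAlgebra

variable {m d r : ℕ} {ν : Fin d → Fin m → ℤ} {n k : Fin r → ℕ}

/-! ### A logarithm on the group near the identity -/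

/-- The skew-hermitian parts of the matrix components. -/
noncomputable def skewPart : Coords d k →L[ℝ] (∀ i, Matrix (Fin (k i)) (Fin (k i)) ℂ) :=
  LinearMap.toContinuousLinearMap
    { toFun := fun c i => (2⁻¹ : ℝ) • (c.2 i - (c.2 i)ᴴ)
      map_add' := fun c c' => by
        funext i
        simp only [Prod.snd_add, Pi.add_apply, Matrix.conjTranspose_add, ← smul_add]
        congr 1
        abel
      map_smul' := fun a c => by
        funext i
        simp only [Prod.smul_snd, Pi.smul_apply, Matrix.conjTranspose_smul, RingHom.id_apply,
          star_trivial, ← smul_sub]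
        rw [smul_comm] }

theorem skewPart_apply (c : Coords d k) (i : Fin r) :
    skewPart c i = (2⁻¹ : ℝ) • (c.2 i - (c.2 i)ᴴ) := rfl

/-- A substitute for the logarithm of `G`, defined near the identity. -/
noncomputable def logG {P : Fin d → Fin d → ℤ} (hP : IsTorusRetraction ν P) (c : Coords d k) :
    lieG ν k :=
  ⟨(fun l => ∑ j, (P j l : ℝ) * (Complex.log (c.1 j)).im, skewPart c), fun l' => by
    simp only [Finset.sum_mul]
    rw [Finset.sum_comm]
    refine Finset.sum_eq_zero fun j _ => ?_
    have h1 : ∑ l, (P j l : ℝ) * ν l l' = 0 := by exact_mod_cast hP.row_mem j l'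
    calc ∑ l, (P j l : ℝ) * (Complex.log (c.1 j)).im * ν l l'
        = (Complex.log (c.1 j)).im * ∑ l, (P j l : ℝ) * ν l l' := by
          rw [Finset.mul_sum]
          exact Finset.sum_congr rfl fun _ _ => by ring
      _ = 0 := by rw [h1, mul_zero], fun i => by
    change (skewPart c i)ᴴ = -skewPart c i
    rw [skewPart_apply, Matrix.conjTranspose_smul, Matrix.conjTranspose_sub,
      Matrix.conjTranspose_conjTranspose, star_trivial, ← smul_neg, neg_sub]⟩

/-- Only three properties of a logarithm are needed to turn Γ = 1 into a regular equation with
values in 𝔤: smoothness, no other zeros on `G` near 1, and derivative the identity on 𝔤. The skew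
part has these on the unitary factors, and the arguments recombined by `P` have them on K. -/
theorem exists_log {P : Fin d → Fin d → ℤ} (hP : IsTorusRetraction ν P) :
    ∃ T : Set (Coords d k), IsOpen T ∧ 1 ∈ T ∧ ContDiffOn ℝ ∞ (logG (k := k) hP) T ∧
      logG (k := k) hP 1 = 0 ∧ (∀ g : G ν k, coords ν k g ∈ T → logG hP (coords ν k g) = 0 → g = 1) ∧
      ∀ X : lieG ν k, fderiv ℝ (logG (k := k) hP) 1 (lieCoords ν k X) = X := by
  -- A linear retraction of the ambient space onto 𝔤; smoothness and derivatives of a map into the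
  -- submodule are computed in the ambient space.
  obtain ⟨p, hp⟩ := (lieG ν k).subtype.exists_leftInverse_of_injective (Submodule.ker_subtype _)
  have hp' : ∀ X : lieG ν k, p X.1 = X := fun X => LinearMap.congr_fun hp X
  let pc := LinearMap.toContinuousLinearMap p
  let L : Coords d k → (Fin d → ℝ) × (∀ i, Matrix (Fin (k i)) (Fin (k i)) ℂ) :=
    fun c => (fun l => ∑ j, (P j l : ℝ) * (Complex.log (c.1 j)).im, skewPart c)
  have hL : logG (k := k) hP = fun c => pc (L c) := funext fun c => (hp' (logG hP c)).symm
  -- The slit plane is where log is smooth. Invertibility of A + 1 excludes the eigenvalue −1: a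
  -- unitary A with zero skew part satisfies A² = 1, and then A = 1.
  let T : Set (Coords d k) := (⋂ j, {c | c.1 j ∈ Complex.slitPlane}) ∩ ⋂ i, {c | IsUnit (c.2 i + 1)}
  have hT : IsOpen T := by
    refine (isOpen_iInter_of_finite fun j => ?_).inter (isOpen_iInter_of_finite fun i => ?_)
    · exact Complex.isOpen_slitPlane.preimage (contDiff_coords_fst j).continuous
    · exact Units.isOpen.preimage ((contDiff_coords_snd i).continuous.add continuous_const)
  have h1T : (1 : Coords d k) ∈ T := by
    refine ⟨Set.mem_iInter.2 fun j => Complex.one_mem_slitPlane, Set.mem_iInter.2 fun i => ?_⟩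
    change IsUnit ((1 : Matrix (Fin (k i)) (Fin (k i)) ℂ) + 1)
    rw [one_add_one_eq_two, Matrix.isUnit_iff_isUnit_det]
    have h2 : (2 : Matrix (Fin (k i)) (Fin (k i)) ℂ) = (2 : ℂ) • 1 := by
      rw [two_smul, one_add_one_eq_two]
    rw [h2, Matrix.det_smul]
    simp
  have hLsmooth : ContDiffOn ℝ ∞ L T := by
    refine ContDiffOn.prodMk (contDiffOn_pi.2 fun l => ContDiffOn.sum fun j _ => ?_)
      skewPart.contDiff.contDiffOn
    refine contDiffOn_const.mul ?_
    intro c hc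
    have h1 : ContDiffAt ℝ ∞ Complex.log (c.1 j) :=
      (Complex.contDiffAt_log (Set.mem_iInter.1 hc.1 j)).restrict_scalars ℝ
    exact (Complex.imCLM.contDiff.contDiffAt.comp c
      (h1.comp c (contDiff_coords_fst j).contDiffAt)).contDiffWithinAt
  refine ⟨T, hT, h1T, ?_, ?_, fun g hg h0 => ?_, fun X => ?_⟩
  · rw [hL]
    exact pc.contDiff.comp_contDiffOn hLsmooth
  · apply Subtype.ext
    refine Prod.ext (funext fun l => ?_) (funext fun i => ?_)
    · simp [logG]
    · change skewPart 1 i = 0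
      rw [skewPart_apply]
      simp
  · have h1 : ∀ l, ∑ j, (P j l : ℝ) * (Complex.log ((g.1 : Fin d → Circle) j)).im = 0 :=
      fun l => congrFun (congrArg (fun X : lieG ν k => X.1.1) h0) l
    have h2 : ∀ i, skewPart (coords ν k g) i = 0 :=
      fun i => congrFun (congrArg (fun X : lieG ν k => X.1.2) h0) i
    refine Prod.ext (Subtype.ext (funext fun l => ?_)) (funext fun i => Subtype.ext ?_)
    · rw [coords_fst_eq_prod hP g l]
      have h3 : ∀ j, (g.1 : Fin d → Circle) j =
          Circle.exp (Complex.log ((g.1 : Fin d → Circle) j)).im := fun j => by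
        rw [Complex.log_im, Circle.exp_arg]
      rw [Finset.prod_congr rfl fun j _ => by rw [h3 j, circle_exp_zpow], prod_circle_exp, h1]
      simp
    · have h3 := h2 i
      rw [skewPart_apply, smul_eq_zero_iff_right (by norm_num), sub_eq_zero] at h3
      refine eq_one_of_mul_self_eq_one ?_ (Set.mem_iInter.1 hg.2 i)
      have h4 := coe_mul_conjTranspose (g.2 i)
      have h5 : (g.2 i).1 = (g.2 i).1ᴴ := h3
      rwa [← h5] at h4
  · have hlog : HasFDerivAt (𝕜 := ℝ) Complex.log (ContinuousLinearMap.id ℝ ℂ) 1 := by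
      have h1 := (Complex.hasDerivAt_log Complex.one_mem_slitPlane).hasFDerivAt.restrictScalars ℝ
      refine h1.congr_fderiv ?_
      ext v
      simp
    have hj : ∀ j, HasFDerivAt (fun c : Coords d k => (Complex.log (c.1 j)).im)
        (Complex.imCLM ∘L (ContinuousLinearMap.proj j ∘L ContinuousLinearMap.fst ℝ _ _)) 1 := fun j => by
      have h1 : HasFDerivAt (fun c : Coords d k => c.1 j)
          ((ContinuousLinearMap.proj (R := ℝ) j) ∘L ContinuousLinearMap.fst ℝ (Fin d → ℂ)
            (∀ i, Matrix (Fin (k i)) (Fin (k i)) ℂ)) 1 :=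
        ((ContinuousLinearMap.proj (R := ℝ) j) ∘L ContinuousLinearMap.fst ℝ (Fin d → ℂ)
            (∀ i, Matrix (Fin (k i)) (Fin (k i)) ℂ)).hasFDerivAt
      have h2 : HasFDerivAt (fun c : Coords d k => Complex.log (c.1 j)) _ 1 :=
        HasFDerivAt.comp (g := Complex.log) (1 : Coords d k) hlog h1
      exact Complex.imCLM.hasFDerivAt.comp (1 : Coords d k) h2
    have hd : HasFDerivAt L (ContinuousLinearMap.prod (ContinuousLinearMap.pi fun l => ∑ j, (P j l : ℝ) •
        (Complex.imCLM ∘L (ContinuousLinearMap.proj j ∘L ContinuousLinearMap.fst ℝ _ _))) skewPart) 1 := by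
      refine HasFDerivAt.prodMk (hasFDerivAt_pi.2 fun l => ?_) skewPart.hasFDerivAt
      exact HasFDerivAt.fun_sum fun j _ => (hj j).const_mul _
    have hd2 : HasFDerivAt (fun c => pc (L c)) _ 1 := pc.hasFDerivAt.comp (1 : Coords d k) hd
    rw [hL, hd2.fderiv]
    refine Eq.trans ?_ (hp' X)
    refine congrArg p (Prod.ext (funext fun l => ?_) (funext fun i => ?_))
    · refine Eq.trans ?_ (hP.fix _ X.2.1 l)
      simp [lieCoords, mul_comm]
    · refine (skewPart_apply _ i).trans ?_
      change (2⁻¹ : ℝ) • (X.1.2 i - (X.1.2 i)ᴴ) = X.1.2 i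
      rw [X.2.2 i, sub_neg_eq_add, ← two_smul ℝ, smul_smul]
      norm_num

/-! ### The derivatives of the moment map and of the action -/

/-- The standard symplectic form as a continuous bilinear map. -/
noncomputable def omega (ι : Type) [Fintype ι] : (ι → ℂ) →L[ℝ] (ι → ℂ) →L[ℝ] ℝ :=
  (LinearMap.mk₂ ℝ (fun u v : ι → ℂ => stdSymplectic u v)
    (fun u u' v => by simp [stdSymplectic, add_dotProduct])
    (fun a u v => by simp [stdSymplectic, star_smul, smul_dotProduct])
    (fun u v v' => by simp [stdSymplectic, dotProduct_add])
    (fun a u v => by simp [stdSymplectic, dotProduct_smul])).toContinuousBilinearMap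

theorem omega_apply {ι : Type} [Fintype ι] (u v : ι → ℂ) : omega ι u v = stdSymplectic u v := rfl

theorem omega_swap {ι : Type} [Fintype ι] (u v : ι → ℂ) : omega ι u v = -omega ι v u := by
  simp only [omega_apply, stdSymplectic]
  rw [← Complex.conj_im, ← RCLike.star_def, Matrix.star_dotProduct]

theorem eq_zero_of_omega {ι : Type} [Fintype ι] {u : ι → ℂ} (h : ∀ v, omega ι u v = 0) : u = 0 := by
  have h1 := h (Complex.I • u)
  have h2 : omega ι u (Complex.I • u) = ∑ i, Complex.normSq (u i) := by
    simp [omega_apply, stdSymplectic, dotProduct, Complex.normSq_apply]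
  rw [h2, Finset.sum_eq_zero_iff_of_nonneg fun i _ => Complex.normSq_nonneg _] at h1
  exact funext fun i => Complex.normSq_eq_zero.1 (h1 i (Finset.mem_univ i))

theorem omega_act_lieCoords (X : lieG ν k) (u v : Idx d n k → ℂ) :
    omega _ (act n k (lieCoords ν k X) u) v = -omega _ u (act n k (lieCoords ν k X) v) := by
  have h1 : (lieEmbed ν n k X)ᴴ = -lieEmbed ν n k X := by
    have h2 : (lieEmbed ν n k X)ᴴ = blockMatrix n k _ _ := blockMatrix_conjTranspose n k _ _
    have h3 : -lieEmbed ν n k X = lieEmbed ν n k (-X) := (map_neg _ _).symm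
    rw [h2, h3]
    change _ = blockMatrix n k _ _
    congr 1
    · funext j; simp
    · funext i; exact X.2.2 i
  simp only [omega_apply, act_lieCoords, stdSymplectic, Matrix.star_mulVec, h1,
    Matrix.dotProduct_mulVec, Matrix.vecMul_neg, neg_dotProduct, Complex.neg_im]

theorem momentMap_eq (z : Idx d n k → ℂ) (X : lieG ν k) :
    momentMap ν n k z X = 1 / 2 * omega _ z (act n k (lieCoords ν k X) z) := rfl

/-- The two terms of the derivative of ½ω(z, Xz) agree because X is infinitesimally symplectic,
which cancels the ½. -/
theorem hasFDerivAt_momentMap (X : lieG ν k) (z : Idx d n k → ℂ) :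
    HasFDerivAt (fun z => momentMap ν n k z X)
      ((omega (Idx d n k)).flip (act n k (lieCoords ν k X) z)) z := by
  have h1 := ((omega (Idx d n k)).hasFDerivAt_of_bilinear (hasFDerivAt_id z)
    (act n k (lieCoords ν k X)).hasFDerivAt).const_mul (1 / 2 : ℝ)
  refine h1.congr_fderiv ?_
  ext w
  have h2 : omega _ z (act n k (lieCoords ν k X) w) = omega _ w (act n k (lieCoords ν k X) z) := by
    rw [omega_swap z, omega_act_lieCoords, neg_neg]
  simp [h2]
  ring

theorem contDiff_momentMap (X : lieG ν k) : ContDiff ℝ ∞ fun z => momentMap ν n k z X := by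
  simp only [momentMap_eq]
  exact contDiff_const.mul
    (((omega (Idx d n k)).contDiff).clm_apply (act n k (lieCoords ν k X)).contDiff)

theorem lieCoords_injective : Function.Injective (lieCoords ν k) := by
  intro X Y h
  refine Subtype.ext (Prod.ext (funext fun j => ?_) 
    (congrArg (fun c : Coords d k => c.2) h))
  have h1 : Complex.I * (X.1.1 j : ℂ) = Complex.I * (Y.1.1 j : ℂ) := congrFun (congrArg Prod.fst h) j
  exact Complex.ofReal_injective (mul_left_cancel₀ Complex.I_ne_zero h1)

theorem hasDerivAt_act {c : ℝ → Coords d k} {c' : Coords d k} {s : ℝ} (hc : HasDerivAt c c' s)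
    (z : Idx d n k → ℂ) : HasDerivAt (fun s => act n k (c s) z) (act n k c' z) s :=
  ((act n k).flip z).hasFDerivAt.comp_hasDerivAt s hc

/-- Orbits are tangent to the level set. -/
theorem omega_act_eq_zero {z : Idx d n k → ℂ} (hz : z ∈ Level ν n k) (X Y : lieG ν k) :
    omega _ (act n k (lieCoords ν k X) z) (act n k (lieCoords ν k Y) z) = 0 := by
  obtain ⟨c, hc0, -, -, hc, -⟩ := exists_oneParam X
  have h1 : HasDerivAt (fun s => act n k (coords ν k (c s)) z) (act n k (lieCoords ν k X) z) 0 :=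
    hasDerivAt_act hc z
  have h0 : act n k (coords ν k (c 0)) z = z := by rw [hc0, map_one, act_one]
  have h2 := hasFDerivAt_momentMap (n := n) Y z
  rw [← h0] at h2
  have h3 := h2.comp_hasDerivAt (0 : ℝ) h1
  have h4 : ((fun z => momentMap ν n k z Y) ∘ fun s => act n k (coords ν k (c s)) z) =
      fun _ => momentValue ν n k Y :=
    funext fun s => LinearMap.congr_fun (embed_mulVec_mem ν n k (c s) hz) Y
  rw [h4, h0] at h3
  exact h3.unique (hasDerivAt_const _ _)

/-- A smooth equivariant map sends the infinitesimal action to left translation. -/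
theorem fderiv_equivariantMap {O : Set (Idx d n k → ℂ)} {Γ : (Idx d n k → ℂ) → G ν k}
    (hO : IsOpen O) (hΓ : ContDiffOn ℝ ∞ (fun z => coords ν k (Γ z)) O)
    (hact : ∀ (g : G ν k), ∀ z ∈ O, act n k (coords ν k g) z ∈ O ∧
      Γ (act n k (coords ν k g) z) = g * Γ z) {z : Idx d n k → ℂ} (hz : z ∈ O) (X : lieG ν k) :
    fderiv ℝ (fun z => coords ν k (Γ z)) z (act n k (lieCoords ν k X) z) =
      lieCoords ν k X * coords ν k (Γ z) := by
  obtain ⟨c, hc0, -, -, hc, -⟩ := exists_oneParam X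
  have h1 : HasDerivAt (fun s => act n k (coords ν k (c s)) z) (act n k (lieCoords ν k X) z) 0 :=
    hasDerivAt_act hc z
  have h0 : act n k (coords ν k (c 0)) z = z := by rw [hc0, map_one, act_one]
  have h2 := ((hΓ.contDiffAt (hO.mem_nhds hz)).differentiableAt (by simp)).hasFDerivAt
  rw [← h0] at h2
  have h3 := h2.comp_hasDerivAt (0 : ℝ) h1
  rw [h0] at h3
  have h4 : ((fun z => coords ν k (Γ z)) ∘ fun s => act n k (coords ν k (c s)) z) =
      fun s => coords ν k (c s) * coords ν k (Γ z) :=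
    funext fun s => by rw [Function.comp_apply, (hact (c s) z hz).2, map_mul]
  rw [h4] at h3
  exact h3.unique (hc.mul_const _)

/-- Infinitesimal freeness: the derivative of Γ in the direction Xz is X·Γ(z), which determines X.
-/
theorem act_lieCoords_injective {O : Set (Idx d n k → ℂ)} {Γ : (Idx d n k → ℂ) → G ν k}
    (hO : IsOpen O) (hΓ : ContDiffOn ℝ ∞ (fun z => coords ν k (Γ z)) O)
    (hact : ∀ (g : G ν k), ∀ z ∈ O, act n k (coords ν k g) z ∈ O ∧
      Γ (act n k (coords ν k g) z) = g * Γ z) {z : Idx d n k → ℂ} (hz : z ∈ O) {X : lieG ν k}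
    (hX : act n k (lieCoords ν k X) z = 0) : X = 0 := by
  have h1 := fderiv_equivariantMap hO hΓ hact hz X
  rw [hX, map_zero] at h1
  apply lieCoords_injective
  calc lieCoords ν k X = lieCoords ν k X * coords ν k (Γ z) * star (coords ν k (Γ z)) := by
        rw [mul_assoc, coords_mul_star, mul_one]
    _ = lieCoords ν k 0 := by rw [← h1, zero_mul, map_zero]

end Infinitesimal

end ToricGrassmann

namespace ToricGrassmann

section Slices

open Filter Topology

attribute [local instance] Matrix.linftyOpNormedRing Matrix.linftyOpNormedAlgebra

variable {m d r : ℕ} {ν : Fin d → Fin m → ℤ} {n k : Fin r → ℕ}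

/-! ### Slices -/

/-- The components of the moment map in a basis of the Lie algebra. -/
noncomputable def momentCoord (ν : Fin d → Fin m → ℤ) (n k : Fin r → ℕ) (z : Idx d n k → ℂ)
    (i : Fin (Module.finrank ℝ (lieG ν k))) : ℝ :=
  momentMap ν n k z (Module.finBasis ℝ (lieG ν k) i)

theorem contDiff_momentCoord : ContDiff ℝ ∞ (momentCoord ν n k) :=
  contDiff_pi.2 fun _ => contDiff_momentMap _

theorem momentCoord_eq_iff {z z' : Idx d n k → ℂ} :
    momentCoord ν n k z = momentCoord ν n k z' ↔ momentMap ν n k z = momentMap ν n k z' :=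
  ⟨fun h => (Module.finBasis ℝ (lieG ν k)).ext fun i => congrFun h i,
    fun h => funext fun i => by simp only [momentCoord, h]⟩

theorem momentCoord_eq_iff_mem {z z₀ : Idx d n k → ℂ} (hz₀ : z₀ ∈ Level ν n k) :
    momentCoord ν n k z = momentCoord ν n k z₀ ↔ z ∈ Level ν n k := by
  have h0 : momentMap ν n k z₀ = momentValue ν n k := hz₀
  rw [momentCoord_eq_iff, h0]
  rfl

theorem fderiv_momentCoord (z w : Idx d n k → ℂ) (i : Fin (Module.finrank ℝ (lieG ν k))) :
    fderiv ℝ (momentCoord ν n k) z w i =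
      omega _ w (act n k (lieCoords ν k (Module.finBasis ℝ (lieG ν k) i)) z) := by
  have h1 : HasFDerivAt (momentCoord ν n k) _ z := hasFDerivAt_pi.2 fun i =>
    hasFDerivAt_momentMap (n := n) (Module.finBasis ℝ (lieG ν k) i) z
  rw [h1.fderiv]
  rfl

theorem fderiv_momentCoord_eq_zero_iff (z w : Idx d n k → ℂ) :
    fderiv ℝ (momentCoord ν n k) z w = 0 ↔
      ∀ X : lieG ν k, omega _ w (act n k (lieCoords ν k X) z) = 0 := by
  refine ⟨fun h X => ?_, fun h => funext fun i => (fderiv_momentCoord z w i).trans (h _)⟩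
  let L : lieG ν k →ₗ[ℝ] ℝ :=
    ((omega (Idx d n k) w).toLinearMap ∘ₗ ((act n k).flip z).toLinearMap) ∘ₗ lieCoords ν k
  have h1 : L = 0 := (Module.finBasis ℝ (lieG ν k)).ext fun i =>
    (fderiv_momentCoord z w i).symm.trans (congrFun h i)
  exact LinearMap.congr_fun h1 X

/-- A functional vanishing on the range is pairing with some X for which ω(w, Xz) = 0 for all w.
Then Xz = 0, and freeness gives X = 0. -/
theorem fderiv_momentCoord_surjective {z : Idx d n k → ℂ}
    (hz : ∀ X : lieG ν k, act n k (lieCoords ν k X) z = 0 → X = 0) :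
    Function.Surjective (fderiv ℝ (momentCoord ν n k) z) := by
  by_contra hcon
  have h1 : LinearMap.range (fderiv ℝ (momentCoord ν n k) z).toLinearMap < ⊤ :=
    lt_top_iff_ne_top.2 fun h => hcon (LinearMap.range_eq_top.1 h)
  obtain ⟨f, hf, hle⟩ := Submodule.exists_le_ker_of_lt_top _ h1
  let b := Module.finBasis ℝ (lieG ν k)
  let X : lieG ν k := ∑ i, f (Pi.single i 1) • b i
  have h2 : ∀ w, f (fderiv ℝ (momentCoord ν n k) z w) =
      omega _ w (act n k (lieCoords ν k X) z) := by
    intro w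
    have h3 : ∀ i : Fin (Module.finrank ℝ (lieG ν k)),
        (fun j => if i = j then (1 : ℝ) else 0) = Pi.single i 1 := fun i => by
      ext j
      simp [Pi.single_apply, eq_comm]
    rw [LinearMap.pi_apply_eq_sum_univ f]
    simp only [X, h3, map_sum, map_smul, fderiv_momentCoord, FunLike.coe_sum, Finset.sum_apply,
      FunLike.coe_smul, Pi.smul_apply, smul_eq_mul]
    exact Finset.sum_congr rfl fun i _ => mul_comm _ _
  have h3 : X = 0 := by
    refine hz X (eq_zero_of_omega fun w => ?_)
    rw [omega_swap, ← h2, neg_eq_zero]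
    exact hle ⟨w, rfl⟩
  apply hf
  refine LinearMap.pi_ext' fun i => LinearMap.ext_ring ?_
  have h4 := congrArg (fun Y => b.repr Y i) h3
  simpa [X, Finsupp.single_apply] using h4

/-- A slice of the action of `G` on the level set at a point, together with an equivariant map. -/
structure LocalSlice (z₀ : Level ν n k) (c : ℕ) where
  O : Set (Idx d n k → ℂ)
  Γ : (Idx d n k → ℂ) → G ν k
  O₁ : Set (Idx d n k → ℂ)
  W : Set (EuclideanSpace ℝ (Fin c))
  P : (Idx d n k → ℂ) →L[ℝ] EuclideanSpace ℝ (Fin c)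
  s : EuclideanSpace ℝ (Fin c) → (Idx d n k → ℂ)
  isOpen_O : IsOpen O
  contDiffOn_Γ : ContDiffOn ℝ ∞ (fun z => coords ν k (Γ z)) O
  Γ_self : Γ z₀ = 1
  act_mem : ∀ (g : G ν k), ∀ z ∈ O, act n k (coords ν k g) z ∈ O
  Γ_act : ∀ (g : G ν k), ∀ z ∈ O, Γ (act n k (coords ν k g) z) = g * Γ z
  isOpen_O₁ : IsOpen O₁
  isOpen_W : IsOpen W
  subset_O : O₁ ⊆ O
  self_mem : (z₀ : Idx d n k → ℂ) ∈ O₁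
  contDiffOn_s : ContDiffOn ℝ ∞ s W
  s_mem : ∀ w ∈ W, s w ∈ O₁
  s_mem_level : ∀ w ∈ W, s w ∈ Level ν n k
  Γ_s : ∀ w ∈ W, Γ (s w) = 1
  P_s : ∀ w ∈ W, P (s w) = w
  P_mem : ∀ z ∈ O₁, z ∈ Level ν n k → Γ z = 1 → P z ∈ W
  s_P : ∀ z ∈ O₁, z ∈ Level ν n k → Γ z = 1 → s (P z) = z

/-- The slice is a level set of the pair formed by the moment map and the logarithm of Γ, both with
values in spaces of dimension dim 𝔤. Surjectivity of its derivative gives the dimension count 2 dim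
𝔤 + c. -/
theorem exists_slice (hν : IsMonotoneDelzant ν) (hn : ∀ i, 1 ≤ n i) (z₀ : Level ν n k) :
    ∃ c : ℕ, Module.finrank ℝ (Idx d n k → ℂ) = 2 * Module.finrank ℝ (lieG ν k) + c ∧
      Nonempty (LocalSlice z₀ c) := by
  obtain ⟨O, Γ, hO, hzO, hΓ, hΓ1, hact⟩ := exists_equivariantMap hν hn z₀.2
  obtain ⟨Q, hQ, -⟩ := exists_isTorusRetraction hν zero_mem_monotonePolytope
  obtain ⟨T, hT, h1T, hlog, hlog1, hlog0, hlogd⟩ := exists_log (k := k) hQ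
  have hfree : ∀ X : lieG ν k, act n k (lieCoords ν k X) z₀ = 0 → X = 0 :=
    fun X hX => act_lieCoords_injective hO hΓ hact hzO hX
  let U : Set (Idx d n k → ℂ) := O ∩ (fun z => coords ν k (Γ z)) ⁻¹' T
  have hU : IsOpen U := hΓ.continuousOn.isOpen_inter_preimage hO hT
  have hzU : (z₀ : Idx d n k → ℂ) ∈ U := ⟨hzO, by
    rw [Set.mem_preimage, hΓ1, map_one]; exact h1T⟩
  let lam : (Idx d n k → ℂ) → lieG ν k := fun z => logG hQ (coords ν k (Γ z))
  have hlam : ContDiffOn ℝ ∞ lam U :=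
    hlog.comp (hΓ.mono Set.inter_subset_left) Set.inter_subset_right
  let f : (Idx d n k → ℂ) → (Fin (Module.finrank ℝ (lieG ν k)) → ℝ) × lieG ν k :=
    fun z => (momentCoord ν n k z, lam z)
  have hf : ContDiffOn ℝ ∞ f U := contDiff_momentCoord.contDiffOn.prodMk hlam
  have hdlam : ∀ X, fderiv ℝ lam z₀ (act n k (lieCoords ν k X) z₀) = X := by
    intro X
    have h1 := ((hΓ.contDiffAt (hO.mem_nhds hzO)).differentiableAt (by simp)).hasFDerivAt
    have h2 : HasFDerivAt (logG (k := k) hQ) (fderiv ℝ (logG (k := k) hQ) 1)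
        (coords ν k (Γ z₀)) := by
      rw [hΓ1, map_one]
      exact ((hlog.contDiffAt (hT.mem_nhds h1T)).differentiableAt (by simp)).hasFDerivAt
    have h3 : HasFDerivAt lam _ z₀.1 :=
      HasFDerivAt.comp (g := logG hQ) (f := fun z => coords ν k (Γ z)) z₀.1 h2 h1
    have h4 := fderiv_equivariantMap hO hΓ hact hzO X
    rw [hΓ1, map_one, mul_one] at h4
    refine (congrArg (fun T => T (act n k (lieCoords ν k X) z₀)) h3.fderiv).trans ?_
    exact (congrArg (fderiv ℝ (logG (k := k) hQ) 1) h4).trans (hlogd X)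
  have hfd : HasFDerivAt f ((fderiv ℝ (momentCoord ν n k) z₀).prod (fderiv ℝ lam z₀)) z₀.1 :=
    ((contDiff_momentCoord.differentiable (by simp)).differentiableAt.hasFDerivAt).prodMk
      (((hlam.contDiffAt (hU.mem_nhds hzU)).differentiableAt (by simp)).hasFDerivAt)
  have hsurj : Function.Surjective (fderiv ℝ f z₀) := by
    rw [hfd.fderiv]
    rintro ⟨y, Y⟩
    obtain ⟨w, hw⟩ := fderiv_momentCoord_surjective hfree y
    -- Adding the orbit direction Xz₀ corrects the logarithm component, whose derivative there is X,
    -- without changing the moment component, because orbits stay in the level set.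
    set X := Y - fderiv ℝ lam z₀ w
    refine ⟨w + act n k (lieCoords ν k X) z₀, Prod.ext ?_ ?_⟩
    · have h1 : fderiv ℝ (momentCoord ν n k) z₀ (act n k (lieCoords ν k X) z₀) = 0 :=
        (fderiv_momentCoord_eq_zero_iff _ _).2 fun Y => omega_act_eq_zero z₀.2 X Y
      simp only [ContinuousLinearMap.prod_apply, map_add, h1, hw, Prod.mk_add_mk, add_zero]
    · simp only [ContinuousLinearMap.prod_apply, map_add, hdlam, X, Prod.mk_add_mk, add_sub_cancel]
  have hdim : Module.finrank ℝ ((Fin (Module.finrank ℝ (lieG ν k)) → ℝ) × lieG ν k) =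
      2 * Module.finrank ℝ (lieG ν k) := by
    simp [two_mul]
  have hle := LinearMap.finrank_le_finrank_of_surjective (f := (fderiv ℝ f z₀).toLinearMap) hsurj
  obtain ⟨c, hc⟩ := Nat.exists_eq_add_of_le hle
  obtain ⟨O₁, W, P, s, hO₁, hW, hO₁U, hz₁, hs, hsW, hsP, -⟩ :=
    exists_levelSet_parametrization hU hf hzU hsurj hc
  have hfz₀ : f z₀ = (momentCoord ν n k z₀, 0) := by
    simp only [f, lam, hΓ1, map_one, hlog1]
  have hfz : ∀ z, z ∈ Level ν n k → Γ z = 1 → f z = f z₀ := fun z hz hz1 => by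
    rw [hfz₀]
    simp only [f, lam, hz1, map_one, hlog1, (momentCoord_eq_iff_mem z₀.2).2 hz]
  refine ⟨c, by rw [hc, hdim], ⟨{ 
    O := O, Γ := Γ, O₁ := O₁, W := W, P := P, s := s
    isOpen_O := hO, contDiffOn_Γ := hΓ, Γ_self := hΓ1
    act_mem := fun g z hz => (hact g z hz).1
    Γ_act := fun g z hz => (hact g z hz).2
    isOpen_O₁ := hO₁, isOpen_W := hW
    subset_O := fun z hz => (hO₁U hz).1
    self_mem := hz₁, contDiffOn_s := hs
    s_mem := fun w hw => (hsW w hw).1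
    s_mem_level := fun w hw => (momentCoord_eq_iff_mem z₀.2).1 (congrArg Prod.fst (hsW w hw).2.1)
    Γ_s := fun w hw => hlog0 _ (hO₁U (hsW w hw).1).2
      ((congrArg Prod.snd (hsW w hw).2.1).trans (congrArg Prod.snd hfz₀))
    P_s := fun w hw => (hsW w hw).2.2
    P_mem := fun z hz hzZ hz1 => (hsP z hz (hfz z hzZ hz1)).1
    s_P := fun z hz hzZ hz1 => (hsP z hz (hfz z hzZ hz1)).2 }⟩⟩

/-- The level set is parametrized near each of its points. -/
theorem exists_levelChart (hν : IsMonotoneDelzant ν) (hn : ∀ i, 1 ≤ n i) {a : ℕ}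
    (ha : Module.finrank ℝ (Idx d n k → ℂ) = Module.finrank ℝ (lieG ν k) + a) (z₀ : Level ν n k) :
    ∃ C : QuotientChart (EuclideanSpace ℝ (Fin a)) (id : Level ν n k → Level ν n k),
      (z₀ : Idx d n k → ℂ) ∈ C.dom ∧ C.lift (C.coord z₀) = z₀ ∧
      ∀ v, (∀ X : lieG ν k, omega _ v (act n k (lieCoords ν k X) z₀) = 0) →
        ∃ w, fderiv ℝ (fun w => (C.lift w : Idx d n k → ℂ)) (C.coord z₀) w = v := by
  obtain ⟨O, Γ, hO, hzO, hΓ, hΓ1, hact⟩ := exists_equivariantMap hν hn z₀.2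
  have hfree : ∀ X : lieG ν k, act n k (lieCoords ν k X) z₀ = 0 → X = 0 :=
    fun X hX => act_lieCoords_injective hO hΓ hact hzO hX
  obtain ⟨O₁, W, P, s, hO₁, hW, -, hz₁, hs, hsW, hsP, hd⟩ :=
    exists_levelSet_parametrization isOpen_univ
      (contDiff_momentCoord (ν := ν) (n := n) (k := k)).contDiffOn (Set.mem_univ z₀.1)
      (fderiv_momentCoord_surjective hfree) (c := a) (by simpa using ha)
  classical
  let lift : EuclideanSpace ℝ (Fin a) → Level ν n k :=
    fun w => if h : s w ∈ Level ν n k then ⟨s w, h⟩ else z₀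
  have hlift : ∀ w ∈ W, (lift w : Idx d n k → ℂ) = s w := fun w hw => by
    have h1 := (momentCoord_eq_iff_mem z₀.2).1 (hsW w hw).2.1
    simp only [lift, dif_pos h1]
  have hP : ∀ z : Level ν n k, (z : Idx d n k → ℂ) ∈ O₁ → P z ∈ W ∧ s (P z) = z :=
    fun z hz => hsP z hz ((momentCoord_eq_iff_mem z₀.2).2 z.2)
  let C : QuotientChart (EuclideanSpace ℝ (Fin a)) (id : Level ν n k → Level ν n k) :=
    { dom := O₁, cod := W, coord := P, lift := lift
      isOpen_dom := hO₁, isOpen_cod := hW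
      contDiffOn_coord := P.contDiff.contDiffOn
      contDiffOn_lift := hs.congr hlift
      coord_mem := fun z hz => (hP z hz).1
      lift_mem := fun w hw => by rw [hlift w hw]; exact (hsW w hw).1
      coord_lift := fun w hw => by rw [hlift w hw]; exact (hsW w hw).2.2
      quot_lift_coord := fun z hz => Subtype.ext (by
        rw [id, id, hlift _ (hP z hz).1]; exact (hP z hz).2)
      saturated := fun z z' h hz => by
        obtain rfl : z = z' := h
        exact ⟨hz, rfl⟩ }
  refine ⟨C, hz₁, C.quot_lift_coord z₀ hz₁, fun v hv => ?_⟩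
  obtain ⟨w, hw⟩ := hd v ((fderiv_momentCoord_eq_zero_iff _ _).2 hv)
  refine ⟨w, Eq.trans ?_ hw⟩
  have h1 : (fun w => (C.lift w : Idx d n k → ℂ)) =ᶠ[𝓝 (P z₀)] s := by
    filter_upwards [hW.mem_nhds (hP z₀ hz₁).1] with w hw using hlift w hw
  exact congrArg (fun T => T w) (h1.fderiv_eq (𝕜 := ℝ))

end Slices

end ToricGrassmann

namespace ToricGrassmann

section Charts

open Filter Topology

attribute [local instance] Matrix.linftyOpNormedRing Matrix.linftyOpNormedAlgebra

variable {m d r : ℕ} {ν : Fin d → Fin m → ℤ} {n k : Fin r → ℕ}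

/-! ### Charts of the quotients -/

theorem toBase_eq_iff {z z' : Level ν n k} :
    toBase ν n k z = toBase ν n k z' ↔ ∃ g : G ν k, g • z' = z :=
  Quotient.eq (r := MulAction.orbitRel (G ν k) (Level ν n k))

theorem toTotalSpace_eq_iff {z z' : Level ν n k} :
    toTotalSpace ν n k z = toTotalSpace ν n k z' ↔ ∃ g ∈ G0tau ν n k, g • z' = z := by
  refine (Quotient.eq (r := MulAction.orbitRel (G0tau ν n k) (Level ν n k))).trans ?_
  exact ⟨fun ⟨g, hg⟩ => ⟨g, g.2, hg⟩, fun ⟨g, hg, h⟩ => ⟨⟨g, hg⟩, h⟩⟩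

/-- The involution of the algebra of coordinates as a continuous linear map. -/
noncomputable def starCoords : Coords d k →L[ℝ] Coords d k :=
  LinearMap.toContinuousLinearMap
    { toFun := fun c => star c
      map_add' := fun _ _ => star_add _ _
      map_smul' := fun a c => by
        refine Prod.ext (funext fun j => ?_) (funext fun i => ?_)
        · simp
        · exact (Matrix.conjTranspose_smul a (c.2 i)) }

theorem starCoords_coords (g : G ν k) : starCoords (coords ν k g) = coords ν k g⁻¹ :=
  (coords_inv g).symm

namespace LocalSlice

variable {z₀ : Level ν n k} {c : ℕ} (S : LocalSlice z₀ c)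

/-- The projection to the slice along the orbits. -/
noncomputable def toSlice (z : Idx d n k → ℂ) : Idx d n k → ℂ :=
  act n k (starCoords (coords ν k (S.Γ z))) z

theorem toSlice_eq (z : Idx d n k → ℂ) : S.toSlice z = act n k (coords ν k (S.Γ z)⁻¹) z := by
  rw [toSlice, starCoords_coords]

theorem toSlice_coe (z : Level ν n k) : S.toSlice z = ((S.Γ z)⁻¹ • z : Level ν n k) := by
  rw [toSlice_eq, act_coords]

theorem contDiffOn_toSlice : ContDiffOn ℝ ∞ S.toSlice S.O :=
  ((act n k).contDiff.comp_contDiffOn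
    (starCoords.contDiff.comp_contDiffOn S.contDiffOn_Γ)).clm_apply contDiffOn_id

theorem toSlice_act (g : G ν k) {z : Idx d n k → ℂ} (hz : z ∈ S.O) :
    S.toSlice (act n k (coords ν k g) z) = S.toSlice z := by
  rw [toSlice_eq, toSlice_eq, S.Γ_act g z hz, ← act_mul, ← map_mul, _root_.mul_inv_rev,
    inv_mul_cancel_right]

theorem Γ_toSlice {z : Idx d n k → ℂ} (hz : z ∈ S.O) : S.Γ (S.toSlice z) = 1 := by
  rw [toSlice_eq, S.Γ_act _ z hz, inv_mul_cancel]

theorem toSlice_of_eq_one {z : Idx d n k → ℂ} (hz : S.Γ z = 1) : S.toSlice z = z := by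
  rw [toSlice_eq, hz, inv_one, map_one, act_one]

open Classical in
/-- The parametrization of the slice. -/
noncomputable def lift (w : EuclideanSpace ℝ (Fin c)) : Level ν n k :=
  if h : S.s w ∈ Level ν n k then ⟨S.s w, h⟩ else z₀

theorem coe_lift {w : EuclideanSpace ℝ (Fin c)} (hw : w ∈ S.W) :
    (S.lift w : Idx d n k → ℂ) = S.s w := by
  simp only [lift, dif_pos (S.s_mem_level w hw)]

theorem P_toSlice_mem (z : Level ν n k) (hz : (z : Idx d n k → ℂ) ∈ S.O)
    (hz₁ : S.toSlice z ∈ S.O₁) : S.P (S.toSlice z) ∈ S.W :=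
  S.P_mem _ hz₁ (by rw [S.toSlice_coe]; exact Subtype.coe_prop _) (S.Γ_toSlice hz)

theorem lift_P_toSlice (z : Level ν n k) (hz : (z : Idx d n k → ℂ) ∈ S.O)
    (hz₁ : S.toSlice z ∈ S.O₁) : S.lift (S.P (S.toSlice z)) = (S.Γ z)⁻¹ • z := by
  apply Subtype.ext
  rw [S.coe_lift (S.P_toSlice_mem z hz hz₁), S.s_P _ hz₁ _ (S.Γ_toSlice hz), S.toSlice_coe]
  rw [S.toSlice_coe]
  exact Subtype.coe_prop _

theorem self_mem_O : (z₀ : Idx d n k → ℂ) ∈ S.O := S.subset_O S.self_mem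

theorem toSlice_self : S.toSlice z₀ = z₀ := S.toSlice_of_eq_one S.Γ_self

/-- The chart of the base given by a slice. -/
noncomputable def baseChart : QuotientChart (EuclideanSpace ℝ (Fin c)) (toBase ν n k) where
  dom := S.O ∩ S.toSlice ⁻¹' S.O₁
  cod := S.W
  coord z := S.P (S.toSlice z)
  lift := S.lift
  isOpen_dom := S.contDiffOn_toSlice.continuousOn.isOpen_inter_preimage S.isOpen_O S.isOpen_O₁
  isOpen_cod := S.isOpen_W
  contDiffOn_coord := S.P.contDiff.comp_contDiffOn
    (S.contDiffOn_toSlice.mono Set.inter_subset_left)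
  contDiffOn_lift := S.contDiffOn_s.congr fun _ hw => S.coe_lift hw
  coord_mem z hz := S.P_toSlice_mem z hz.1 hz.2
  lift_mem w hw := by
    rw [S.coe_lift hw]
    refine ⟨S.subset_O (S.s_mem w hw), ?_⟩
    rw [Set.mem_preimage, S.toSlice_of_eq_one (S.Γ_s w hw)]
    exact S.s_mem w hw
  coord_lift w hw := by
    rw [S.coe_lift hw, S.toSlice_of_eq_one (S.Γ_s w hw), S.P_s w hw]
  quot_lift_coord z hz := by
    rw [S.lift_P_toSlice z hz.1 hz.2, toBase_eq_iff]
    exact ⟨_, rfl⟩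
  saturated z z' h hz := by
    obtain ⟨g, hg⟩ := toBase_eq_iff.1 h.symm
    have h1 : (z' : Idx d n k → ℂ) = act n k (coords ν k g) z := by rw [act_coords, hg]
    rw [h1, S.toSlice_act g hz.1]
    refine ⟨⟨S.act_mem g z hz.1, ?_⟩, rfl⟩
    rw [Set.mem_preimage, S.toSlice_act g hz.1]
    exact hz.2

theorem self_mem_baseChart : (z₀ : Idx d n k → ℂ) ∈ S.baseChart.dom ∧
    S.baseChart.lift (S.baseChart.coord z₀) = z₀ := by
  have h1 : S.toSlice z₀ ∈ S.O₁ := by rw [S.toSlice_self]; exact S.self_mem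
  refine ⟨⟨S.self_mem_O, h1⟩, ?_⟩
  change S.lift (S.P (S.toSlice z₀)) = z₀
  rw [S.lift_P_toSlice z₀ S.self_mem_O h1, S.Γ_self, inv_one, one_smul]

/-- The angular coordinate. -/
noncomputable def angle (a : Fin d → ℤ) (b : Fin r → ℤ) (z : Idx d n k → ℂ) : ℝ :=
  (Complex.log (characterExt a b (coords ν k (S.Γ z)))).im

theorem angle_eq (a : Fin d → ℤ) (b : Fin r → ℤ) (z : Idx d n k → ℂ) :
    S.angle a b z = Complex.arg (character ν k a b (S.Γ z)) := by
  rw [angle, characterExt_coords, Complex.log_im]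

theorem contDiffOn_characterExt (a : Fin d → ℤ) (b : Fin r → ℤ) :
    ContDiffOn ℝ ∞ (fun z => characterExt a b (coords ν k (S.Γ z))) S.O := fun z hz =>
  (ContDiffAt.comp (g := characterExt a b) (f := fun z => coords ν k (S.Γ z)) z
    (contDiffAt_characterExt a b (S.Γ z))
    (S.contDiffOn_Γ.contDiffAt (S.isOpen_O.mem_nhds hz))).contDiffWithinAt

/-- The chart of the total space given by a slice. -/
noncomputable def totalChart {a : Fin d → ℤ} {b : Fin r → ℤ}
    (hker : (character ν k a b).ker = G0tau ν n k) {ε : ℝ → G ν k}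
    (hε : ContDiff ℝ ∞ fun s => coords ν k (ε s))
    (hεθ : ∀ s, character ν k a b (ε s) = Circle.exp s)
    (e : (EuclideanSpace ℝ (Fin c) × ℝ) ≃L[ℝ] EuclideanSpace ℝ (Fin (c + 1))) :
    QuotientChart (EuclideanSpace ℝ (Fin (c + 1))) (toTotalSpace ν n k) where
  -- The coordinates are a point of the slice and the angle of θ(Γ z). The slit plane removes θ(Γ z)
  -- = −1, where the angle jumps; at `z₀` itself the angle is 0.
  dom := S.O ∩ (S.toSlice ⁻¹' S.O₁ ∩
    {z | characterExt a b (coords ν k (S.Γ z)) ∈ Complex.slitPlane})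
  cod := e.symm ⁻¹' (S.W ×ˢ Set.Ioo (-Real.pi) Real.pi)
  coord z := e (S.P (S.toSlice z), S.angle a b z)
  lift w := ε (e.symm w).2 • S.lift (e.symm w).1
  isOpen_dom := by
    have h1 : S.O ∩ (S.toSlice ⁻¹' S.O₁ ∩
        {z | characterExt a b (coords ν k (S.Γ z)) ∈ Complex.slitPlane}) =
        S.O ∩ (fun z => (S.toSlice z, characterExt a b (coords ν k (S.Γ z)))) ⁻¹'
          (S.O₁ ×ˢ Complex.slitPlane) := rfl
    rw [h1]
    exact (S.contDiffOn_toSlice.continuousOn.prodMk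
      (S.contDiffOn_characterExt a b).continuousOn).isOpen_inter_preimage S.isOpen_O
        (S.isOpen_O₁.prod Complex.isOpen_slitPlane)
  isOpen_cod := (S.isOpen_W.prod isOpen_Ioo).preimage e.symm.continuous
  contDiffOn_coord := by
    refine e.contDiff.comp_contDiffOn (ContDiffOn.prodMk ?_ ?_)
    · exact S.P.contDiff.comp_contDiffOn (S.contDiffOn_toSlice.mono Set.inter_subset_left)
    · intro z hz
      have h1 := (S.contDiffOn_characterExt a b).contDiffAt (S.isOpen_O.mem_nhds hz.1)
      have h2 : ContDiffAt ℝ ∞ Complex.log (characterExt a b (coords ν k (S.Γ z))) :=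
        (Complex.contDiffAt_log hz.2.2).restrict_scalars ℝ
      exact (Complex.imCLM.contDiff.contDiffAt.comp z
        (ContDiffAt.comp z h2 h1)).contDiffWithinAt
  contDiffOn_lift := by
    have h1 : ContDiffOn ℝ ∞ (fun w => act n k (coords ν k (ε (e.symm w).2)) (S.s (e.symm w).1))
        (e.symm ⁻¹' (S.W ×ˢ Set.Ioo (-Real.pi) Real.pi)) := by
      have h2 : ContDiff ℝ ∞ fun w => (e.symm w).2 := contDiff_snd.comp e.symm.contDiff
      have h3 : ContDiff ℝ ∞ fun w => (e.symm w).1 := contDiff_fst.comp e.symm.contDiff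
      exact (((act n k).contDiff.comp (hε.comp h2)).contDiffOn).clm_apply
        (S.contDiffOn_s.comp h3.contDiffOn fun w hw => hw.1)
    refine h1.congr fun w hw => ?_
    rw [← S.coe_lift hw.1, act_coords]
  coord_mem z hz := by
    rw [Set.mem_preimage, e.symm_apply_apply]
    refine ⟨S.P_toSlice_mem z hz.1 hz.2.1, ?_⟩
    change S.angle a b z ∈ _
    have h1 := hz.2.2
    rw [Set.mem_ofPred_eq, characterExt_coords, Complex.mem_slitPlane_iff_arg] at h1
    rw [S.angle_eq]
    exact ⟨Complex.neg_pi_lt_arg _, lt_of_le_of_ne (Complex.arg_le_pi _) h1.1⟩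
  lift_mem w hw := by
    rw [← act_coords, S.coe_lift hw.1]
    have h1 := S.subset_O (S.s_mem _ hw.1)
    refine ⟨S.act_mem _ _ h1, ?_, ?_⟩
    · rw [Set.mem_preimage, S.toSlice_act _ h1, S.toSlice_of_eq_one (S.Γ_s _ hw.1)]
      exact S.s_mem _ hw.1
    · rw [Set.mem_ofPred_eq, characterExt_coords, S.Γ_act _ _ h1, S.Γ_s _ hw.1, mul_one, hεθ,
        Complex.mem_slitPlane_iff_arg, Circle.arg_exp hw.2.1 hw.2.2.le]
      exact ⟨hw.2.2.ne, Circle.coe_ne_zero _⟩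
  coord_lift w hw := by
    rw [← act_coords, S.coe_lift hw.1]
    have h1 := S.subset_O (S.s_mem _ hw.1)
    rw [S.toSlice_act _ h1, S.toSlice_of_eq_one (S.Γ_s _ hw.1), S.P_s _ hw.1, S.angle_eq,
      S.Γ_act _ _ h1, S.Γ_s _ hw.1, mul_one, hεθ, Circle.arg_exp hw.2.1 hw.2.2.le]
    exact e.apply_symm_apply w
  quot_lift_coord z hz := by
    rw [e.symm_apply_apply, S.lift_P_toSlice z hz.1 hz.2.1, toTotalSpace_eq_iff]
    -- This element carries `z` to its lift, and θ takes the value 1 on it, so it lies in `G0tau`.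
    refine ⟨ε (S.angle a b z) * (S.Γ z)⁻¹, ?_, mul_smul _ _ _⟩
    rw [← hker, MonoidHom.mem_ker, map_mul, hεθ, S.angle_eq, Circle.exp_arg, map_inv,
      mul_inv_cancel]
  saturated z z' h hz := by
    obtain ⟨g, hgK, hg⟩ := toTotalSpace_eq_iff.1 h.symm
    have h1 : (z' : Idx d n k → ℂ) = act n k (coords ν k g) z := by rw [act_coords, hg]
    rw [← hker, MonoidHom.mem_ker] at hgK
    have h2 : character ν k a b (S.Γ (act n k (coords ν k g) z)) = character ν k a b (S.Γ z) := by
      rw [S.Γ_act g z hz.1, map_mul, hgK, one_mul]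
    rw [h1, S.toSlice_act g hz.1, S.angle_eq, S.angle_eq, h2]
    refine ⟨⟨S.act_mem g z hz.1, ?_, ?_⟩, rfl⟩
    · rw [Set.mem_preimage, S.toSlice_act g hz.1]
      exact hz.2.1
    · rw [Set.mem_ofPred_eq, characterExt_coords, h2, ← characterExt_coords]
      exact hz.2.2

theorem self_mem_totalChart {a : Fin d → ℤ} {b : Fin r → ℤ}
    (hker : (character ν k a b).ker = G0tau ν n k) {ε : ℝ → G ν k} (hε0 : ε 0 = 1)
    (hε : ContDiff ℝ ∞ fun s => coords ν k (ε s))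
    (hεθ : ∀ s, character ν k a b (ε s) = Circle.exp s)
    (e : (EuclideanSpace ℝ (Fin c) × ℝ) ≃L[ℝ] EuclideanSpace ℝ (Fin (c + 1))) :
    (z₀ : Idx d n k → ℂ) ∈ (S.totalChart hker hε hεθ e).dom ∧
    (S.totalChart hker hε hεθ e).lift ((S.totalChart hker hε hεθ e).coord z₀) = z₀ := by
  have h1 : S.toSlice z₀ ∈ S.O₁ := by rw [S.toSlice_self]; exact S.self_mem
  refine ⟨⟨S.self_mem_O, h1, ?_⟩, ?_⟩
  · rw [Set.mem_ofPred_eq, S.Γ_self, characterExt_coords, map_one]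
    exact Complex.one_mem_slitPlane
  · change ε (e.symm (e (S.P (S.toSlice z₀), S.angle a b z₀))).2 •
      S.lift (e.symm (e (S.P (S.toSlice z₀), S.angle a b z₀))).1 = z₀
    rw [e.symm_apply_apply, S.lift_P_toSlice z₀ S.self_mem_O h1, S.angle_eq, S.Γ_self, map_one,
      Circle.coe_one, Complex.arg_one, hε0, inv_one, one_smul, one_smul]

end LocalSlice

end Charts

end ToricGrassmann

namespace ToricGrassmann

section Topology

open Filter Topology

attribute [local instance] Matrix.linftyOpNormedRing Matrix.linftyOpNormedAlgebra

variable {m d r : ℕ} {ν : Fin d → Fin m → ℤ} {n k : Fin r → ℕ}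

/-! ### Compactness of the group -/

/-- K is closed, being cut out by the monomial equations of `P`: a solution t is the exponential of
the vector arg(t)·P, which lies in 𝔨. -/
theorem compactSpace_torusK {P : Fin d → Fin d → ℤ} (hP : IsTorusRetraction ν P) :
    CompactSpace (torusK ν) := by
  refine (isCompact_iff_compactSpace (s := (torusK ν : Set (Fin d → Circle)))).1 ?_
  have h1 : (torusK ν : Set (Fin d → Circle)) = {t | ∀ l, t l = ∏ j, t j ^ P j l} := by
    ext t
    refine ⟨fun ht l => coords_fst_eq_prod (k := (Fin.elim0 : Fin 0 → ℕ)) hP (⟨t, ht⟩, fun i => i.elim0) l,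
      fun ht => ⟨fun l => ∑ j, (P j l : ℝ) * Complex.arg (t j), fun l' => ?_, funext fun l => ?_⟩⟩
    · simp only [Finset.sum_mul]
      rw [Finset.sum_comm]
      refine Finset.sum_eq_zero fun j _ => ?_
      have h1 : ∑ l, (P j l : ℝ) * ν l l' = 0 := by exact_mod_cast hP.row_mem j l'
      calc ∑ l, (P j l : ℝ) * Complex.arg (t j) * ν l l'
          = Complex.arg (t j) * ∑ l, (P j l : ℝ) * ν l l' := by
            rw [Finset.mul_sum]
            exact Finset.sum_congr rfl fun _ _ => by ring
        _ = 0 := by rw [h1, mul_zero]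
    · rw [ht l, ← prod_circle_exp]
      exact Finset.prod_congr rfl fun j _ => by rw [← circle_exp_zpow, Circle.exp_arg]
  rw [h1]
  have h2 : IsClosed {t : Fin d → Circle | ∀ l, t l = ∏ j, t j ^ P j l} := by
    rw [Set.ofPred_forall]
    refine isClosed_iInter fun l => isClosed_eq (continuous_apply l) ?_
    exact continuous_finsetProd _ fun j _ => (continuous_apply j).zpow _
  exact h2.isCompact

theorem compactSpace_G (hν : IsMonotoneDelzant ν) : CompactSpace (G ν k) := by
  obtain ⟨P, hP, -⟩ := exists_isTorusRetraction hν zero_mem_monotonePolytope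
  have := compactSpace_torusK hP
  infer_instance

theorem continuous_coords : Continuous (coords ν k) := by
  refine Continuous.prodMk (continuous_pi fun j => ?_) (continuous_pi fun i => ?_)
  · exact continuous_subtype_val.comp
      ((continuous_apply j).comp (continuous_subtype_val.comp continuous_fst))
  · exact continuous_subtype_val.comp ((continuous_apply i).comp continuous_snd)

instance : ContinuousSMul (G ν k) (Level ν n k) where
  continuous_smul := by
    refine continuous_induced_rng.2 ?_
    exact ((act n k).continuous.comp (continuous_coords.comp continuous_fst)).clm_apply
      (continuous_subtype_val.comp continuous_snd)

theorem isOpenQuotientMap_toBase : IsOpenQuotientMap (toBase ν n k) :=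
  MulAction.isOpenQuotientMap_quotientMk (Γ := G ν k) (T := Level ν n k)

theorem isOpenQuotientMap_toTotalSpace : IsOpenQuotientMap (toTotalSpace ν n k) :=
  MulAction.isOpenQuotientMap_quotientMk (Γ := G0tau ν n k) (T := Level ν n k)

/-! ### The level set is compact and connected -/

/-- A parametrization of the level set. -/
noncomputable def levelMap (hkn : ∀ i, k i ≤ n i)
    (p : (Fin d → Circle) × monotonePolytope ν × (∀ i, Matrix.unitaryGroup (Fin (n i)) ℂ)) :
    Idx d n k → ℂ :=
  Sum.elim (fun j => (p.1 j : ℂ) * (Real.sqrt (2 * ∑ l, p.2.1.1 l * (ν j l : ℝ) + 1) : ℂ))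
    (fun q => (Real.sqrt (n q.1) : ℂ) * (p.2.2 q.1).1 q.2.1 (Fin.castLE (hkn q.1) q.2.2))

theorem levelMap_mem (hkn : ∀ i, k i ≤ n i)
    (p : (Fin d → Circle) × monotonePolytope ν × (∀ i, Matrix.unitaryGroup (Fin (n i)) ℂ)) :
    levelMap hkn p ∈ Level ν n k := by
  rw [mem_level_iff]
  refine ⟨fun x hx => ?_, fun i => ?_⟩
  · have h1 : ∀ j, Complex.normSq (levelMap hkn p (Sum.inl j)) - 1 =
        2 * ∑ l, p.2.1.1 l * (ν j l : ℝ) := fun j => by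
      have h2 : 0 ≤ 2 * ∑ l, p.2.1.1 l * (ν j l : ℝ) + 1 := by
        have := p.2.1.2 j
        linarith
      simp only [levelMap, Sum.elim_inl, map_mul, Circle.normSq_coe, one_mul, Complex.normSq_ofReal,
        Real.mul_self_sqrt h2]
      ring
    simp only [h1, Finset.mul_sum]
    rw [Finset.sum_comm]
    refine Finset.sum_eq_zero fun l _ => ?_
    calc ∑ j, x j * (2 * (p.2.1.1 l * (ν j l : ℝ))) = 2 * p.2.1.1 l * ∑ j, x j * (ν j l : ℝ) := by
          rw [Finset.mul_sum]
          exact Finset.sum_congr rfl fun _ _ => by ring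
      _ = 0 := by rw [hx l, mul_zero]
  · ext b b'
    have h1 := congrFun (congrFun (conjTranspose_mul_coe (p.2.2 i)) (Fin.castLE (hkn i) b'))
      (Fin.castLE (hkn i) b)
    have h3 : ((Real.sqrt (n i) : ℝ) : ℂ) * (Real.sqrt (n i) : ℝ) = n i := by
      rw [← Complex.ofReal_mul, Real.mul_self_sqrt (Nat.cast_nonneg _), Complex.ofReal_natCast]
    have h2 : gram (levelMap hkn p) i b b' = (n i : ℂ) *
        ((p.2.2 i).1ᴴ * (p.2.2 i).1) (Fin.castLE (hkn i) b') (Fin.castLE (hkn i) b) := by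
      rw [Matrix.mul_apply, Finset.mul_sum, gram, Matrix.of_apply]
      refine Finset.sum_congr rfl fun a _ => ?_
      simp only [levelMap, Sum.elim_inr, star_mul', Matrix.conjTranspose_apply, RCLike.star_def,
        Complex.conj_ofReal]
      rw [← h3]
      ring
    rw [h2, h1, Matrix.smul_apply, smul_eq_mul]
    congr 1
    simp [Matrix.one_apply, eq_comm]

theorem continuous_levelMap (hkn : ∀ i, k i ≤ n i) :
    Continuous (levelMap (ν := ν) hkn) := by
  refine continuous_pi fun q => ?_
  rcases q with j | ⟨i, a, b⟩
  · refine Continuous.mul ?_ (Complex.continuous_ofReal.comp (Real.continuous_sqrt.comp ?_))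
    · exact continuous_subtype_val.comp ((continuous_apply j).comp continuous_fst)
    · refine (continuous_const.mul (continuous_finsetSum _ fun l _ => ?_)).add continuous_const
      exact ((continuous_apply l).comp (continuous_subtype_val.comp
        (continuous_fst.comp continuous_snd))).mul continuous_const
  · refine continuous_const.mul ?_
    have h1 : Continuous fun p : (Fin d → Circle) × monotonePolytope ν ×
        (∀ i, Matrix.unitaryGroup (Fin (n i)) ℂ) => (p.2.2 i).1 :=
      continuous_subtype_val.comp ((continuous_apply i).comp (continuous_snd.comp continuous_snd))
    exact h1.matrix_elem a _

theorem exists_unitary_extension {p q : ℕ} (hqp : q ≤ p) {v : Fin q → Fin p → ℂ}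
    (hv : ∀ b b', ∑ a, v b a * star (v b' a) = (1 : Matrix (Fin q) (Fin q) ℂ) b b') :
    ∃ A : Matrix.unitaryGroup (Fin p) ℂ, ∀ a b, A.1 a (Fin.castLE hqp b) = v b a := by
  let w : Fin p → EuclideanSpace ℂ (Fin p) :=
    fun b => if h : (b : ℕ) < q then WithLp.toLp 2 (v ⟨b, h⟩) else 0
  have hw : Orthonormal ℂ ({b : Fin p | (b : ℕ) < q}.domRestrict w) := by
    rw [orthonormal_iff_ite]
    rintro ⟨b, hb⟩ ⟨b', hb'⟩
    have hb1 : (b : ℕ) < q := hb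
    have hb2 : (b' : ℕ) < q := hb'
    have h1 := hv ⟨b', hb2⟩ ⟨b, hb1⟩
    simp only [Set.domRestrict_apply, w, dif_pos hb1, dif_pos hb2]
    rw [EuclideanSpace.inner_toLp_toLp, dotProduct]
    refine h1.trans ?_
    simp [Matrix.one_apply, Fin.ext_iff, eq_comm]
  obtain ⟨e, he⟩ := hw.exists_orthonormalBasis_extension_of_card_eq (by simp)
  refine ⟨⟨Matrix.of fun a b => e b a, ?_⟩, fun a b => ?_⟩
  · rw [Matrix.mem_unitaryGroup_iff']
    ext b b'
    have h1 := orthonormal_iff_ite.1 e.orthonormal b b'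
    rw [PiLp.inner_apply] at h1
    simp only [Matrix.star_eq_conjTranspose, Matrix.mul_apply, Matrix.conjTranspose_apply,
      Matrix.of_apply, Matrix.one_apply]
    rw [← h1]
    exact Finset.sum_congr rfl fun a _ => by simp [mul_comm]
  · have h1 := he (Fin.castLE hqp b) b.2
    simp only [Matrix.of_apply, h1, w]
    have h2 : ((Fin.castLE hqp b : Fin p) : ℕ) < q := b.2
    rw [dif_pos h2]
    rfl

/-- Orthogonality of |z_j|² − 1 to 𝔨 provides the point of the polytope, and the arguments provide
the phases. The Gram condition makes the columns divided by √n_i orthonormal, and they are completed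
to a unitary matrix. -/
theorem levelMap_surjective (hn : ∀ i, 1 ≤ n i) (hkn : ∀ i, k i ≤ n i) {z : Idx d n k → ℂ}
    (hz : z ∈ Level ν n k) : ∃ p, levelMap (ν := ν) hkn p = z := by
  obtain ⟨hz1, hz2⟩ := (mem_level_iff z).1 hz
  obtain ⟨y, hy⟩ := exists_of_kerBeta_le hz1
  have h1 : ∀ j, 2 * ∑ l, (y l / 2) * (ν j l : ℝ) + 1 = Complex.normSq (z (Sum.inl j)) := by
    intro j
    have h2 : ∑ l, (y l / 2) * (ν j l : ℝ) = (∑ l, y l * (ν j l : ℝ)) / 2 := by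
      rw [Finset.sum_div]
      exact Finset.sum_congr rfl fun l _ => by ring
    rw [h2, ← hy j]
    ring
  have h2 : (fun l => y l / 2) ∈ monotonePolytope ν := fun j => by
    have := Complex.normSq_nonneg (z (Sum.inl j))
    have := h1 j
    linarith
  have hU : ∀ i, ∃ A : Matrix.unitaryGroup (Fin (n i)) ℂ, ∀ a b, A.1 a (Fin.castLE (hkn i) b) =
      (Real.sqrt (n i) : ℂ)⁻¹ * z (Sum.inr ⟨i, a, b⟩) := fun i => by
    refine exists_unitary_extension (hkn i)
      (v := fun b a => (Real.sqrt (n i) : ℂ)⁻¹ * z (Sum.inr ⟨i, a, b⟩)) fun b b' => ?_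
    have h3 := congrFun (congrFun (hz2 i) b) b'
    have hn0 : (n i : ℂ) ≠ 0 := by have := hn i; exact_mod_cast (by omega : n i ≠ 0)
    have h4 : (Real.sqrt (n i) : ℂ)⁻¹ * (Real.sqrt (n i) : ℂ)⁻¹ = (n i : ℂ)⁻¹ := by
      rw [← mul_inv, ← Complex.ofReal_mul, Real.mul_self_sqrt (Nat.cast_nonneg _),
        Complex.ofReal_natCast]
    calc ∑ a, (Real.sqrt (n i) : ℂ)⁻¹ * z (Sum.inr ⟨i, a, b⟩) *
          star ((Real.sqrt (n i) : ℂ)⁻¹ * z (Sum.inr ⟨i, a, b'⟩))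
        = (n i : ℂ)⁻¹ * gram z i b b' := by
          rw [gram, Matrix.of_apply, Finset.mul_sum, ← h4]
          refine Finset.sum_congr rfl fun a _ => ?_
          simp only [star_mul', star_inv₀, RCLike.star_def, Complex.conj_ofReal]
          ring
      _ = (1 : Matrix (Fin (k i)) (Fin (k i)) ℂ) b b' := by
          rw [h3, Matrix.smul_apply, smul_eq_mul, ← mul_assoc, inv_mul_cancel₀ hn0, one_mul]
  choose A hA using hU
  refine ⟨(fun j => Circle.exp (Complex.arg (z (Sum.inl j))), ⟨_, h2⟩, A), funext fun q => ?_⟩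
  rcases q with j | ⟨i, a, b⟩
  · simp only [levelMap, Sum.elim_inl, h1]
    rw [mul_comm, Circle.coe_exp, ← Complex.norm_def]
    exact Complex.norm_mul_exp_arg_mul_I _
  · have h3 : (Real.sqrt (n i) : ℂ) ≠ 0 := by
      have : (0 : ℝ) < n i := by exact_mod_cast hn i
      exact Complex.ofReal_ne_zero.2 (Real.sqrt_pos.2 this).ne'
    simp only [levelMap, Sum.elim_inr, hA]
    rw [mul_inv_cancel_left₀ h3]

theorem convex_monotonePolytope : Convex ℝ (monotonePolytope ν) := by
  intro x hx y hy s t hs ht hst j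
  have h1 : ∑ l, (s • x + t • y) l * (ν j l : ℝ) + 1 / 2 =
      s * (∑ l, x l * (ν j l : ℝ) + 1 / 2) + t * (∑ l, y l * (ν j l : ℝ) + 1 / 2) := by
    simp only [Pi.add_apply, Pi.smul_apply, smul_eq_mul, add_mul, Finset.sum_add_distrib, mul_add,
      Finset.mul_sum, mul_assoc]
    linear_combination (1 / 2 : ℝ) * (-hst)
  rw [h1]
  exact add_nonneg (mul_nonneg hs (hx j)) (mul_nonneg ht (hy j))

theorem compactSpace_connectedSpace_level (hν : IsMonotoneDelzant ν) (hn : ∀ i, 1 ≤ n i)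
    (hkn : ∀ i, k i ≤ n i) : CompactSpace (Level ν n k) ∧ ConnectedSpace (Level ν n k) := by
  have h1 : CompactSpace (monotonePolytope ν) := isCompact_iff_compactSpace.1 hν.compact
  have h2 : ConnectedSpace (monotonePolytope ν) := isConnected_iff_connectedSpace.1
    ⟨⟨0, zero_mem_monotonePolytope⟩, convex_monotonePolytope.isPreconnected⟩
  have hcirc : ConnectedSpace Circle :=
    Function.Surjective.connectedSpace (f := Circle.exp) (fun z => ⟨_, Circle.exp_arg z⟩)
      Circle.exp.continuous
  let f : (Fin d → Circle) × monotonePolytope ν × (∀ i, Matrix.unitaryGroup (Fin (n i)) ℂ) →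
      Level ν n k := fun p => ⟨levelMap hkn p, levelMap_mem hkn p⟩
  have hf : Continuous f := continuous_induced_rng.2 (continuous_levelMap hkn)
  have hs : Function.Surjective f := fun z => by
    obtain ⟨p, hp⟩ := levelMap_surjective hn hkn z.2
    exact ⟨p, Subtype.ext hp⟩
  exact ⟨hs.compactSpace hf, hs.connectedSpace hf⟩

/-! ### The quotients are Hausdorff -/

/-- The orbit relation is the image of the compact set K × Level under (g, z) ↦ (g•z, z), hence
closed, which suffices for an open quotient map. It serves for `G` and for G_0^τ, the latter being
closed as the kernel of a continuous character. -/
theorem t2Space_of_orbits {X : Type*} [TopologicalSpace X] [CompactSpace (Level ν n k)]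
    {q : Level ν n k → X} (hq : IsOpenQuotientMap q) {K : Set (G ν k)} (hK : IsCompact K)
    (h : ∀ z z', q z = q z' ↔ ∃ g ∈ K, g • z' = z) : T2Space X := by
  rw [t2Space_iff_of_isOpenQuotientMap hq]
  have h1 : {p : Level ν n k × Level ν n k | q p.1 = q p.2} =
      (fun p : G ν k × Level ν n k => (p.1 • p.2, p.2)) '' (K ×ˢ Set.univ) := by
    ext ⟨z, z'⟩
    refine (h z z').trans ⟨fun ⟨g, hg, hz⟩ => ⟨(g, z'), ⟨hg, trivial⟩, by rw [← hz]⟩, ?_⟩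
    rintro ⟨⟨g, y⟩, ⟨hg, -⟩, hy⟩
    obtain ⟨rfl, rfl⟩ := Prod.mk.inj hy
    exact ⟨g, hg, rfl⟩
  rw [h1]
  exact ((hK.prod isCompact_univ).image
    (continuous_smul.prodMk continuous_snd)).isClosed

theorem t2Space_base (hν : IsMonotoneDelzant ν) [CompactSpace (Level ν n k)] :
    T2Space (Base ν n k) := by
  have := compactSpace_G (k := k) hν
  exact t2Space_of_orbits isOpenQuotientMap_toBase isCompact_univ fun z z' =>
    toBase_eq_iff.trans (by simp)

theorem t2Space_totalSpace (hν : IsMonotoneDelzant ν) [CompactSpace (Level ν n k)]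
    {a : Fin d → ℤ} {b : Fin r → ℤ} (hker : (character ν k a b).ker = G0tau ν n k) :
    T2Space (TotalSpace ν n k) := by
  have := compactSpace_G (k := k) hν
  refine t2Space_of_orbits isOpenQuotientMap_toTotalSpace (K := G0tau ν n k) ?_
    fun z z' => toTotalSpace_eq_iff
  rw [← hker]
  exact (isClosed_singleton.preimage (continuous_character a b)).isCompact

end Topology

end ToricGrassmann

/-! ### Basic forms can be recognized in charts -/

section BasicForms

open Filter Topology

variable {E X : Type} [NormedAddCommGroup E] [NormedSpace ℝ E] {Z : Set E}

theorem ContMDiffAt.mfderiv_eq_fderiv {E' N : Type} [NormedAddCommGroup E'] [NormedSpace ℝ E']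
    [TopologicalSpace N] [ChartedSpace E' N] {f : N → E} {y : N}
    (hf : ContMDiffAt 𝓘(ℝ, E') 𝓘(ℝ, E) ∞ f y) :
    ContDiffAt ℝ ∞ (fun t => f ((extChartAt 𝓘(ℝ, E') y).symm t)) (extChartAt 𝓘(ℝ, E') y y) ∧
    mfderiv 𝓘(ℝ, E') 𝓘(ℝ, E) f y =
      fderiv ℝ (fun t => f ((extChartAt 𝓘(ℝ, E') y).symm t)) (extChartAt 𝓘(ℝ, E') y y) := by
  have h1 := (contMDiffAt_iff.1 hf).2
  have h2 := (hf.mdifferentiableAt (by simp)).mfderiv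
  simp only [writtenInExtChartAt, ModelWithCorners.range_eq_univ, fderivWithin_univ,
    extChartAt_model_space_eq_id, PartialEquiv.refl_coe, Function.id_comp,
    contDiffWithinAt_univ] at h1 h2
  exact ⟨h1, h2⟩

/-- Reading both lifts in the chart of the source manifold at `y` reduces basicness to maps from
normed spaces and ordinary derivatives. -/
theorem isBasicForm_of_fderiv {n : ℕ} {q : Z → X} {β : E → E [⋀^Fin n]→L[ℝ] ℝ}
    (h : ∀ (E' : Type) [NormedAddCommGroup E'] [NormedSpace ℝ E'] (g₁ g₂ : E' → Z) (y : E'),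
      ContDiffAt ℝ ∞ (fun t => (g₁ t : E)) y → ContDiffAt ℝ ∞ (fun t => (g₂ t : E)) y →
      (∀ᶠ t in 𝓝 y, q (g₁ t) = q (g₂ t)) → ∀ v : Fin n → E',
      β (g₁ y) (fun i => fderiv ℝ (fun t => (g₁ t : E)) y (v i)) =
        β (g₂ y) (fun i => fderiv ℝ (fun t => (g₂ t : E)) y (v i))) : IsBasicForm q β := by
  intro E' N _ _ _ _ g₁ g₂ y h₁ h₂ hq
  obtain ⟨h₁', hd₁⟩ := h₁.mfderiv_eq_fderiv
  obtain ⟨h₂', hd₂⟩ := h₂.mfderiv_eq_fderiv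
  have hc : Tendsto (extChartAt 𝓘(ℝ, E') y).symm (𝓝 (extChartAt 𝓘(ℝ, E') y y)) (𝓝 y) := by
    have := continuousAt_extChartAt_symm (I := 𝓘(ℝ, E')) y
    rwa [ContinuousAt, extChartAt_to_inv] at this
  rw [hd₁, hd₂]
  ext v
  have := h E' (fun t => g₁ ((extChartAt 𝓘(ℝ, E') y).symm t))
    (fun t => g₂ ((extChartAt 𝓘(ℝ, E') y).symm t)) (extChartAt 𝓘(ℝ, E') y y) h₁' h₂' (hc hq) v
  rw [extChartAt_to_inv] at this
  exact this

end BasicForms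

namespace ToricGrassmann

section Forms

open Filter Topology

attribute [local instance] Matrix.linftyOpNormedRing Matrix.linftyOpNormedAlgebra

variable {m d r : ℕ} {ν : Fin d → Fin m → ℤ} {n k : Fin r → ℕ}

/-! ### The Liouville form and the symplectic form of the vector space -/

/-- The Liouville form as a differential form. -/
noncomputable def liouvilleForm (ι : Type) [Fintype ι] : (ι → ℂ) → (ι → ℂ) [⋀^Fin 1]→L[ℝ] ℝ :=
  fun z => ContinuousAlternatingMap.ofSubsingleton ℝ (ι → ℂ) ℝ (0 : Fin 1) ((1 / 2 : ℝ) • omega ι z)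

theorem liouvilleForm_apply {ι : Type} [Fintype ι] (z : ι → ℂ) (v : Fin 1 → ι → ℂ) :
    liouvilleForm ι z v = 1 / 2 * omega ι z (v 0) := rfl

theorem contDiff_liouvilleForm_apply {ι : Type} [Fintype ι] :
    ContDiff ℝ ∞ fun p : (ι → ℂ) × (Fin 1 → ι → ℂ) => liouvilleForm ι p.1 p.2 := by
  simp only [liouvilleForm_apply]
  exact contDiff_const.mul (((omega ι).contDiff.comp contDiff_fst).clm_apply
    ((contDiff_apply ℝ (ι → ℂ) (0 : Fin 1)).comp contDiff_snd))

theorem contDiff_liouvilleForm {ι : Type} [Fintype ι] : ContDiff ℝ ∞ (liouvilleForm ι) := by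
  refine contDiffOn_univ.1 (contDiffOn_alternating_of_apply fun v => ?_)
  exact (contDiff_liouvilleForm_apply.comp (contDiff_id.prodMk contDiff_const)).contDiffOn

theorem extDeriv_liouvilleForm {ι : Type} [Fintype ι] (z : ι → ℂ) (v : Fin 2 → ι → ℂ) :
    extDeriv (liouvilleForm ι) z v = omega ι (v 0) (v 1) := by
  have hd : ∀ (u w : ι → ℂ), fderiv ℝ (liouvilleForm ι) z u (fun _ => w) = 1 / 2 * omega ι u w := by
    intro u w
    have h1 : HasFDerivAt (liouvilleForm ι) (fderiv ℝ (liouvilleForm ι) z) z :=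
      ((contDiff_liouvilleForm (ι := ι)).differentiable (by simp)).differentiableAt.hasFDerivAt
    have h2 := (ContinuousAlternatingMap.apply ℝ (ι → ℂ) ℝ (fun _ : Fin 1 => w)).hasFDerivAt.comp z h1
    have h3 : HasFDerivAt (fun z => 1 / 2 * omega ι z w) ((1 / 2 : ℝ) • (omega ι).flip w) z :=
      ((omega ι).flip w).hasFDerivAt.const_mul (1 / 2 : ℝ)
    exact congrArg (fun T => T u) (h2.unique h3)
  have h0 : Fin.removeNth 0 v = fun _ => v 1 := funext fun i => by
    rw [Subsingleton.elim i 0]; rfl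
  have h1 : Fin.removeNth 1 v = fun _ => v 0 := funext fun i => by
    rw [Subsingleton.elim i 0]; rfl
  rw [extDeriv, ContinuousAlternatingMap.alternatizeUncurryFin_apply, Fin.sum_univ_two, h0, h1, hd, hd,
    omega_swap (v 1)]
  simp
  ring

theorem contDiff_extDeriv_liouvilleForm_apply {ι : Type} [Fintype ι] :
    ContDiff ℝ ∞ fun p : (ι → ℂ) × (Fin 2 → ι → ℂ) => extDeriv (liouvilleForm ι) p.1 p.2 := by
  simp only [extDeriv_liouvilleForm]
  exact ((omega ι).contDiff.comp ((contDiff_apply ℝ (ι → ℂ) (0 : Fin 2)).comp contDiff_snd)).clm_apply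
    ((contDiff_apply ℝ (ι → ℂ) (1 : Fin 2)).comp contDiff_snd)

theorem extDeriv_extDeriv_liouvilleForm {ι : Type} [Fintype ι] :
    extDeriv (extDeriv (liouvilleForm ι)) = 0 :=
  extDeriv_extDeriv contDiff_liouvilleForm (by simpa using WithTop.coe_le_coe.2 (le_top : (2 : ℕ∞) ≤ ⊤))

/-! ### Tangent vectors of the level set and of the orbits -/

theorem omega_act_coords (g : G ν k) (u v : Idx d n k → ℂ) :
    omega _ (act n k (coords ν k g) u) (act n k (coords ν k g) v) = omega _ u v := by
  have h1 : ∀ w, act n k (coords ν k g) w = embed ν n k g *ᵥ w := fun w => rfl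
  simp only [omega_apply, h1, stdSymplectic, Matrix.star_mulVec, Matrix.dotProduct_mulVec,
    Matrix.vecMul_vecMul, embed_conjTranspose_mul, Matrix.vecMul_one]

theorem omega_fderiv_eq_zero {E' : Type} [NormedAddCommGroup E'] [NormedSpace ℝ E']
    {g : E' → Level ν n k} {y : E'} (hg : DifferentiableAt ℝ (fun t => (g t : Idx d n k → ℂ)) y)
    (u : E') (X : lieG ν k) :
    omega _ (fderiv ℝ (fun t => (g t : Idx d n k → ℂ)) y u) (act n k (lieCoords ν k X) (g y)) = 0 := by
  have h1 := HasFDerivAt.comp (g := fun z => momentMap ν n k z X) y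
    (hasFDerivAt_momentMap (n := n) X (g y)) hg.hasFDerivAt
  have h2 : ((fun z => momentMap ν n k z X) ∘ fun t => (g t : Idx d n k → ℂ)) =
      fun _ => momentValue ν n k X := funext fun t => LinearMap.congr_fun (g t).2 X
  rw [h2] at h1
  exact congrArg (fun T => T u) (h1.unique (hasFDerivAt_const _ _))

/-- The derivatives of two maps to the level set whose values lie in the same orbits. -/
theorem exists_fderiv_eq (hν : IsMonotoneDelzant ν) (hn : ∀ i, 1 ≤ n i) {E' : Type}
    [NormedAddCommGroup E'] [NormedSpace ℝ E'] {g₁ g₂ : E' → Level ν n k} {y : E'}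
    (h₁ : ContDiffAt ℝ ∞ (fun t => (g₁ t : Idx d n k → ℂ)) y)
    (h₂ : ContDiffAt ℝ ∞ (fun t => (g₂ t : Idx d n k → ℂ)) y) {K : Set (G ν k)}
    (hK : ∀ᶠ t in 𝓝 y, ∃ h ∈ K, h • g₂ t = g₁ t) :
    ∃ h ∈ K, g₁ y = h • g₂ y ∧ ∀ u, ∃ X : lieG ν k,
      IsTangentTo K h (lieCoords ν k X * coords ν k h) ∧
      fderiv ℝ (fun t => (g₁ t : Idx d n k → ℂ)) y u = act n k (lieCoords ν k X) (g₁ y) +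
        act n k (coords ν k h) (fderiv ℝ (fun t => (g₂ t : Idx d n k → ℂ)) y u) := by
  obtain ⟨P, hP, -⟩ := exists_isTorusRetraction hν zero_mem_monotonePolytope
  obtain ⟨c, -, ⟨S⟩⟩ := exists_slice hν hn (g₂ y)
  -- By equivariance of Γ this is the only group element that can carry g₂ t to g₁ t. So it lies in
  -- `K` near `y`, and it is smooth in t; the product rule for h(t)·g₂(t) then gives the formula.
  let h : E' → G ν k := fun t => S.Γ (g₁ t) * (S.Γ (g₂ t))⁻¹
  have hO₂ : ∀ᶠ t in 𝓝 y, (g₂ t : Idx d n k → ℂ) ∈ S.O :=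
    h₂.continuousAt.eventually_mem (S.isOpen_O.mem_nhds S.self_mem_O)
  have hev : ∀ᶠ t in 𝓝 y, h t ∈ K ∧ g₁ t = h t • g₂ t ∧ (g₁ t : Idx d n k → ℂ) ∈ S.O := by
    filter_upwards [hO₂, hK] with t ht ⟨h', hh', hht⟩
    have h1 : (g₁ t : Idx d n k → ℂ) = act n k (coords ν k h') (g₂ t) := by rw [act_coords, hht]
    have h2 : h t = h' := by
      simp only [h, h1, S.Γ_act h' _ ht, mul_inv_cancel_right]
    rw [h2]
    exact ⟨hh', hht.symm, h1 ▸ S.act_mem h' _ ht⟩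
  obtain ⟨hyK, hy, hyO⟩ := hev.self_of_nhds
  have hΓ₁ : ContDiffAt ℝ ∞ (fun t => coords ν k (S.Γ (g₁ t))) y :=
    ContDiffAt.comp (g := fun z => coords ν k (S.Γ z)) y
      (S.contDiffOn_Γ.contDiffAt (S.isOpen_O.mem_nhds hyO)) h₁
  have hΓ₂ : ContDiffAt ℝ ∞ (fun t => coords ν k (S.Γ (g₂ t))) y :=
    ContDiffAt.comp (g := fun z => coords ν k (S.Γ z)) y
      (S.contDiffOn_Γ.contDiffAt (S.isOpen_O.mem_nhds S.self_mem_O)) h₂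
  have hh : ContDiffAt ℝ ∞ (fun t => coords ν k (h t)) y := by
    have h1 : (fun t => coords ν k (h t)) =
        fun t => coords ν k (S.Γ (g₁ t)) * starCoords (coords ν k (S.Γ (g₂ t))) := funext fun t => by
      rw [starCoords_coords, ← map_mul]
    rw [h1]
    exact hΓ₁.mul (starCoords.contDiff.contDiffAt.comp y hΓ₂)
  have hhd := (hh.differentiableAt (by simp)).hasFDerivAt
  refine ⟨h y, hyK, hy, fun u => ?_⟩
  have htan : IsTangentTo K (h y) (fderiv ℝ (fun t => coords ν k (h t)) y u) := by
    intro f hf hfK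
    have h1 := HasFDerivAt.comp (g := f) y hf.hasFDerivAt hhd
    have h2 : HasFDerivAt (f ∘ fun t => coords ν k (h t)) (0 : E' →L[ℝ] ℂ) y := by
      refine (hasFDerivAt_const (0 : ℂ) y).congr_of_eventuallyEq ?_
      filter_upwards [hev] with t ht using hfK _ ht.1
    exact congrArg (fun T => T u) (h1.unique h2)
  obtain ⟨X, hX⟩ := htan.exists_lieCoords hP
  refine ⟨X, hX ▸ htan, ?_⟩
  have h1 : HasFDerivAt (fun t => act n k (coords ν k (h t)) (g₂ t)) _ y :=
    (act n k).hasFDerivAt_of_bilinear hhd (h₂.differentiableAt (by simp)).hasFDerivAt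
  have h2 : (fun t => (g₁ t : Idx d n k → ℂ)) =ᶠ[𝓝 y] fun t => act n k (coords ν k (h t)) (g₂ t) := by
    filter_upwards [hev] with t ht
    rw [act_coords, ← ht.2.1]
  have h3 := congrArg (fun T => T u) (h1.congr_of_eventuallyEq h2).fderiv
  refine h3.trans ?_
  rw [hy, ← act_coords, ← act_mul, ← hX, add_comm]
  rfl

/-- The extended character minus 1 is a test function vanishing on the kernel; its derivative is
computed along the one-parameter group of X. -/
theorem IsTangentTo.characterDeriv_eq_zero {a : Fin d → ℤ} {b : Fin r → ℤ} {h : G ν k}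
    (hh : h ∈ (character ν k a b).ker) {X : lieG ν k}
    (hX : IsTangentTo ((character ν k a b).ker : Set (G ν k)) h (lieCoords ν k X * coords ν k h)) :
    characterDeriv ν k a b X = 0 := by
  have hd : DifferentiableAt ℝ (characterExt a b) (coords ν k h) :=
    (contDiffAt_characterExt a b h).differentiableAt (by simp)
  have h1 := hX (fun c => characterExt a b c - 1) (hd.sub_const 1) fun g hg => by
    have : character ν k a b g = 1 := hg
    rw [characterExt_coords, this, Circle.coe_one, sub_self]
  replace h1 := (congrArg (fun T => T (lieCoords ν k X * coords ν k h))
    (hd.hasFDerivAt.sub_const (1 : ℂ)).fderiv).symm.trans h1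
  obtain ⟨c, hc0, -, -, hc, hχ⟩ := exists_oneParam X
  have h2 : HasDerivAt (fun s => coords ν k (c s) * coords ν k h)
      (lieCoords ν k X * coords ν k h) 0 := hc.mul_const _
  have h3 := hd.hasFDerivAt
  have h0 : coords ν k (c 0) * coords ν k h = coords ν k h := by rw [hc0, map_one, one_mul]
  rw [← h0] at h3
  have h4 := h3.comp_hasDerivAt (0 : ℝ) h2
  rw [h0, h1] at h4
  have h5 : (characterExt a b ∘ fun s => coords ν k (c s) * coords ν k h) =
      fun s => (Circle.exp (s * characterDeriv ν k a b X) : ℂ) := funext fun s => by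
    have : character ν k a b h = 1 := hh
    rw [Function.comp_apply, ← map_mul, characterExt_coords, map_mul, this, mul_one, hχ]
  rw [h5] at h4
  have h6 := (hasDerivAt_circle_exp (characterDeriv ν k a b X) 0).unique h4
  simpa using h6

/-- Here the level p enters: on an orbit direction Xz the Liouville form equals p(X). -/
theorem momentMap_eq_characterDeriv (z : Level ν n k) (X : lieG ν k) :
    1 / 2 * omega _ z.1 (act n k (lieCoords ν k X) z) =
      1 / 2 * characterDeriv ν k 1 (fun i => n i) X :=
  (LinearMap.congr_fun z.2 X).trans (trace_lieEmbed X)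

/-- Two lifts differ by an element of G_0^τ, which preserves the form, and by an orbit direction Xz
with X tangent to the kernel of θ. On the latter the form is p(X), a multiple of the derivative of
θ, hence zero. -/
theorem isBasicForm_liouvilleForm (hν : IsMonotoneDelzant ν) (hn : ∀ i, 1 ≤ n i)
    {a : Fin d → ℤ} {b : Fin r → ℤ} (hker : (character ν k a b).ker = G0tau ν n k) {c : ℝ}
    (hc : ∀ X, characterDeriv ν k 1 (fun i => n i) X = c * characterDeriv ν k a b X) :
    IsBasicForm (toTotalSpace ν n k) (liouvilleForm (Idx d n k)) := by
  refine isBasicForm_of_fderiv fun E' _ _ g₁ g₂ y h₁ h₂ hq v => ?_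
  have hK : ∀ᶠ t in 𝓝 y, ∃ h ∈ (character ν k a b).ker, h • g₂ t = g₁ t := by
    filter_upwards [hq] with t ht
    rw [hker]
    exact toTotalSpace_eq_iff.1 ht
  obtain ⟨h, hhK, hhy, hd⟩ := exists_fderiv_eq hν hn h₁ h₂ (K := (character ν k a b).ker) hK
  obtain ⟨X, hX, hXu⟩ := hd (v 0)
  rw [liouvilleForm_apply, liouvilleForm_apply, hXu, map_add, mul_add, momentMap_eq_characterDeriv,
    hc, hX.characterDeriv_eq_zero hhK, hhy, ← act_coords, omega_act_coords]
  simp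

/-- Two lifts differ by an element of `G` and by orbit directions. `G` preserves ω, and orbit
directions are ω-orthogonal to every vector tangent to the level set. -/
theorem isBasicForm_extDeriv_liouvilleForm (hν : IsMonotoneDelzant ν) (hn : ∀ i, 1 ≤ n i) :
    IsBasicForm (toBase ν n k) (extDeriv (liouvilleForm (Idx d n k))) := by
  refine isBasicForm_of_fderiv fun E' _ _ g₁ g₂ y h₁ h₂ hq v => ?_
  have hK : ∀ᶠ t in 𝓝 y, ∃ h ∈ (Set.univ : Set (G ν k)), h • g₂ t = g₁ t := by
    filter_upwards [hq] with t ht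
    simpa using toBase_eq_iff.1 ht
  obtain ⟨h, -, hhy, hd⟩ := exists_fderiv_eq hν hn h₁ h₂ hK
  obtain ⟨X, -, hXu⟩ := hd (v 0)
  obtain ⟨Y, -, hYu⟩ := hd (v 1)
  have hd₁ := h₁.differentiableAt (by simp : (∞ : WithTop ℕ∞) ≠ 0)
  have h1 := omega_fderiv_eq_zero hd₁ (v 0) Y
  have h2 := omega_fderiv_eq_zero hd₁ (v 1) X
  have h3 := omega_act_eq_zero (g₁ y).2 X Y
  rw [hXu, map_add, _root_.add_apply, h3, zero_add] at h1
  rw [hYu, map_add, _root_.add_apply, omega_swap, h3, neg_zero, zero_add,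
    omega_swap, neg_eq_zero] at h2
  rw [extDeriv_liouvilleForm, extDeriv_liouvilleForm, hXu, hYu]
  simp only [map_add, _root_.add_apply, h1, h2, h3, omega_act_coords, zero_add, add_zero]

end Forms

end ToricGrassmann

/-! ### Smooth maps to and from the circle -/

section CircleMaps

open Filter Topology

variable {E' H N : Type*} [NormedAddCommGroup E'] [NormedSpace ℝ E'] [TopologicalSpace H]
  {I : ModelWithCorners ℝ E' H} [TopologicalSpace N] [ChartedSpace H N]

theorem contMDiff_circle_coe : ContMDiff (𝓡 1) 𝓘(ℝ, ℂ) ∞ (fun a : Circle => (a : ℂ)) := by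
  have := finrank_real_complex_fact'
  exact contMDiff_coe_sphere (E := ℂ) (n := 1) (m := ∞)

/-- The angle between a complex number of modulus one and `a₀`. -/
theorem contDiffAt_angle (a₀ : Circle) :
    ContDiffAt ℝ ∞ (fun w : ℂ => (Complex.log (w * (a₀⁻¹ : Circle))).im) a₀ := by
  have h1 : ContDiffAt ℝ ∞ Complex.log ((a₀ : ℂ) * (a₀⁻¹ : Circle)) := by
    rw [← Circle.coe_mul, mul_inv_cancel, Circle.coe_one]
    exact (Complex.contDiffAt_log Complex.one_mem_slitPlane).restrict_scalars ℝ
  exact Complex.imCLM.contDiff.contDiffAt.comp _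
    (ContDiffAt.comp (f := fun w : ℂ => w * (a₀⁻¹ : Circle)) (a₀ : ℂ) h1
      (contDiff_id.mul contDiff_const).contDiffAt)

theorem exp_angle (a₀ a : Circle) :
    Circle.exp (Complex.log ((a : ℂ) * (a₀⁻¹ : Circle))).im * a₀ = a := by
  rw [← Circle.coe_mul, Complex.log_im, Circle.exp_arg, inv_mul_cancel_right]

/-- Near `x` the map is the exponential of a smooth angle measured from `f x`, so smoothness into
the circle may be tested in ℂ. -/
theorem contMDiffAt_circle {f : N → Circle} {x : N}
    (hf : ContMDiffAt I 𝓘(ℝ, ℂ) ∞ (fun y => (f y : ℂ)) x) : ContMDiffAt I (𝓡 1) ∞ f x := by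
  have h1 : f = fun y => Circle.exp
      ((Complex.log ((f y : ℂ) * ((f x)⁻¹ : Circle))).im + Complex.arg (f x)) := funext fun y => by
    rw [Circle.exp_add, Circle.exp_arg, exp_angle]
  rw [h1]
  have h2 : ContMDiffAt I 𝓘(ℝ, ℝ) ∞
      (fun y => (Complex.log ((f y : ℂ) * ((f x)⁻¹ : Circle))).im + Complex.arg (f x)) x :=
    ContMDiffAt.comp (I' := 𝓘(ℝ, ℂ)) x
      (g := fun w : ℂ => (Complex.log (w * ((f x)⁻¹ : Circle))).im + Complex.arg (f x))
      (f := fun y => (f y : ℂ))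
      ((contDiffAt_angle (f x)).add contDiffAt_const).contMDiffAt hf
  exact contMDiff_circleExp.contMDiffAt.comp x h2

end CircleMaps

namespace ToricGrassmann

section CircleAction

open Filter Topology

attribute [local instance] Matrix.linftyOpNormedRing Matrix.linftyOpNormedAlgebra

variable {m d r : ℕ} {ν : Fin d → Fin m → ℤ} {n k : Fin r → ℕ}
  {F F₀ F₁ : Type} [NormedAddCommGroup F] [NormedSpace ℝ F]
  [NormedAddCommGroup F₀] [NormedSpace ℝ F₀] [NormedAddCommGroup F₁] [NormedSpace ℝ F₁]

theorem proj_toTotalSpace (z : Level ν n k) :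
    proj ν n k (toTotalSpace ν n k z) = toBase ν n k z := rfl

/-- The action of `G / G_0^τ` on the total space. -/
theorem exists_circleAction {θ : G ν k →* Circle} (hθ : Function.Surjective θ)
    (hker : θ.ker = G0tau ν n k) : ∃ _ : MulAction Circle (TotalSpace ν n k),
      ∀ (g : G ν k) (z : Level ν n k), θ g • toTotalSpace ν n k z = toTotalSpace ν n k (g • z) := by
  have hs := (isOpenQuotientMap_toTotalSpace (ν := ν) (n := n) (k := k)).surjective
  let sm : Circle → TotalSpace ν n k → TotalSpace ν n k := fun a v =>
    toTotalSpace ν n k (Function.surjInv hθ a • Function.surjInv hs v)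
  have hsm : ∀ g z, sm (θ g) (toTotalSpace ν n k z) = toTotalSpace ν n k (g • z) := by
    intro g z
    obtain ⟨h, hh, hz⟩ := toTotalSpace_eq_iff.1 (Function.surjInv_eq hs (toTotalSpace ν n k z))
    rw [toTotalSpace_eq_iff]
    refine ⟨Function.surjInv hθ (θ g) * h * g⁻¹, ?_, ?_⟩
    · rw [← hker, MonoidHom.mem_ker] at hh ⊢
      rw [map_mul, map_mul, hh, Function.surjInv_eq hθ, mul_one, map_inv, mul_inv_cancel]
    · rw [smul_smul, inv_mul_cancel_right, mul_smul, hz]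
  refine ⟨{ smul := sm, mul_smul := fun a b v => ?_, one_smul := fun v => ?_ }, hsm⟩
  · obtain ⟨z, rfl⟩ := hs v
    obtain ⟨g, rfl⟩ := hθ a
    obtain ⟨h, rfl⟩ := hθ b
    change sm (θ g * θ h) _ = sm (θ g) (sm (θ h) _)
    rw [← map_mul, hsm (g * h), hsm h, hsm g, mul_smul]
  · obtain ⟨z, rfl⟩ := hs v
    have h1 := hsm 1 z
    rw [map_one, one_smul] at h1
    exact h1

/-! ### The symplectic form of the base -/

/-- The double ω-orthogonal of the space of orbit directions is that space itself: a functional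
vanishing on the common kernel of finitely many functionals is a combination of them, and ω is
nondegenerate. -/
theorem exists_lieCoords_of_omega {z u : Idx d n k → ℂ}
    (hu : ∀ v, (∀ X : lieG ν k, omega _ v (act n k (lieCoords ν k X) z) = 0) → omega _ u v = 0) :
    ∃ X : lieG ν k, u = act n k (lieCoords ν k X) z := by
  let b := Module.finBasis ℝ (lieG ν k)
  have h1 : (omega (Idx d n k) u).toLinearMap ∈ Submodule.span ℝ
      (Set.range fun i => (omega (Idx d n k) (act n k (lieCoords ν k (b i)) z)).toLinearMap) := by
    refine mem_span_of_iInf_ker_le_ker fun v hv => hu v fun X => ?_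
    rw [Submodule.mem_iInf] at hv
    rw [omega_swap, neg_eq_zero, ← b.sum_repr X]
    simp only [map_sum, map_smul, FunLike.coe_sum, Finset.sum_apply, FunLike.coe_smul, Pi.smul_apply]
    exact Finset.sum_eq_zero fun i _ => by
      have h2 : omega _ (act n k (lieCoords ν k (b i)) z) v = 0 := hv i
      rw [h2, smul_zero]
  obtain ⟨c, hc⟩ := (Submodule.mem_span_range_iff_exists_fun ℝ).1 h1
  refine ⟨∑ i, c i • b i, sub_eq_zero.1 (eq_zero_of_omega fun v => ?_)⟩
  have h2 : ∑ i, c i * omega _ (act n k (lieCoords ν k (b i)) z) v = omega _ u v := by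
    simpa using LinearMap.congr_fun hc v
  rw [map_sub, _root_.sub_apply, ← h2, sub_eq_zero]
  simp only [map_sum, map_smul, FunLike.coe_sum, Finset.sum_apply, FunLike.coe_smul, Pi.smul_apply,
    smul_eq_mul]

theorem contDiff_act_coords {c : ℝ → G ν k} (hc : ContDiff ℝ ∞ fun s => coords ν k (c s)) :
    ContDiff ℝ ∞ fun p : ℝ × (Idx d n k → ℂ) => act n k (coords ν k (c p.1)) p.2 :=
  ((act n k).contDiff.comp (hc.comp contDiff_fst)).clm_apply contDiff_snd

theorem hasDerivAt_orbit {c : ℝ → G ν k} {X : lieG ν k}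
    (hc : HasDerivAt (fun s => coords ν k (c s)) (lieCoords ν k X) 0) (z : Level ν n k) :
    HasDerivAt (fun s => ((c s • z : Level ν n k) : Idx d n k → ℂ))
      (act n k (lieCoords ν k X) z) 0 :=
  hasDerivAt_act hc (z : Idx d n k → ℂ)

theorem contDiff_orbit {c : ℝ → G ν k} (hc : ContDiff ℝ ∞ fun s => coords ν k (c s))
    (z : Level ν n k) : ContDiff ℝ ∞ fun s => ((c s • z : Level ν n k) : Idx d n k → ℂ) := by
  simp only [← act_coords]
  exact ((act n k).contDiff.comp hc).clm_apply contDiff_const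

/-- A vector in the radical lifts to one that is ω-orthogonal to the tangent space of the level set.
By the double orthogonal it is an orbit direction, which the projection to the base kills. -/
theorem form_nondegenerate [ChartedSpace F₀ (Level ν n k)] [ChartedSpace F (Base ν n k)]
    (hν : IsMonotoneDelzant ν) (hn : ∀ i, 1 ≤ n i)
    (hZ : IsSmoothQuotient F₀ (id : Level ν n k → Level ν n k))
    (h : IsSmoothQuotient F (toBase ν n k)) {a : ℕ}
    (ha : Module.finrank ℝ (Idx d n k → ℂ) = Module.finrank ℝ (lieG ν k) + a)
    (x : Base ν n k) (u : TangentSpace 𝓘(ℝ, F) x)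
    (hu : ∀ v : TangentSpace 𝓘(ℝ, F) x,
      h.form (extDeriv (liouvilleForm (Idx d n k))) x ![u, v] = 0) : u = 0 := by
  obtain ⟨z, rfl⟩ := h.isOpenQuotientMap.surjective x
  obtain ⟨U, rfl⟩ := hZ.mfderiv_quot_surjective h z u
  let dval : ∀ z' : Level ν n k, F₀ → (Idx d n k → ℂ) :=
    fun z' U => mfderiv 𝓘(ℝ, F₀) 𝓘(ℝ, Idx d n k → ℂ) (Subtype.val : Level ν n k → _) z' U
  let dq : ∀ z' : Level ν n k, F₀ → F := fun z' U => mfderiv 𝓘(ℝ, F₀) 𝓘(ℝ, F) (toBase ν n k) z' U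
  have h1 : ∀ V : F₀, omega _ (dval z U) (dval z V) = 0 := by
    intro V
    have h2 := hZ.form_quot_apply h (isBasicForm_extDeriv_liouvilleForm hν hn) z ![U, V]
    refine (extDeriv_liouvilleForm z.1 (fun i => dval z ((![U, V] : Fin 2 → F₀) i))).symm.trans
      (h2.symm.trans (Eq.trans ?_ (hu (dq z V))))
    congr 1
    funext i
    fin_cases i <;> rfl
  obtain ⟨C, hzC, hCz, hCd⟩ := exists_levelChart hν hn ha z
  obtain ⟨X, hX⟩ := exists_lieCoords_of_omega (ν := ν) (z := z.1) (u := dval z U) fun v hv => by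
    obtain ⟨w, hw⟩ := hCd v hv
    have h2 : ContDiffAt ℝ ∞ (fun w => (C.lift w : Idx d n k → ℂ)) (C.coord z) :=
      C.contDiffOn_lift.contDiffAt (C.isOpen_cod.mem_nhds (C.coord_mem z hzC))
    have h3 := hZ.mfderiv_val_comp (g := C.lift) h2.contMDiffAt w
    rw [mfderiv_eq_fderiv] at h3
    have h4 : ∃ V, dval z V = v := by
      rw [← hCz]
      exact ⟨_, h3.trans hw⟩
    obtain ⟨V, rfl⟩ := h4
    exact h1 V
  obtain ⟨c, hc0, -, hcs, hcd, -⟩ := exists_oneParam X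
  have hγ : ContMDiffAt 𝓘(ℝ, ℝ) 𝓘(ℝ, Idx d n k → ℂ) ∞
      (fun s => ((c s • z : Level ν n k) : Idx d n k → ℂ)) (0 : ℝ) :=
    (contDiff_orbit hcs z).contDiffAt.contMDiffAt
  -- The velocity of the orbit curve c(s)•z, along which the projection to the base is constant.
  have h5 : ∃ U', dval z U' = act n k (lieCoords ν k X) z ∧ dq z U' = 0 := by
    have h6 := hZ.mfderiv_val_comp hγ (1 : ℝ)
    rw [mfderiv_eq_fderiv] at h6
    have h7 := hZ.mfderiv_quot_comp h hγ (1 : ℝ)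
    have h8 : (fun s => toBase ν n k (c s • z)) = fun _ => toBase ν n k z :=
      funext fun s => toBase_eq_iff.2 ⟨c s, rfl⟩
    rw [h8, mfderiv_const] at h7
    have hz : c 0 • z = z := by rw [hc0, one_smul]
    have h9 : ∃ U', dval (c 0 • z) U' = act n k (lieCoords ν k X) z ∧ dq (c 0 • z) U' = 0 :=
      ⟨_, h6.trans (hasDerivAt_orbit hcd z).deriv, h7⟩
    rwa [hz] at h9
  obtain ⟨U', hU', hq⟩ := h5
  have h6 : U = U' := hZ.mfderiv_val_injective z (hX.trans hU'.symm)
  subst h6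
  exact hq

end CircleAction

end ToricGrassmann

namespace ToricGrassmann

section PrincipalBundle

open Filter Topology

attribute [local instance] Matrix.linftyOpNormedRing Matrix.linftyOpNormedAlgebra

variable {m d r : ℕ} {ν : Fin d → Fin m → ℤ} {n k : Fin r → ℕ}
  {F F₁ : Type} [NormedAddCommGroup F] [NormedSpace ℝ F]
  [NormedAddCommGroup F₁] [NormedSpace ℝ F₁]
  [ChartedSpace F (Base ν n k)] [ChartedSpace F₁ (TotalSpace ν n k)]
  {a : Fin d → ℤ} {b : Fin r → ℤ}

/-! ### The circle action is smooth -/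

/-- Near θ(g₀) the acting element is exp of a smooth angle times θ(g₀), so the action lifts to (t,
v) ↦ ε(angle t)·g₀·sec(v) in the level set. -/
theorem contMDiffSMul_circle [MulAction Circle (TotalSpace ν n k)]
    {θ : G ν k →* Circle} (h : IsSmoothQuotient F₁ (toTotalSpace ν n k))
    (hact : ∀ (g : G ν k) (z : Level ν n k),
      θ g • toTotalSpace ν n k z = toTotalSpace ν n k (g • z))
    (hθ : Function.Surjective θ) {ε : ℝ → G ν k}
    (hε : ContDiff ℝ ∞ fun s => coords ν k (ε s)) (hεθ : ∀ s, θ (ε s) = Circle.exp s) :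
    ContMDiffSMul (𝓡 1) 𝓘(ℝ, F₁) ∞ Circle (TotalSpace ν n k) := by
  refine ⟨fun ⟨a₀, v₀⟩ => ?_⟩
  obtain ⟨z₀, rfl⟩ := h.isOpenQuotientMap.surjective v₀
  obtain ⟨g₀, rfl⟩ := hθ a₀
  obtain ⟨sec, -, hs⟩ := h.exists_section z₀
  let ang : Circle → ℝ := fun x => (Complex.log ((x : ℂ) * ((θ g₀)⁻¹ : Circle))).im
  have hang : ContMDiffAt (𝓡 1) 𝓘(ℝ, ℝ) ∞ ang (θ g₀) :=
    ContMDiffAt.comp (I' := 𝓘(ℝ, ℂ)) (θ g₀)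
      (g := fun w : ℂ => (Complex.log (w * ((θ g₀)⁻¹ : Circle))).im) (f := fun x : Circle => (x : ℂ))
      (contDiffAt_angle (θ g₀)).contMDiffAt contMDiff_circle_coe.contMDiffAt
  let γ : Circle × TotalSpace ν n k → Level ν n k := fun p => ε (ang p.1) • g₀ • sec p.2
  have h1 : ContMDiffAt ((𝓡 1).prod 𝓘(ℝ, F₁)) 𝓘(ℝ, Idx d n k → ℂ) ∞
      (fun p => (γ p : Idx d n k → ℂ)) (θ g₀, toTotalSpace ν n k z₀) := by
    have h2 : ContMDiffAt ((𝓡 1).prod 𝓘(ℝ, F₁)) 𝓘(ℝ, ℝ × (Idx d n k → ℂ)) ∞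
        (fun p : Circle × TotalSpace ν n k => (ang p.1, (sec p.2 : Idx d n k → ℂ)))
        (θ g₀, toTotalSpace ν n k z₀) := by
      refine ContMDiffAt.prodMk_space ?_ ?_
      · exact ContMDiffAt.comp (θ g₀, toTotalSpace ν n k z₀) (g := ang) (f := Prod.fst)
          hang contMDiffAt_fst
      · exact ContMDiffAt.comp (θ g₀, toTotalSpace ν n k z₀)
          (g := fun v => (sec v : Idx d n k → ℂ)) (f := Prod.snd)
          hs.self_of_nhds.2 contMDiffAt_snd
    have h3 : ContDiff ℝ ∞ fun p : ℝ × (Idx d n k → ℂ) =>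
        act n k (coords ν k (ε p.1)) (act n k (coords ν k g₀) p.2) :=
      (contDiff_act_coords hε).comp
        (contDiff_fst.prodMk ((act n k (coords ν k g₀)).contDiff.comp contDiff_snd))
    have h4 := ContMDiffAt.comp (I' := 𝓘(ℝ, ℝ × (Idx d n k → ℂ))) (θ g₀, toTotalSpace ν n k z₀)
      (g := fun p : ℝ × (Idx d n k → ℂ) =>
        act n k (coords ν k (ε p.1)) (act n k (coords ν k g₀) p.2))
      (f := fun p : Circle × TotalSpace ν n k => (ang p.1, (sec p.2 : Idx d n k → ℂ)))
      h3.contDiffAt.contMDiffAt h2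
    refine h4.congr_of_eventuallyEq (Eventually.of_forall fun p => ?_)
    simp only [γ, ← act_coords, Function.comp_apply]
  refine (h.contMDiffAt_comp h1).congr_of_eventuallyEq ?_
  have h2 : ∀ᶠ p : Circle × TotalSpace ν n k in 𝓝 (θ g₀, toTotalSpace ν n k z₀),
      toTotalSpace ν n k (sec p.2) = p.2 :=
    (continuous_snd.tendsto (θ g₀, toTotalSpace ν n k z₀)).eventually (hs.mono fun v hv => hv.1)
  filter_upwards [h2] with p hp
  rw [← hact, hεθ, ← hact, smul_smul, exp_angle, hp]

/-! ### The projection and the local trivializations -/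

theorem contMDiff_proj (hV : IsSmoothQuotient F₁ (toTotalSpace ν n k))
    (hM : IsSmoothQuotient F (toBase ν n k)) :
    ContMDiff 𝓘(ℝ, F₁) 𝓘(ℝ, F) ∞ (proj ν n k) := by
  intro v
  obtain ⟨z, rfl⟩ := hV.isOpenQuotientMap.surjective v
  obtain ⟨sec, -, hs⟩ := hV.exists_section z
  refine (hM.contMDiffAt_comp hs.self_of_nhds.2).congr_of_eventuallyEq ?_
  filter_upwards [hs] with v hv
  rw [← proj_toTotalSpace, hv.1]

theorem proj_smul [MulAction Circle (TotalSpace ν n k)]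
    {θ : G ν k →* Circle} (hact : ∀ (g : G ν k) (z : Level ν n k),
      θ g • toTotalSpace ν n k z = toTotalSpace ν n k (g • z)) (hθ : Function.Surjective θ)
    (x : Circle) (v : TotalSpace ν n k) : proj ν n k (x • v) = proj ν n k v := by
  obtain ⟨z, rfl⟩ := (isOpenQuotientMap_toTotalSpace (ν := ν) (n := n) (k := k)).surjective v
  obtain ⟨g, rfl⟩ := hθ x
  rw [hact, proj_toTotalSpace, proj_toTotalSpace, toBase_eq_iff]
  exact ⟨g, rfl⟩

namespace LocalSlice

variable {z₀ : Level ν n k} {c : ℕ} (S : LocalSlice z₀ c)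

theorem smul_mem (g : G ν k) {z : Level ν n k} (hz : (z : Idx d n k → ℂ) ∈ S.O) :
    ((g • z : Level ν n k) : Idx d n k → ℂ) ∈ S.O := by
  rw [← act_coords]; exact S.act_mem g z hz

theorem Γ_smul (g : G ν k) {z : Level ν n k} (hz : (z : Idx d n k → ℂ) ∈ S.O) :
    S.Γ (g • z : Level ν n k) = g * S.Γ z := by
  rw [← act_coords]; exact S.Γ_act g z hz

/-- The domain of the local trivialization. -/
def baseSet : Set (Base ν n k) := toBase ν n k '' {z | (z : Idx d n k → ℂ) ∈ S.O}

theorem isOpen_baseSet : IsOpen S.baseSet :=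
  isOpenQuotientMap_toBase.isOpenMap _ (S.isOpen_O.preimage continuous_subtype_val)

theorem toBase_mem_baseSet {z : Level ν n k} :
    toBase ν n k z ∈ S.baseSet ↔ (z : Idx d n k → ℂ) ∈ S.O := by
  refine ⟨?_, fun h => ⟨z, h, rfl⟩⟩
  rintro ⟨z', hz', h⟩
  obtain ⟨g, rfl⟩ := toBase_eq_iff.1 h.symm
  exact S.smul_mem g hz'

/-- The section of the projection to the base given by the equivariant map. -/
noncomputable def baseSection (x : Base ν n k) : Level ν n k :=
  (S.Γ (Function.surjInv (isOpenQuotientMap_toBase (ν := ν) (n := n) (k := k)).surjective x :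
    Level ν n k))⁻¹ •
    Function.surjInv (isOpenQuotientMap_toBase (ν := ν) (n := n) (k := k)).surjective x

theorem baseSection_toBase {z : Level ν n k} (hz : (z : Idx d n k → ℂ) ∈ S.O) :
    S.baseSection (toBase ν n k z) = (S.Γ z)⁻¹ • z := by
  have hs := (isOpenQuotientMap_toBase (ν := ν) (n := n) (k := k)).surjective
  obtain ⟨g, hg⟩ := toBase_eq_iff.1 (Function.surjInv_eq hs (toBase ν n k z))
  rw [baseSection, ← hg, S.Γ_smul g hz, smul_smul, _root_.mul_inv_rev, inv_mul_cancel_right]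

/-- The fibre coordinate of the local trivialization. -/
noncomputable def fibreCoord (θ : G ν k →* Circle) (v : TotalSpace ν n k) : Circle :=
  θ (S.Γ (Function.surjInv (isOpenQuotientMap_toTotalSpace (ν := ν) (n := n) (k := k)).surjective v :
    Level ν n k))

theorem fibreCoord_toTotalSpace {θ : G ν k →* Circle} (hker : θ.ker = G0tau ν n k)
    {z : Level ν n k} (hz : (z : Idx d n k → ℂ) ∈ S.O) :
    S.fibreCoord θ (toTotalSpace ν n k z) = θ (S.Γ z) := by
  have hs := (isOpenQuotientMap_toTotalSpace (ν := ν) (n := n) (k := k)).surjective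
  obtain ⟨g, hgK, hg⟩ := toTotalSpace_eq_iff.1 (Function.surjInv_eq hs (toTotalSpace ν n k z))
  rw [← hker, MonoidHom.mem_ker] at hgK
  rw [fibreCoord, ← hg, S.Γ_smul g hz, map_mul, hgK, one_mul]

theorem contMDiffAt_baseSection (hM : IsSmoothQuotient F (toBase ν n k)) {x : Base ν n k}
    (hx : x ∈ S.baseSet) :
    ContMDiffAt 𝓘(ℝ, F) 𝓘(ℝ, Idx d n k → ℂ) ∞ (fun x => (S.baseSection x : Idx d n k → ℂ)) x := by
  obtain ⟨z, hz, rfl⟩ := hx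
  refine hM.contMDiffAt_of_lift (g := S.toSlice)
    (S.contDiffOn_toSlice.contDiffAt (S.isOpen_O.mem_nhds hz)).contMDiffAt ?_
  filter_upwards [(S.isOpen_O.preimage continuous_subtype_val).mem_nhds hz] with z' hz'
  rw [S.baseSection_toBase hz', S.toSlice_coe]

theorem contMDiffAt_fibreCoord (hV : IsSmoothQuotient F₁ (toTotalSpace ν n k))
    (hker : (character ν k a b).ker = G0tau ν n k) {v : TotalSpace ν n k}
    (hv : proj ν n k v ∈ S.baseSet) :
    ContMDiffAt 𝓘(ℝ, F₁) (𝓡 1) ∞ (S.fibreCoord (character ν k a b)) v := by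
  obtain ⟨z, rfl⟩ := hV.isOpenQuotientMap.surjective v
  rw [proj_toTotalSpace, S.toBase_mem_baseSet] at hv
  refine contMDiffAt_circle (hV.contMDiffAt_of_lift
    (g := fun z => characterExt a b (coords ν k (S.Γ z)))
    ((S.contDiffOn_characterExt a b).contDiffAt (S.isOpen_O.mem_nhds hv)).contMDiffAt ?_)
  filter_upwards [(S.isOpen_O.preimage continuous_subtype_val).mem_nhds hv] with z' hz'
  rw [S.fibreCoord_toTotalSpace hker hz', characterExt_coords]

theorem contMDiffAt_smul_baseSection [MulAction Circle (TotalSpace ν n k)]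
    (hV : IsSmoothQuotient F₁ (toTotalSpace ν n k))
    (hM : IsSmoothQuotient F (toBase ν n k))
    (hsm : ContMDiffSMul (𝓡 1) 𝓘(ℝ, F₁) ∞ Circle (TotalSpace ν n k))
    {p : Base ν n k × Circle} (hp : p.1 ∈ S.baseSet) :
    ContMDiffAt (𝓘(ℝ, F).prod (𝓡 1)) 𝓘(ℝ, F₁) ∞
      (fun p : Base ν n k × Circle => p.2 • toTotalSpace ν n k (S.baseSection p.1)) p := by
  have h1 : ContMDiffAt 𝓘(ℝ, F) 𝓘(ℝ, F₁) ∞ (fun x => toTotalSpace ν n k (S.baseSection x)) p.1 :=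
    hV.contMDiffAt_comp (S.contMDiffAt_baseSection hM hp)
  have h2 : ContMDiffAt (𝓘(ℝ, F).prod (𝓡 1)) 𝓘(ℝ, F₁) ∞
      (fun p : Base ν n k × Circle => toTotalSpace ν n k (S.baseSection p.1)) p :=
    ContMDiffAt.comp p (g := fun x => toTotalSpace ν n k (S.baseSection x)) (f := Prod.fst)
      h1 contMDiffAt_fst
  exact ContMDiffAt.comp p (g := fun q : Circle × TotalSpace ν n k => q.1 • q.2)
    (f := fun p : Base ν n k × Circle => (p.2, toTotalSpace ν n k (S.baseSection p.1)))
    hsm.contMDiff_smul.contMDiffAt (contMDiffAt_snd.prodMk h2)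

/-- The local trivialization given by a slice. -/
noncomputable def trivialization [MulAction Circle (TotalSpace ν n k)]
    (hV : IsSmoothQuotient F₁ (toTotalSpace ν n k))
    (hM : IsSmoothQuotient F (toBase ν n k))
    (hker : (character ν k a b).ker = G0tau ν n k)
    (hact : ∀ (g : G ν k) (z : Level ν n k),
      character ν k a b g • toTotalSpace ν n k z = toTotalSpace ν n k (g • z))
    (hθ : Function.Surjective (character ν k a b))
    (hsm : ContMDiffSMul (𝓡 1) 𝓘(ℝ, F₁) ∞ Circle (TotalSpace ν n k)) :
    Bundle.Trivialization Circle (proj ν n k) where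
  toFun v := (proj ν n k v, S.fibreCoord (character ν k a b) v)
  invFun p := p.2 • toTotalSpace ν n k (S.baseSection p.1)
  source := proj ν n k ⁻¹' S.baseSet
  target := S.baseSet ×ˢ Set.univ
  map_source' v hv := ⟨hv, trivial⟩
  map_target' := by
    rintro ⟨x, t⟩ ⟨⟨z, hz, rfl⟩, -⟩
    rw [Set.mem_preimage, proj_smul hact hθ, proj_toTotalSpace, S.baseSection_toBase hz,
      S.toBase_mem_baseSet]
    exact S.smul_mem _ hz
  left_inv' v hv := by
    obtain ⟨z, rfl⟩ := hV.isOpenQuotientMap.surjective v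
    rw [Set.mem_preimage, proj_toTotalSpace, S.toBase_mem_baseSet] at hv
    rw [S.fibreCoord_toTotalSpace hker hv, proj_toTotalSpace, S.baseSection_toBase hv, hact,
      smul_inv_smul]
  right_inv' := by
    rintro ⟨x, t⟩ ⟨⟨z, hz, rfl⟩, -⟩
    obtain ⟨g, rfl⟩ := hθ t
    have h1 := S.smul_mem (S.Γ z)⁻¹ hz
    refine Prod.ext ?_ ?_
    · change proj ν n k (character ν k a b g • toTotalSpace ν n k (S.baseSection (toBase ν n k z))) = _
      rw [proj_smul hact hθ, proj_toTotalSpace, S.baseSection_toBase hz, toBase_eq_iff]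
      exact ⟨_, rfl⟩
    · change S.fibreCoord _ (character ν k a b g •
        toTotalSpace ν n k (S.baseSection (toBase ν n k z))) = _
      rw [S.baseSection_toBase hz, hact, S.fibreCoord_toTotalSpace hker (S.smul_mem g h1),
        S.Γ_smul g h1, S.Γ_smul _ hz, inv_mul_cancel, mul_one]
  open_source := S.isOpen_baseSet.preimage (contMDiff_proj hV hM).continuous
  open_target := S.isOpen_baseSet.prod isOpen_univ
  continuousOn_toFun := (contMDiff_proj hV hM).continuous.continuousOn.prodMk fun v hv =>
    (S.contMDiffAt_fibreCoord hV hker hv).continuousAt.continuousWithinAt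
  continuousOn_invFun p hp :=
    (S.contMDiffAt_smul_baseSection hV hM hsm hp.1).continuousAt.continuousWithinAt
  baseSet := S.baseSet
  open_baseSet := S.isOpen_baseSet
  source_eq := rfl
  target_eq := rfl
  proj_toFun v _ := rfl

end LocalSlice

theorem isPrincipalCircleBundle_proj [MulAction Circle (TotalSpace ν n k)]
    (hν : IsMonotoneDelzant ν) (hn : ∀ i, 1 ≤ n i)
    (hV : IsSmoothQuotient F₁ (toTotalSpace ν n k)) (hM : IsSmoothQuotient F (toBase ν n k))
    (hker : (character ν k a b).ker = G0tau ν n k)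
    (hact : ∀ (g : G ν k) (z : Level ν n k),
      character ν k a b g • toTotalSpace ν n k z = toTotalSpace ν n k (g • z))
    {ε : ℝ → G ν k} (hε : ContDiff ℝ ∞ fun s => coords ν k (ε s))
    (hεθ : ∀ s, character ν k a b (ε s) = Circle.exp s) :
    IsPrincipalCircleBundle F₁ F (proj ν n k) := by
  have hθ : Function.Surjective (character ν k a b) := fun t =>
    ⟨ε (Complex.arg t), by rw [hεθ, Circle.exp_arg]⟩
  have hsm := contMDiffSMul_circle hV hact hθ hε hεθ
  refine ⟨hsm, contMDiff_proj hV hM, proj_smul hact hθ, fun x => ?_⟩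
  obtain ⟨z₀, rfl⟩ := hM.isOpenQuotientMap.surjective x
  obtain ⟨c, -, ⟨S⟩⟩ := exists_slice hν hn z₀
  refine ⟨S.trivialization hV hM hker hact hθ hsm, S.toBase_mem_baseSet.2 S.self_mem_O,
    fun v hv => ?_, fun p hp => ?_, fun t v hv => ?_⟩
  · exact ((contMDiff_proj hV hM v).prodMk
      (S.contMDiffAt_fibreCoord hV hker hv)).contMDiffWithinAt
  · exact (S.contMDiffAt_smul_baseSection hV hM hsm hp.1).contMDiffWithinAt
  · obtain ⟨z, rfl⟩ := hV.isOpenQuotientMap.surjective v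
    obtain ⟨g, rfl⟩ := hθ t
    have hz : (z : Idx d n k → ℂ) ∈ S.O := S.toBase_mem_baseSet.1 hv
    refine Prod.ext (proj_smul hact hθ _ _) ?_
    change S.fibreCoord _ (character ν k a b g • toTotalSpace ν n k z) =
      character ν k a b g * S.fibreCoord _ (toTotalSpace ν n k z)
    rw [hact, S.fibreCoord_toTotalSpace hker (S.smul_mem g hz), S.fibreCoord_toTotalSpace hker hz,
      S.Γ_smul g hz, map_mul]

/-! ### The connection form -/

theorem DiffForm_pullback_congr {E E' V M : Type} [NormedAddCommGroup E] [NormedSpace ℝ E]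
    [NormedAddCommGroup E'] [NormedSpace ℝ E'] [TopologicalSpace V] [ChartedSpace E V]
    [TopologicalSpace M] [ChartedSpace E' M] {q : ℕ} {f f' : V → M} (β : DiffForm E' M q) {x : V}
    (h : f =ᶠ[𝓝 x] f') :
    DiffForm.pullback (E := E) f β x = DiffForm.pullback (E := E) f' β x := by
  have h1 : mfderiv 𝓘(ℝ, E) 𝓘(ℝ, E') f x = mfderiv 𝓘(ℝ, E) 𝓘(ℝ, E') f' x := h.mfderiv_eq
  unfold DiffForm.pullback
  rw [h1, h.self_of_nhds]

theorem liouvilleForm_smul (g : G ν k) (z : Level ν n k) (w : Fin 1 → Idx d n k → ℂ) :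
    liouvilleForm (Idx d n k) (g • z : Level ν n k) (fun i => act n k (coords ν k g) (w i)) =
      liouvilleForm (Idx d n k) z w := by
  have h : omega _ ((g • z : Level ν n k) : Idx d n k → ℂ) (act n k (coords ν k g) (w 0)) =
      omega _ (z : Idx d n k → ℂ) (w 0) := by
    rw [← act_coords, omega_act_coords]
  rw [liouvilleForm_apply, liouvilleForm_apply, h]

/-- A section followed by g is a lift of the action of θ(g), and g is linear and preserves ω_std. -/
theorem form_invariant [MulAction Circle (TotalSpace ν n k)]
    {θ : G ν k →* Circle} (hV : IsSmoothQuotient F₁ (toTotalSpace ν n k))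
    (hβ : IsBasicForm (toTotalSpace ν n k) (liouvilleForm (Idx d n k)))
    (hact : ∀ (g : G ν k) (z : Level ν n k),
      θ g • toTotalSpace ν n k z = toTotalSpace ν n k (g • z))
    (hθ : Function.Surjective θ) (t : Circle) :
    (hV.form (liouvilleForm (Idx d n k))).pullback (fun v : TotalSpace ν n k => t • v) =
      hV.form (liouvilleForm (Idx d n k)) := by
  obtain ⟨g, rfl⟩ := hθ t
  funext v
  have hs := hV.contMDiffAt_sectionAt v
  have hg : ContMDiffAt 𝓘(ℝ, F₁) 𝓘(ℝ, Idx d n k → ℂ) ∞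
      (fun x => ((g • hV.sectionAt v x : Level ν n k) : Idx d n k → ℂ)) v := by
    simp only [← act_coords]
    exact ContMDiffAt.comp (I' := 𝓘(ℝ, Idx d n k → ℂ)) v (g := act n k (coords ν k g))
      (act n k (coords ν k g)).contDiff.contDiffAt.contMDiffAt hs
  have h1 : (fun x : TotalSpace ν n k => θ g • x) =ᶠ[𝓝 v]
      fun x => toTotalSpace ν n k (g • hV.sectionAt v x) := by
    filter_upwards [hV.eventually_sectionAt v] with x hx
    rw [← hact, hx.1]
  rw [DiffForm_pullback_congr _ h1, hV.form_pullback hβ hg]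
  have h2 : mfderiv 𝓘(ℝ, F₁) 𝓘(ℝ, Idx d n k → ℂ)
      (fun x => ((g • hV.sectionAt v x : Level ν n k) : Idx d n k → ℂ)) v =
      (act n k (coords ν k g)).comp (mfderiv 𝓘(ℝ, F₁) 𝓘(ℝ, Idx d n k → ℂ)
        (fun x => (hV.sectionAt v x : Idx d n k → ℂ)) v) := by
    simp only [← act_coords]
    have h3 : HasMFDerivAt 𝓘(ℝ, Idx d n k → ℂ) 𝓘(ℝ, Idx d n k → ℂ) (act n k (coords ν k g))
        (hV.sectionAt v v : Idx d n k → ℂ) (act n k (coords ν k g)) :=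
      (act n k (coords ν k g)).hasFDerivAt.hasMFDerivAt
    exact (h3.comp v (hs.mdifferentiableAt (by simp)).hasMFDerivAt).mfderiv
  rw [h2]
  exact ContinuousAlternatingMap.ext fun u => liouvilleForm_smul g (hV.sectionAt v v) fun i =>
    mfderiv 𝓘(ℝ, F₁) 𝓘(ℝ, Idx d n k → ℂ)
      (fun x => (hV.sectionAt v x : Idx d n k → ℂ)) v (u i)

/-- The generator lifts to the orbit direction Xz, on which the Liouville form is the constant p(X).
-/
theorem form_generator [MulAction Circle (TotalSpace ν n k)]
    {c : ℝ} (hV : IsSmoothQuotient F₁ (toTotalSpace ν n k))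
    (hβ : IsBasicForm (toTotalSpace ν n k) (liouvilleForm (Idx d n k)))
    (hact : ∀ (g : G ν k) (z : Level ν n k),
      character ν k a b g • toTotalSpace ν n k z = toTotalSpace ν n k (g • z))
    {ε : ℝ → G ν k} (hε0 : ε 0 = 1) (hε : ContDiff ℝ ∞ fun s => coords ν k (ε s))
    (hεθ : ∀ s, character ν k a b (ε s) = Circle.exp s) {X : lieG ν k}
    (hεd : HasDerivAt (fun s => coords ν k (ε s)) (lieCoords ν k X) 0)
    (hX : characterDeriv ν k 1 (fun i => n i) X = c) (v : TotalSpace ν n k) :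
    hV.form (liouvilleForm (Idx d n k)) (Circle.exp 0 • v)
      ![mfderiv 𝓘(ℝ, ℝ) 𝓘(ℝ, F₁) (fun s : ℝ => Circle.exp s • v) 0 (1 : ℝ)] = 1 / 2 * c := by
  obtain ⟨z, rfl⟩ := hV.isOpenQuotientMap.surjective v
  have h1 : (fun s : ℝ => Circle.exp s • toTotalSpace ν n k z) =
      fun s => toTotalSpace ν n k (ε s • z) := funext fun s => by rw [← hact, hεθ]
  have h0 : Circle.exp 0 • toTotalSpace ν n k z = toTotalSpace ν n k (ε 0 • z) := congrFun h1 0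
  have hg : ContMDiffAt 𝓘(ℝ, ℝ) 𝓘(ℝ, Idx d n k → ℂ) ∞
      (fun s => ((ε s • z : Level ν n k) : Idx d n k → ℂ)) (0 : ℝ) :=
    (contDiff_orbit hε z).contDiffAt.contMDiffAt
  have h2 := hV.form_pullback_apply hβ hg (fun _ => (1 : ℝ))
  rw [mfderiv_eq_fderiv] at h2
  rw [h1, h0]
  have h3 : (fun _ : Fin 1 => fderiv ℝ (fun s => ((ε s • z : Level ν n k) : Idx d n k → ℂ)) 0 (1 : ℝ)) =
      fun _ => act n k (lieCoords ν k X) z := funext fun _ => (hasDerivAt_orbit hεd z).deriv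
  refine Eq.trans ?_ (h2.trans ?_)
  · congr 1
    funext i
    rw [Subsingleton.elim i 0]
    rfl
  · refine (congrArg (liouvilleForm (Idx d n k) (ε 0 • z : Level ν n k)) h3).trans ?_
    rw [liouvilleForm_apply, hε0, one_smul, momentMap_eq_characterDeriv, hX]

/-- A local section of V lifts both the identity of V and, after projection to the base, the map π;
both sides are the pullback of dα_std along it. -/
theorem form_curvature (hV : IsSmoothQuotient F₁ (toTotalSpace ν n k))
    (hM : IsSmoothQuotient F (toBase ν n k))
    (hβ : IsBasicForm (toTotalSpace ν n k) (liouvilleForm (Idx d n k)))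
    (hω : IsBasicForm (toBase ν n k) (extDeriv (liouvilleForm (Idx d n k)))) [FiniteDimensional ℝ F₁] :
    (hV.form (liouvilleForm (Idx d n k))).d =
      (hM.form (extDeriv (liouvilleForm (Idx d n k)))).pullback (proj ν n k) := by
  rw [hV.form_d hβ contDiff_liouvilleForm_apply]
  funext v
  have h1 : proj ν n k =ᶠ[𝓝 v] fun x => toBase ν n k (hV.sectionAt v x) := by
    filter_upwards [hV.eventually_sectionAt v] with x hx
    rw [← proj_toTotalSpace, hx.1]
  rw [DiffForm_pullback_congr _ h1, hM.form_pullback hω (hV.contMDiffAt_sectionAt v)]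
  rfl

theorem form_isSymplectic [FiniteDimensional ℝ F] {F₀ : Type} [NormedAddCommGroup F₀]
    [NormedSpace ℝ F₀] [ChartedSpace F₀ (Level ν n k)]
    (hν : IsMonotoneDelzant ν) (hn : ∀ i, 1 ≤ n i)
    (hZ : IsSmoothQuotient F₀ (id : Level ν n k → Level ν n k))
    (hM : IsSmoothQuotient F (toBase ν n k)) {e : ℕ}
    (he : Module.finrank ℝ (Idx d n k → ℂ) = Module.finrank ℝ (lieG ν k) + e) :
    (hM.form (extDeriv (liouvilleForm (Idx d n k)))).IsSymplectic where
  smooth := hM.form_isSmooth (isBasicForm_extDeriv_liouvilleForm hν hn)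
    contDiff_extDeriv_liouvilleForm_apply
  closed := by
    rw [hM.form_d (isBasicForm_extDeriv_liouvilleForm hν hn) contDiff_extDeriv_liouvilleForm_apply,
      extDeriv_extDeriv_liouvilleForm]
    rfl
  nondegenerate := form_nondegenerate hν hn hZ hM he

end PrincipalBundle

end ToricGrassmann

/-! ### Assembly of the prequantization bundle -/

open ToricGrassmann in
theorem mainTheorem6 {m d r : ℕ} (ν : Fin d → Fin m → ℤ) (n k : Fin r → ℕ)
    (hν : IsMonotoneDelzant ν) (heven : ∃ u : Fin m → ℤ, ∑ j, ν j = 2 • u)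
    (hk : ∀ i, 1 ≤ k i) (hkn : ∀ i, k i ≤ n i) (hpos : 0 < d ∨ 0 < r) :
    ∃ (a b c : ℕ)
      (_ : ChartedSpace (EuclideanSpace ℝ (Fin a)) (Level ν n k))
      (_ : ChartedSpace (EuclideanSpace ℝ (Fin b)) (TotalSpace ν n k))
      (_ : ChartedSpace (EuclideanSpace ℝ (Fin c)) (Base ν n k))
      (_ : MulAction Circle (TotalSpace ν n k))
      (θ : G ν k →* Circle)
      (α : DiffForm (EuclideanSpace ℝ (Fin b)) (TotalSpace ν n k) 1)
      (Ω : DiffForm (EuclideanSpace ℝ (Fin c)) (Base ν n k) 2),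
      -- the level set is an embedded submanifold of the complex vector space
      IsManifold (𝓡 a) ∞ (Level ν n k) ∧
      (ContMDiff (𝓡 a) 𝓘(ℝ, Idx d n k → ℂ) ∞ (Subtype.val : Level ν n k → (Idx d n k → ℂ)) ∧
        ∀ z : Level ν n k, Function.Injective
          (mfderiv (𝓡 a) 𝓘(ℝ, Idx d n k → ℂ) (Subtype.val : Level ν n k → (Idx d n k → ℂ)) z)) ∧
      -- the two quotient projections are submersions
      (ContMDiff (𝓡 a) (𝓡 b) ∞ (toTotalSpace ν n k) ∧
        ∀ z, Function.Surjective (mfderiv (𝓡 a) (𝓡 b) (toTotalSpace ν n k) z)) ∧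
      (ContMDiff (𝓡 a) (𝓡 c) ∞ (toBase ν n k) ∧
        ∀ z, Function.Surjective (mfderiv (𝓡 a) (𝓡 c) (toBase ν n k) z)) ∧
      -- the circle acting on the total space is the quotient of `G` by `G_0^τ`
      Continuous θ ∧ Function.Surjective θ ∧ θ.ker = G0tau ν n k ∧
      (∀ (g : G ν k) (z : Level ν n k),
        θ g • toTotalSpace ν n k z = toTotalSpace ν n k (g • z)) ∧
      -- the forms are induced by the standard ones
      (∀ (z : Level ν n k) (X : TangentSpace (𝓡 a) z),
        α (toTotalSpace ν n k z) ![mfderiv (𝓡 a) (𝓡 b) (toTotalSpace ν n k) z X] =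
          stdLiouville (z : Idx d n k → ℂ)
            (mfderiv (𝓡 a) 𝓘(ℝ, Idx d n k → ℂ) Subtype.val z X)) ∧
      (∀ (z : Level ν n k) (X Y : TangentSpace (𝓡 a) z),
        Ω (toBase ν n k z) ![mfderiv (𝓡 a) (𝓡 c) (toBase ν n k) z X,
            mfderiv (𝓡 a) (𝓡 c) (toBase ν n k) z Y] =
          stdSymplectic
            (mfderiv (𝓡 a) 𝓘(ℝ, Idx d n k → ℂ) (Subtype.val : Level ν n k → (Idx d n k → ℂ)) z X)
            (mfderiv (𝓡 a) 𝓘(ℝ, Idx d n k → ℂ)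
              (Subtype.val : Level ν n k → (Idx d n k → ℂ)) z Y)) ∧
      IsPrequantizationBundle α (proj ν n k) Ω := by
  have hn : ∀ i, 1 ≤ n i := fun i => (hk i).trans (hkn i)
  obtain ⟨a, b, c, hc, hker, hcX, X, hX⟩ := exists_character_ker_eq hν heven hk hn hpos
  obtain ⟨ε, hε0, -, hε, hεd, hεX⟩ := exists_oneParam X
  have hεθ : ∀ s, character ν k a b (ε s) = Circle.exp s := fun s => by rw [hεX, hX, mul_one]
  have hθ : Function.Surjective (character ν k a b) := fun t =>
    ⟨ε (Complex.arg t), by rw [hεθ, Circle.exp_arg]⟩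
  obtain ⟨hcomp, hconn⟩ := compactSpace_connectedSpace_level hν hn hkn
  -- The slice dimension is the same at all points, since dim ℂ^D = 2 dim 𝔤 + e determines it; a
  -- single model space therefore serves for M, and another for V.
  obtain ⟨e, he⟩ : ∃ e : ℕ, ∀ z₀ : Level ν n k,
      Module.finrank ℝ (Idx d n k → ℂ) = 2 * Module.finrank ℝ (lieG ν k) + e ∧
        Nonempty (LocalSlice z₀ e) := by
    obtain ⟨z₁⟩ := hconn.toNonempty
    obtain ⟨e, he, -⟩ := exists_slice hν hn z₁
    refine ⟨e, fun z₀ => ?_⟩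
    obtain ⟨e', he', hS⟩ := exists_slice hν hn z₀
    obtain rfl : e' = e := by omega
    exact ⟨he, hS⟩
  have hfin : Module.finrank ℝ (Idx d n k → ℂ) =
      Module.finrank ℝ (lieG ν k) + (Module.finrank ℝ (lieG ν k) + e) := by
    obtain ⟨z₁⟩ := hconn.toNonempty
    have := (he z₁).1
    omega
  let E : (EuclideanSpace ℝ (Fin e) × ℝ) ≃L[ℝ] EuclideanSpace ℝ (Fin (e + 1)) :=
    ContinuousLinearEquiv.ofFinrankEq (by simp)
  obtain ⟨instZ, hZ⟩ := exists_isSmoothQuotient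
    (IsOpenQuotientMap.id : IsOpenQuotientMap (id : Level ν n k → Level ν n k)) fun z₀ => by
      obtain ⟨C, h1, h2, -⟩ := exists_levelChart hν hn hfin z₀
      exact ⟨C, h1, h2⟩
  obtain ⟨instV, hV⟩ := exists_isSmoothQuotient (isOpenQuotientMap_toTotalSpace (ν := ν) (n := n)
    (k := k)) fun z₀ => by
      obtain ⟨-, ⟨S⟩⟩ := he z₀
      exact ⟨S.totalChart hker hε hεθ E, S.self_mem_totalChart hker hε0 hε hεθ E⟩
  obtain ⟨instM, hM⟩ := exists_isSmoothQuotient (isOpenQuotientMap_toBase (ν := ν) (n := n)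
    (k := k)) fun z₀ => by
      obtain ⟨-, ⟨S⟩⟩ := he z₀
      exact ⟨S.baseChart, S.self_mem_baseChart⟩
  obtain ⟨instA, hact⟩ := exists_circleAction hθ hker
  have hβ := isBasicForm_liouvilleForm hν hn hker hcX
  have hω := isBasicForm_extDeriv_liouvilleForm (ν := ν) (n := n) (k := k) hν hn
  refine ⟨_, _, _, instZ, instV, instM, instA, character ν k a b,
    hV.form (liouvilleForm (Idx d n k)), hM.form (extDeriv (liouvilleForm (Idx d n k))),
    hZ.isManifold, ⟨hZ.contMDiff_val, hZ.mfderiv_val_injective⟩,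
    ⟨hZ.contMDiff_quot hV, hZ.mfderiv_quot_surjective hV⟩,
    ⟨hZ.contMDiff_quot hM, hZ.mfderiv_quot_surjective hM⟩,
    continuous_character a b, hθ, hker, hact, fun z Y => ?_, fun z Y Y' => ?_, ?_⟩
  · refine Eq.trans ?_ (hZ.form_quot_apply hV hβ z fun _ => Y)
    congr 1
    funext i
    rw [Subsingleton.elim i 0]
    rfl
  · refine Eq.trans ?_ ((hZ.form_quot_apply hM hω z ![Y, Y']).trans
      (extDeriv_liouvilleForm z.1 _))
    congr 1
    funext i
    fin_cases i <;> rfl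
  · exact
      { isManifold_total := hV.isManifold
        isManifold_base := hM.isManifold
        t2_total := t2Space_totalSpace hν hker
        t2_base := t2Space_base hν
        compact_total := hV.isOpenQuotientMap.surjective.compactSpace
          hV.isOpenQuotientMap.continuous
        compact_base := hM.isOpenQuotientMap.surjective.compactSpace
          hM.isOpenQuotientMap.continuous
        connected_total := hV.isOpenQuotientMap.surjective.connectedSpace
          hV.isOpenQuotientMap.continuous
        connected_base := hM.isOpenQuotientMap.surjective.connectedSpace
          hM.isOpenQuotientMap.continuous
        symplectic := form_isSymplectic hν hn hZ hM hfin
        principal := isPrincipalCircleBundle_proj hν hn hV hM hker hact hε hεθ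
        smooth := hV.form_isSmooth hβ contDiff_liouvilleForm_apply
        invariant := form_invariant hV hβ hact hθ
        -- X is normalized so that the derivative of θ along it is 1. Then the derivative of det
        -- along it is `c`, and p(X) = c/2.
        connection := ⟨1 / 2 * c, by positivity,
          form_generator hV hβ hact hε0 hε hεθ hεd (by rw [hcX, hX, mul_one])⟩
        curvature := form_curvature hV hM hβ hω }
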